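/- Let $P$ be a convex polygon with $n\ge 3$ vertices, stored in an array in counterclockwise order along its boundary, and let $h$ be its horizontal width. A cut of $P$ is a vertical segment with both endpoints on $\partial P$ and all other points in the interior of $P$. A strip partition of $P$ is given by a finite set of cuts that divides $P$ into pieces of horizontal width at most $1$ (strips). The value version asks for the minimum number $\mathrm{opt}(P)$ of strips in a strip partition. The reporting version asks for the codeword of a strip partition with $\mathrm{opt}(P)$ strips. The descriptor of a cut consists of the boundary edges of $P$ that contain its top and its bottom endpoint (the left one, if the endpoint is on two edges) and of its $x$-coordinate. The codeword of a strip partition encodes the descriptors of its cuts from left to right: if $h<n$, in literal form (one record per cut); if $h\ge n$, in run-length form (one record for each maximal sequence of consecutive cuts at $x=t,t+1,\dots,t+m-1$ with the same pair of edges, which stores this pair together with $t$ and $m$). The model is the real RAM with unit-cost arithmetic ($+,-,\times,\div$) and comparisons on real numbers and with integer index arithmetic; there is no floor function, but the integer part $\lfloor x_i\rfloor$ of the $x$-coordinate of each vertex is given with the input. Then the following holds. (a) The value version can be solved in $O(\log n)$ time. (b) The encoding is lossless: every strip partition of $P$ has exactly one codeword, and different strip partitions of $P$ have different codewords. (c)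 For $h\ge 1$, the reporting version can be solved in $O\!\left(h\log\!\left(1+\frac{n}{h}\right)\right)$ time. The reported partition has its cuts at unit distances, at $x=x_{\min}+j$ for $1\le j<\lceil h\rceil$, where $x_{\min}$ is the $x$-coordinate of the leftmost points of $P$. Each algorithm is a single program that works for all $n$ and all $P$, and the constants hidden in the $O$-notation are absolute. -/

import Mathlib

namespace StripPartition

/-! ### Convex polygons, vertical cuts, strip partitions -/

/-- Twice the signed area of the triangle `a b c`;
nonnegative iff `c` is on or to the left of the directed line from `a` to `b`. -/
def cross (a b c : ℝ × ℝ) : ℝ :=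
  (b.1 - a.1) * (c.2 - a.2) - (b.2 - a.2) * (c.1 - a.1)

/-- `p 0, …, p (n-1)` are the vertices of a convex polygon in counterclockwise order: they are
distinct, not all collinear, and all of them lie on or to the left of the line through every
directed edge `p i → p (i+1)` (indices are cyclic). Vertices with a straight angle are allowed. -/
structure IsConvexPolygon {n : ℕ} [NeZero n] (p : Fin n → ℝ × ℝ) : Prop where
  three_le : 3 ≤ n
  injective : Function.Injective p
  left_of_edges : ∀ i j, 0 ≤ cross (p i) (p (i + 1)) (p j)
  not_collinear : ∃ i j, 0 < cross (p i) (p (i + 1)) (p j)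

/-- The region (interior and boundary) of the convex polygon with vertices `p`. -/
def region {n : ℕ} (p : Fin n → ℝ × ℝ) : Set (ℝ × ℝ) := convexHull ℝ (Set.range p)

/-- The `x`-coordinate of the leftmost points of a (compact) set. -/
noncomputable def leftX (X : Set (ℝ × ℝ)) : ℝ := sInf (Prod.fst '' X)

/-- The `x`-coordinate of the rightmost points of a (compact) set. -/
noncomputable def rightX (X : Set (ℝ × ℝ)) : ℝ := sSup (Prod.fst '' X)

/-- The horizontal width of a bounded nonempty set. -/
noncomputable def hwidth (X : Set (ℝ × ℝ)) : ℝ := rightX X - leftX X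

/-- A vertical segment, from `(x, bot)` to `(x, top)`. -/
@[ext]
structure VSegment where
  x : ℝ
  bot : ℝ
  top : ℝ

/-- The points of a vertical segment. -/
def VSegment.points (c : VSegment) : Set (ℝ × ℝ) := {q | q.1 = c.x ∧ c.bot ≤ q.2 ∧ q.2 ≤ c.top}

/-- A vertical cut of `P`: a vertical segment with both endpoints on the boundary of `P` and
all its other points in the interior of `P`. -/
def IsCut (P : Set (ℝ × ℝ)) (c : VSegment) : Prop :=
  c.bot < c.top ∧ (c.x, c.bot) ∈ frontier P ∧ (c.x, c.top) ∈ frontier P ∧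
    ∀ y, c.bot < y → y < c.top → (c.x, y) ∈ interior P

/-- The interior of `P` without the points of the cuts. -/
def uncut (P : Set (ℝ × ℝ)) (C : Finset VSegment) : Set (ℝ × ℝ) :=
  interior P \ ⋃ c ∈ C, c.points

/-- The pieces into which the cuts `C` divide `P`: the closures of the connected components of
what the cuts leave of the interior of `P`. -/
def pieces (P : Set (ℝ × ℝ)) (C : Finset VSegment) : Set (Set (ℝ × ℝ)) :=
  {Q | ∃ q ∈ uncut P C, Q = closure (connectedComponentIn (uncut P C) q)}

/-- The cuts `C` divide `P` into strips, that is, pieces of horizontal width at most one. -/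
def IsStripPartition (P : Set (ℝ × ℝ)) (C : Finset VSegment) : Prop :=
  (∀ c ∈ C, IsCut P c) ∧ ∀ Q ∈ pieces P C, hwidth Q ≤ 1

/-- `k` is the minimum number of strips over all strip partitions of `P`. -/
def IsOpt (P : Set (ℝ × ℝ)) (k : ℕ) : Prop :=
  IsLeast {m : ℕ | ∃ C, IsStripPartition P C ∧ (pieces P C).encard = m} k

/-- `C` is a strip partition of `P` with the minimum number of strips. -/
def IsOptimalStripPartition (P : Set (ℝ × ℝ)) (C : Finset VSegment) : Prop :=
  IsStripPartition P C ∧ ∃ k : ℕ, IsOpt P k ∧ (pieces P C).encard = k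

/-! ### Cut descriptors and their encodings -/

/-- The descriptor of a cut: the boundary edges that contain its top and bottom endpoints (edge
`i` joins the vertices `i` and `i + 1`) and its `x`-coordinate. -/
structure Descriptor (n : ℕ) where
  topEdge : Fin n
  botEdge : Fin n
  x : ℝ

/-- The point `q` lies on edge `i`, and this edge extends to the left of `q`. The second part
selects the left one of two edges that meet at `q`. -/
def OnLeftEdge {n : ℕ} [NeZero n] (p : Fin n → ℝ × ℝ) (q : ℝ × ℝ) (i : Fin n) : Prop :=
  q ∈ segment ℝ (p i) (p (i + 1)) ∧ min (p i).1 (p (i + 1)).1 < q.1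

/-- `d` is the descriptor of the cut `c` of the polygon with vertices `p`. -/
def IsDescriptor {n : ℕ} [NeZero n] (p : Fin n → ℝ × ℝ) (c : VSegment) (d : Descriptor n) :
    Prop :=
  d.x = c.x ∧ OnLeftEdge p (c.x, c.top) d.topEdge ∧ OnLeftEdge p (c.x, c.bot) d.botEdge

/-- A run: `len` cuts at `x, x + 1, …, x + len - 1` that all span the same two edges. -/
structure Run (n : ℕ) where
  topEdge : Fin n
  botEdge : Fin n
  x : ℝ
  len : ℕ

open Classical in
/-- Groups a list of descriptors into maximal runs. -/
noncomputable def runs {n : ℕ} : List (Descriptor n) → List (Run n)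
  | [] => []
  | d :: l =>
    match runs l with
    | [] => [⟨d.topEdge, d.botEdge, d.x, 1⟩]
    | r :: rs =>
      if d.topEdge = r.topEdge ∧ d.botEdge = r.botEdge ∧ r.x = d.x + 1 then
        ⟨d.topEdge, d.botEdge, d.x, r.len + 1⟩ :: rs
      else
        ⟨d.topEdge, d.botEdge, d.x, 1⟩ :: r :: rs

/-- An output cell holds an integer (a vertex or edge index) or a real number. -/
inductive Cell where
  | int (z : ℤ)
  | real (r : ℝ)

/-- The literal encoding: three cells for every cut. -/
def literalCode {n : ℕ} (ds : List (Descriptor n)) : List Cell :=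
  ds.flatMap fun d => [.int (d.topEdge : ℕ), .int (d.botEdge : ℕ), .real d.x]

/-- The run-length encoding: four cells for every maximal run. -/
noncomputable def runLengthCode {n : ℕ} (ds : List (Descriptor n)) : List Cell :=
  (runs ds).flatMap fun r =>
    [.int (r.topEdge : ℕ), .int (r.botEdge : ℕ), .real r.x, .real r.len]

open Classical in
/-- The hybrid encoding: literal if the width of the polygon is less than the number of its
vertices, and run-length otherwise. -/
noncomputable def hybridCode {n : ℕ} (p : Fin n → ℝ × ℝ) (ds : List (Descriptor n)) :
    List Cell :=
  if hwidth (region p) < n then literalCode ds else runLengthCode ds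

/-- `w` is the hybrid codeword of the set `C` of cuts: the encoding of the descriptors of the
cuts, listed from left to right. -/
def IsCodeword {n : ℕ} [NeZero n] (p : Fin n → ℝ × ℝ) (C : Finset VSegment) (w : List Cell) :
    Prop :=
  ∃ (cs : List VSegment) (ds : List (Descriptor n)),
    cs.Pairwise (fun c c' => c.x < c'.x) ∧ (∀ c, c ∈ cs ↔ c ∈ C) ∧
    List.Forall₂ (IsDescriptor p) cs ds ∧ w = hybridCode p ds

/-! ### The real RAM

Programs are built from unit-cost instructions on integer registers and memory (used as indices:
addition, subtraction, halving, comparison) and on real registers and memory (`+`, `-`, `×`, `÷`,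
comparison). Memory is addressed indirectly by integers. The only access to a floor function is
through the integer parts of the input `x`-coordinates, and reals cannot be turned into
integers. -/

/-- The read-only input of a program. -/
structure Input where
  size : ℕ
  x : ℤ → ℝ
  y : ℤ → ℝ
  xFloor : ℤ → ℝ

/-- The vertex array of a polygon as an input, each `x`-coordinate together with its integer
part. Entries outside of the array read as zero. -/
noncomputable def inputOf {n : ℕ} (p : Fin n → ℝ × ℝ) : Input where
  size := n
  x z := if hz : 0 ≤ z ∧ z < n then (p ⟨z.toNat, by omega⟩).1 else 0
  y z := if hz : 0 ≤ z ∧ z < n then (p ⟨z.toNat, by omega⟩).2 else 0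
  xFloor z := if hz : 0 ≤ z ∧ z < n then (⌊(p ⟨z.toNat, by omega⟩).1⌋ : ℝ) else 0

/-- The configuration of the machine. -/
structure State where
  intReg : ℕ → ℤ
  realReg : ℕ → ℝ
  intMem : ℤ → ℤ
  realMem : ℤ → ℝ
  out : List Cell

/-- Initially all registers and all memory cells are zero, and nothing is output. -/
def State.init : State where
  intReg _ := 0
  realReg _ := 0
  intMem _ := 0
  realMem _ := 0
  out := []

/-- Integer expressions. -/
inductive IntExpr where
  | const (z : ℤ)
  | reg (k : ℕ)
  | size
  | load (addr : IntExpr)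
  | add (a b : IntExpr)
  | sub (a b : IntExpr)
  | half (a : IntExpr)

/-- The value of an integer expression (`half` rounds down). -/
def IntExpr.eval (inp : Input) (s : State) : IntExpr → ℤ
  | const z => z
  | reg k => s.intReg k
  | size => inp.size
  | load a => s.intMem (a.eval inp s)
  | add a b => a.eval inp s + b.eval inp s
  | sub a b => a.eval inp s - b.eval inp s
  | half a => a.eval inp s / 2

/-- The number of operations in an integer expression. -/
def IntExpr.cost : IntExpr → ℕ
  | const _ => 1
  | reg _ => 1
  | size => 1
  | load a => a.cost + 1
  | add a b => a.cost + b.cost + 1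
  | sub a b => a.cost + b.cost + 1
  | half a => a.cost + 1

/-- Real expressions. Constants enter as integers through `ofInt`. -/
inductive RealExpr where
  | reg (k : ℕ)
  | ofInt (a : IntExpr)
  | load (addr : IntExpr)
  | inputX (i : IntExpr)
  | inputY (i : IntExpr)
  | inputXFloor (i : IntExpr)
  | add (a b : RealExpr)
  | sub (a b : RealExpr)
  | mul (a b : RealExpr)
  | div (a b : RealExpr)

/-- The value of a real expression (division by zero gives zero). -/
noncomputable def RealExpr.eval (inp : Input) (s : State) : RealExpr → ℝ
  | reg k => s.realReg k
  | ofInt a => (a.eval inp s : ℝ)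
  | load a => s.realMem (a.eval inp s)
  | inputX i => inp.x (i.eval inp s)
  | inputY i => inp.y (i.eval inp s)
  | inputXFloor i => inp.xFloor (i.eval inp s)
  | add a b => a.eval inp s + b.eval inp s
  | sub a b => a.eval inp s - b.eval inp s
  | mul a b => a.eval inp s * b.eval inp s
  | div a b => a.eval inp s / b.eval inp s

/-- The number of operations in a real expression. -/
def RealExpr.cost : RealExpr → ℕ
  | reg _ => 1
  | ofInt a => a.cost + 1
  | load a => a.cost + 1
  | inputX i => i.cost + 1
  | inputY i => i.cost + 1
  | inputXFloor i => i.cost + 1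
  | add a b => a.cost + b.cost + 1
  | sub a b => a.cost + b.cost + 1
  | mul a b => a.cost + b.cost + 1
  | div a b => a.cost + b.cost + 1

/-- Tests: comparisons and their Boolean combinations. -/
inductive Test where
  | intLt (a b : IntExpr)
  | intEq (a b : IntExpr)
  | realLt (a b : RealExpr)
  | realEq (a b : RealExpr)
  | neg (t : Test)
  | conj (t u : Test)

/-- The truth of a test. -/
def Test.Holds (inp : Input) (s : State) : Test → Prop
  | intLt a b => a.eval inp s < b.eval inp s
  | intEq a b => a.eval inp s = b.eval inp s
  | realLt a b => a.eval inp s < b.eval inp s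
  | realEq a b => a.eval inp s = b.eval inp s
  | neg t => ¬ t.Holds inp s
  | conj t u => t.Holds inp s ∧ u.Holds inp s

/-- The number of operations in a test. -/
def Test.cost : Test → ℕ
  | intLt a b => a.cost + b.cost + 1
  | intEq a b => a.cost + b.cost + 1
  | realLt a b => a.cost + b.cost + 1
  | realEq a b => a.cost + b.cost + 1
  | neg t => t.cost + 1
  | conj t u => t.cost + u.cost + 1

/-- Programs of the real RAM. -/
inductive Program where
  | skip
  | setInt (k : ℕ) (a : IntExpr)
  | setReal (k : ℕ) (a : RealExpr)
  | storeInt (addr : IntExpr) (a : IntExpr)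
  | storeReal (addr : IntExpr) (a : RealExpr)
  | writeInt (a : IntExpr)
  | writeReal (a : RealExpr)
  | seq (c d : Program)
  | ite (t : Test) (c d : Program)
  | loop (t : Test) (c : Program)

/-- `Exec inp c s s' t`: on input `inp`, the program `c` started in the state `s` halts in the
state `s'` after exactly `t` steps. `loop b c` repeats `c` while the test `b` holds. -/
inductive Exec (inp : Input) : Program → State → State → ℕ → Prop
  | skip (s : State) : Exec inp .skip s s 1
  | setInt (s : State) (k : ℕ) (a : IntExpr) :
      Exec inp (.setInt k a) s
        { s with intReg := Function.update s.intReg k (a.eval inp s) } (a.cost + 1)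
  | setReal (s : State) (k : ℕ) (a : RealExpr) :
      Exec inp (.setReal k a) s
        { s with realReg := Function.update s.realReg k (a.eval inp s) } (a.cost + 1)
  | storeInt (s : State) (b a : IntExpr) :
      Exec inp (.storeInt b a) s
        { s with intMem := Function.update s.intMem (b.eval inp s) (a.eval inp s) }
        (b.cost + a.cost + 1)
  | storeReal (s : State) (b : IntExpr) (a : RealExpr) :
      Exec inp (.storeReal b a) s
        { s with realMem := Function.update s.realMem (b.eval inp s) (a.eval inp s) }
        (b.cost + a.cost + 1)
  | writeInt (s : State) (a : IntExpr) :
      Exec inp (.writeInt a) s { s with out := s.out ++ [.int (a.eval inp s)] } (a.cost + 1)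
  | writeReal (s : State) (a : RealExpr) :
      Exec inp (.writeReal a) s { s with out := s.out ++ [.real (a.eval inp s)] } (a.cost + 1)
  | seq {c d : Program} {s s₁ s₂ : State} {t₁ t₂ : ℕ} :
      Exec inp c s s₁ t₁ → Exec inp d s₁ s₂ t₂ → Exec inp (.seq c d) s s₂ (t₁ + t₂)
  | iteTrue {b : Test} {c d : Program} {s s' : State} {t : ℕ} :
      b.Holds inp s → Exec inp c s s' t → Exec inp (.ite b c d) s s' (b.cost + t + 1)
  | iteFalse {b : Test} {c d : Program} {s s' : State} {t : ℕ} :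
      ¬ b.Holds inp s → Exec inp d s s' t → Exec inp (.ite b c d) s s' (b.cost + t + 1)
  | loopStop {b : Test} {c : Program} {s : State} :
      ¬ b.Holds inp s → Exec inp (.loop b c) s s (b.cost + 1)
  | loopStep {b : Test} {c : Program} {s s₁ s₂ : State} {t₁ t₂ : ℕ} :
      b.Holds inp s → Exec inp c s s₁ t₁ → Exec inp (.loop b c) s₁ s₂ t₂ →
      Exec inp (.loop b c) s s₂ (b.cost + t₁ + t₂ + 1)

/-- On the polygon with vertex array `p`, the program halts after exactly `t` steps with the
output `w`. -/
def HaltsWith {n : ℕ} (c : Program) (p : Fin n → ℝ × ℝ) (w : List Cell) (t : ℕ) : Prop :=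
  ∃ s : State, Exec (inputOf p) c State.init s t ∧ s.out = w

end StripPartition

open StripPartition

namespace StripPartition

/-! ### Cyclic indexing -/

/-! Order the vertices lexicographically, by `x` and then by `y`. By convexity a local maximum of
the cyclic vertex sequence is a global one (`IsCyclicPolygon.le_of_local_max`), so the cycle rises
along the lower chain and falls along the upper chain (`IsSpine`). Exponential search followed by
binary search then finds both extreme vertices in `O(log n)` time (`exec_findSpine`).

The optimum is the width `h`, rounded up. For the lower bound, the projections of the pieces to the
`x`-axis cover the width up to finitely many points, and each has length at most one
(`IsSpine.width_le_card_pieces`). For the upper bound, unit cuts leave at most one piece per slab,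
by convexity (`IsSpine.unit_cuts`). The given integer parts suffice to round up (`ceil_sub_eq`),
which settles the value version.

A cut is determined by its abscissa, and each of its ends has exactly one edge that extends to the
left (`IsSpine.isCut_iff`, `IsSpine.isDescriptor_iff`). The encoding is lossless because records
have fixed length and runs can be expanded again (`flatMap_expand_runs`).

For the reporting version, one pointer per chain moves only to the right, and a galloping search
that advances it by `d` costs `O(1 + log (1 + d))` (`exec_gallop`). The advances add up to at most
`n`. If `h < n`, there are at most `h` records, and concavity of the logarithm, used through its
tangent at `1 + n / h`, bounds the total by `O(h log (1 + n / h))`. If `n ≤ h`, every new run passes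
a vertex, so there are `O(n)` records and `O(n)` search steps, and `n` is `O(h log (1 + n / h))`
because `log (1 + x) ≥ x / 2` for `0 ≤ x ≤ 1`. Bernoulli's inequality absorbs the `O(log n)` for the
extreme vertices (`log_le_mul_log_one_add_div`). -/

/-- The residue of an integer as an index. -/
def cycIdx (n : ℕ) [NeZero n] (z : ℤ) : Fin n :=
  ⟨(z % n).toNat, by
    have hn : (0 : ℤ) < n := by exact_mod_cast NeZero.pos n
    have := Int.emod_nonneg z hn.ne'
    have := Int.emod_lt_of_pos z hn
    omega⟩

lemma cycIdx_val (n : ℕ) [NeZero n] (z : ℤ) : ((cycIdx n z : ℕ) : ℤ) = z % n := by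
  have hn : (0 : ℤ) < n := by exact_mod_cast NeZero.pos n
  have := Int.emod_nonneg z hn.ne'
  simp only [cycIdx]
  omega

lemma cycIdx_eq_iff (n : ℕ) [NeZero n] (z w : ℤ) : cycIdx n z = cycIdx n w ↔ z % n = w % n := by
  rw [← cycIdx_val, ← cycIdx_val, Fin.ext_iff]
  exact_mod_cast Iff.rfl

lemma cycIdx_add_one (n : ℕ) [NeZero n] (z : ℤ) : cycIdx n (z + 1) = cycIdx n z + 1 := by
  apply Fin.ext
  zify
  rw [cycIdx_val, Fin.val_add]
  push_cast
  rw [cycIdx_val, Fin.val_one']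
  push_cast
  rw [Int.add_emod]

lemma cycIdx_natCast (n : ℕ) [NeZero n] (i : Fin n) : cycIdx n (i : ℕ) = i := by
  apply Fin.ext
  zify
  rw [cycIdx_val]
  exact Int.emod_eq_of_lt (by omega) (by exact_mod_cast i.2)

/-- The periodic extension of a vertex array. -/
def cyc {n : ℕ} [NeZero n] (p : Fin n → ℝ × ℝ) (z : ℤ) : ℝ × ℝ := p (cycIdx n z)

/-- A periodic sequence of points that runs through the vertices of a convex polygon. -/
structure IsCyclicPolygon (n : ℕ) (q : ℤ → ℝ × ℝ) : Prop where
  three_le : 3 ≤ n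
  periodic : ∀ z, q (z + n) = q z
  dvd_of_eq : ∀ i j, q i = q j → (n : ℤ) ∣ i - j
  left_of_edges : ∀ i j, 0 ≤ cross (q i) (q (i + 1)) (q j)
  not_collinear : ∃ i j, 0 < cross (q i) (q (i + 1)) (q j)

lemma IsConvexPolygon.isCyclicPolygon {n : ℕ} [NeZero n] {p : Fin n → ℝ × ℝ}
    (hp : IsConvexPolygon p) : IsCyclicPolygon n (cyc p) where
  three_le := hp.three_le
  periodic z := by
    unfold cyc
    congr 1
    rw [cycIdx_eq_iff, Int.add_emod_right]
  dvd_of_eq i j h := by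
    have h := (cycIdx_eq_iff _ _ _).1 (hp.injective h)
    exact Int.ModEq.dvd (Eq.symm h : j ≡ i [ZMOD n])
  left_of_edges i j := by
    unfold cyc
    rw [cycIdx_add_one]
    exact hp.left_of_edges _ _
  not_collinear := by
    obtain ⟨i, j, h⟩ := hp.not_collinear
    refine ⟨(i : ℕ), (j : ℕ), ?_⟩
    unfold cyc
    rwa [cycIdx_add_one, cycIdx_natCast, cycIdx_natCast]

/-- Point reflection preserves orientation, so statements about lexicographic maxima transfer to
minima. The factor `σ = -1` in the search programs exploits the same symmetry. -/
lemma IsCyclicPolygon.neg {n : ℕ} {q : ℤ → ℝ × ℝ} (hq : IsCyclicPolygon n q) :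
    IsCyclicPolygon n (fun z => -q z) where
  three_le := hq.three_le
  periodic z := by simp [hq.periodic]
  dvd_of_eq i j h := hq.dvd_of_eq i j (neg_injective h)
  left_of_edges i j := by
    have := hq.left_of_edges i j
    simp only [cross, Prod.fst_neg, Prod.snd_neg] at this ⊢
    linarith
  not_collinear := by
    obtain ⟨i, j, h⟩ := hq.not_collinear
    refine ⟨i, j, ?_⟩
    simp only [cross, Prod.fst_neg, Prod.snd_neg] at h ⊢
    linarith

/-! ### The cyclic sequence of vertices is bitonic in the lexicographic order -/

lemma toLex_lt_iff (a b : ℝ × ℝ) : toLex a < toLex b ↔ a.1 < b.1 ∨ a.1 = b.1 ∧ a.2 < b.2 :=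
  Prod.Lex.toLex_lt_toLex

lemma toLex_neg_lt_iff (a b : ℝ × ℝ) : toLex (-a) < toLex (-b) ↔ toLex b < toLex a := by
  simp only [toLex_lt_iff, Prod.fst_neg, Prod.snd_neg, neg_lt_neg_iff, neg_inj]
  constructor <;> rintro (h | ⟨h, h'⟩) <;> simp_all

lemma fst_le_of_toLex_lt {a b : ℝ × ℝ} (h : toLex a < toLex b) : a.1 ≤ b.1 := by
  rcases (toLex_lt_iff a b).1 h with h | h
  · exact h.le
  · exact h.1.le

/-- A vector between the directions `-u` and `v`, where `u` is lexicographically positive and `v`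
is lexicographically negative, is not lexicographically positive. -/
lemma not_lex_pos_of_cone {u₁ u₂ v₁ v₂ w₁ w₂ : ℝ} (hu : 0 < u₁ ∨ 0 = u₁ ∧ 0 < u₂)
    (hv : v₁ < 0 ∨ v₁ = 0 ∧ v₂ < 0) (hD : 0 < u₁ * v₂ - u₂ * v₁)
    (hB : 0 ≤ u₁ * w₂ - u₂ * w₁) (hA : 0 ≤ v₁ * w₂ - v₂ * w₁) :
    ¬ (0 < w₁ ∨ 0 = w₁ ∧ 0 < w₂) := by
  set D := u₁ * v₂ - u₂ * v₁
  set B := u₁ * w₂ - u₂ * w₁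
  set A := v₁ * w₂ - v₂ * w₁
  -- Cramer's rule: `D w = -A u + B v`, a nonnegative combination of the lexicographically negative
  -- vectors `-u` and `v`.
  have h1 : D * w₁ = -A * u₁ + B * v₁ := by simp only [D, A, B]; ring
  have h2 : D * w₂ = -A * u₂ + B * v₂ := by simp only [D, A, B]; ring
  have hu1 : 0 ≤ u₁ := by rcases hu with h | h <;> linarith [h]
  have hv1 : v₁ ≤ 0 := by rcases hv with h | h <;> linarith [h]
  have hAu : 0 ≤ A * u₁ := mul_nonneg hA hu1
  have hBv : B * v₁ ≤ 0 := mul_nonpos_of_nonneg_of_nonpos hB hv1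
  rintro (hw | ⟨hw, hw2⟩)
  · have : 0 < D * w₁ := mul_pos hD hw
    linarith
  · rw [← hw, mul_zero] at h1
    have hw2' : 0 < D * w₂ := mul_pos hD hw2
    have e1 : A * u₁ = 0 := by linarith
    have e2 : B * v₁ = 0 := by linarith
    have hAu2 : 0 ≤ A * u₂ := by
      rcases hu with h | h
      · have : A = 0 := by
          rcases mul_eq_zero.1 e1 with h' | h'
          · exact h'
          · linarith
        simp [this]
      · exact mul_nonneg hA h.2.le
    have hBv2 : B * v₂ ≤ 0 := by
      rcases hv with h | h
      · have : B = 0 := by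
          rcases mul_eq_zero.1 e2 with h' | h'
          · exact h'
          · linarith
        simp [this]
      · exact mul_nonpos_of_nonneg_of_nonpos hB h.2.le
    linarith

/-- A local lexicographic maximum is a global one. -/
lemma IsCyclicPolygon.le_of_local_max {n : ℕ} {q : ℤ → ℝ × ℝ} (hq : IsCyclicPolygon n q) {i : ℤ}
    (h1 : toLex (q i) < toLex (q (i + 1))) (h2 : toLex (q (i + 1 + 1)) < toLex (q (i + 1)))
    (j : ℤ) : toLex (q j) ≤ toLex (q (i + 1)) := by
  set a := q i
  set b := q (i + 1)
  set c := q (i + 1 + 1)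
  have hu : 0 < b.1 - a.1 ∨ 0 = b.1 - a.1 ∧ 0 < b.2 - a.2 := by
    rcases (toLex_lt_iff _ _).1 h1 with h | h
    · left; linarith
    · right; constructor <;> linarith [h.1, h.2]
  have hv : c.1 - b.1 < 0 ∨ c.1 - b.1 = 0 ∧ c.2 - b.2 < 0 := by
    rcases (toLex_lt_iff _ _).1 h2 with h | h
    · left; linarith
    · right; constructor <;> linarith [h.1, h.2]
  have key : ∀ j, 0 ≤ (b.1 - a.1) * ((q j).2 - b.2) - (b.2 - a.2) * ((q j).1 - b.1) := by
    intro j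
    have := hq.left_of_edges i j
    unfold cross at this
    linarith
  have key' : ∀ j, 0 ≤ (c.1 - b.1) * ((q j).2 - b.2) - (c.2 - b.2) * ((q j).1 - b.1) :=
    fun j => hq.left_of_edges (i + 1) j
  -- The turn at a local maximum is strict: otherwise the two edges are antiparallel, and being to
  -- the left of both puts every vertex on one line.
  have hD : 0 < (b.1 - a.1) * (c.2 - b.2) - (b.2 - a.2) * (c.1 - b.1) := by
    refine lt_of_le_of_ne (key (i + 1 + 1)) fun h0 => ?_
    have col : ∀ j, (b.1 - a.1) * ((q j).2 - b.2) - (b.2 - a.2) * ((q j).1 - b.1) = 0 := by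
      intro j
      refine le_antisymm ?_ (key j)
      have h' := key' j
      rcases hu with hu | ⟨hu, hu'⟩
      · have hv1 : c.1 - b.1 < 0 := by
          rcases hv with hv | ⟨hv, hv'⟩
          · exact hv
          · rw [hv] at h0
            nlinarith
        have : (b.1 - a.1) * ((c.1 - b.1) * ((q j).2 - b.2) - (c.2 - b.2) * ((q j).1 - b.1)) =
          (c.1 - b.1) * ((b.1 - a.1) * ((q j).2 - b.2) - (b.2 - a.2) * ((q j).1 - b.1)) := by
          linear_combination ((q j).1 - b.1) * h0
        have := mul_nonneg hu.le h'
        by_contra hc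
        nlinarith [mul_neg_of_neg_of_pos hv1 (not_le.1 hc)]
      · rw [← hu] at h0 ⊢
        have hv1 : c.1 - b.1 = 0 := by
          have : (b.2 - a.2) * (c.1 - b.1) = 0 := by linarith
          rcases mul_eq_zero.1 this with h | h
          · linarith
          · exact h
        have hv2 : c.2 - b.2 < 0 := by
          rcases hv with hv | hv
          · linarith
          · exact hv.2
        rw [hv1] at h'
        have : 0 ≤ (q j).1 - b.1 := by
          by_contra hc
          nlinarith [mul_pos_of_neg_of_neg hv2 (not_le.1 hc)]
        nlinarith
    obtain ⟨k, l, hkl⟩ := hq.not_collinear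
    have e1 := col k
    have e2 := col (k + 1)
    have e3 := col l
    have f1 : (b.1 - a.1) * cross (q k) (q (k + 1)) (q l) = 0 := by
      unfold cross
      linear_combination ((q (k + 1)).1 - (q k).1) * (e3 - e1) - ((q l).1 - (q k).1) * (e2 - e1)
    have f2 : (b.2 - a.2) * cross (q k) (q (k + 1)) (q l) = 0 := by
      unfold cross
      linear_combination ((q (k + 1)).2 - (q k).2) * (e3 - e1) - ((q l).2 - (q k).2) * (e2 - e1)
    rcases hu with hu | hu
    · exact absurd f1 (mul_pos hu hkl).ne'
    · exact absurd f2 (mul_pos hu.2 hkl).ne'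
  have := not_lex_pos_of_cone hu hv hD (key j) (key' j)
  rw [← not_lt, toLex_lt_iff]
  intro h
  apply this
  rcases h with h | h
  · left; linarith
  · right; constructor <;> linarith [h.1, h.2]

lemma IsCyclicPolygon.ge_of_local_min {n : ℕ} {q : ℤ → ℝ × ℝ} (hq : IsCyclicPolygon n q) {i : ℤ}
    (h1 : toLex (q (i + 1)) < toLex (q i)) (h2 : toLex (q (i + 1)) < toLex (q (i + 1 + 1)))
    (j : ℤ) : toLex (q (i + 1)) ≤ toLex (q j) := by
  have := hq.neg.le_of_local_max (i := i) ((toLex_neg_lt_iff _ _).2 h1)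
    ((toLex_neg_lt_iff _ _).2 h2) j
  rw [← not_lt] at this ⊢
  rwa [toLex_neg_lt_iff] at this

lemma IsCyclicPolygon.toLex_ne {n : ℕ} {q : ℤ → ℝ × ℝ} (hq : IsCyclicPolygon n q) (i : ℤ) :
    toLex (q i) ≠ toLex (q (i + 1)) := by
  intro h
  have h := hq.dvd_of_eq _ _ (toLex.injective h)
  have h3 := hq.three_le
  have : (n : ℤ) ∣ 1 := by
    have := (dvd_neg.2 h)
    simpa using this
  have := Int.le_of_dvd one_pos this
  omega

/-- A rising edge is followed by a rising edge, except at the lexicographic maximum. -/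
lemma IsCyclicPolygon.rise_succ {n : ℕ} {q : ℤ → ℝ × ℝ} (hq : IsCyclicPolygon n q) {i M : ℤ}
    (hM : ∀ j, toLex (q j) ≤ toLex (q M)) (h : toLex (q i) < toLex (q (i + 1)))
    (hi : ¬ (n : ℤ) ∣ M - (i + 1)) : toLex (q (i + 1)) < toLex (q (i + 1 + 1)) := by
  refine lt_of_not_ge fun h' => hi ?_
  have h' := lt_of_le_of_ne h' (hq.toLex_ne (i + 1)).symm
  exact hq.dvd_of_eq _ _ (toLex.injective (le_antisymm (hq.le_of_local_max h h' M) (hM _)))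

lemma IsCyclicPolygon.fall_succ {n : ℕ} {q : ℤ → ℝ × ℝ} (hq : IsCyclicPolygon n q) {i m : ℤ}
    (hm : ∀ j, toLex (q m) ≤ toLex (q j)) (h : toLex (q (i + 1)) < toLex (q i))
    (hi : ¬ (n : ℤ) ∣ m - (i + 1)) : toLex (q (i + 1 + 1)) < toLex (q (i + 1)) := by
  refine lt_of_not_ge fun h' => hi ?_
  have h' := lt_of_le_of_ne h' (hq.toLex_ne (i + 1))
  exact hq.dvd_of_eq _ _ (toLex.injective (le_antisymm (hm _) (hq.ge_of_local_min h h' m)))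

/-- Around the polygon, the vertices rise in the lexicographic order from `m` to `M` and fall from
`M` to `m + n`. -/
structure IsSpine (n : ℕ) (q : ℤ → ℝ × ℝ) (m M : ℤ) : Prop where
  lt : m < M
  lt_add : M < m + n
  rise : ∀ z, m ≤ z → z < M → toLex (q z) < toLex (q (z + 1))
  fall : ∀ z, M ≤ z → z < m + n → toLex (q (z + 1)) < toLex (q z)

lemma not_dvd_of_abs_lt {n z : ℤ} (h0 : z ≠ 0) (h1 : -n < z) (h2 : z < n) : ¬ n ∣ z := by
  rintro ⟨k, rfl⟩
  have hn : 0 < n := by linarith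
  have : k < 1 := by nlinarith
  have : -1 < k := by nlinarith
  have : k = 0 := by omega
  simp [this] at h0

lemma IsCyclicPolygon.isSpine {n : ℕ} {q : ℤ → ℝ × ℝ} (hq : IsCyclicPolygon n q) {m M : ℤ}
    (hm : ∀ j, toLex (q m) ≤ toLex (q j)) (hM : ∀ j, toLex (q j) ≤ toLex (q M))
    (h1 : m < M) (h2 : M < m + n) : IsSpine n q m M where
  lt := h1
  lt_add := h2
  rise z hz := by
    induction z, hz using Int.leInduction with
    | base => exact fun _ => lt_of_le_of_ne (hm _) (hq.toLex_ne m)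
    | succ z hz ih =>
      intro hz'
      exact hq.rise_succ hM (ih (by omega))
        (not_dvd_of_abs_lt (by omega) (by omega) (by omega))
  fall z hz := by
    induction z, hz using Int.leInduction with
    | base => exact fun _ => lt_of_le_of_ne (hM _) (hq.toLex_ne M).symm
    | succ z hz ih =>
      intro hz'
      exact hq.fall_succ hm (ih (by omega))
        (not_dvd_of_abs_lt (by omega) (by omega) (by omega))

lemma IsCyclicPolygon.apply_emod {n : ℕ} {q : ℤ → ℝ × ℝ} (hq : IsCyclicPolygon n q) (z : ℤ) :
    q (z % n) = q z := by
  have h : Function.Periodic q (n : ℤ) := hq.periodic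
  rw [← h.sub_zsmul_eq (x := z) (z / n), smul_eq_mul, mul_comm, ← Int.emod_def]

lemma IsCyclicPolygon.exists_max {n : ℕ} {q : ℤ → ℝ × ℝ} (hq : IsCyclicPolygon n q) :
    ∃ M : ℤ, 0 ≤ M ∧ M < n ∧ ∀ j, toLex (q j) ≤ toLex (q M) := by
  have h3 := hq.three_le
  have hne : (Finset.Ico (0 : ℤ) n).Nonempty := ⟨0, by simp; omega⟩
  obtain ⟨M, hM, hM'⟩ := Finset.exists_max_image _ (fun z => toLex (q z)) hne
  rw [Finset.mem_Ico] at hM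
  refine ⟨M, hM.1, hM.2, fun j => ?_⟩
  rw [← hq.apply_emod j]
  refine hM' _ (Finset.mem_Ico.2 ⟨Int.emod_nonneg _ (by omega), Int.emod_lt_of_pos _ (by omega)⟩)

lemma IsCyclicPolygon.exists_min {n : ℕ} {q : ℤ → ℝ × ℝ} (hq : IsCyclicPolygon n q) :
    ∃ m : ℤ, 0 ≤ m ∧ m < n ∧ ∀ j, toLex (q m) ≤ toLex (q j) := by
  obtain ⟨m, h0, h1, h⟩ := hq.neg.exists_max
  refine ⟨m, h0, h1, fun j => ?_⟩
  have := h j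
  rwa [← not_lt, toLex_neg_lt_iff, not_lt] at this

lemma IsSpine.shift {n : ℕ} {q : ℤ → ℝ × ℝ} (hq : IsCyclicPolygon n q) {m M : ℤ}
    (hs : IsSpine n q m M) : IsSpine n q (m + n) (M + n) where
  lt := by have := hs.lt; omega
  lt_add := by have := hs.lt_add; omega
  rise z hz hz' := by
    have := hs.rise (z - n) (by omega) (by omega)
    rwa [← hq.periodic, ← hq.periodic (z - n + 1), sub_add_cancel,
      show z - n + 1 + (n : ℤ) = z + 1 by ring] at this
  fall z hz hz' := by
    have := hs.fall (z - n) (by omega) (by omega)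
    rwa [← hq.periodic, ← hq.periodic (z - n), sub_add_cancel,
      show z - n + 1 + (n : ℤ) = z + 1 by ring] at this

/-- Negation exchanges the two chains. -/
lemma IsSpine.of_neg {n : ℕ} {q : ℤ → ℝ × ℝ} (hq : IsCyclicPolygon n q) {m M : ℤ}
    (hs : IsSpine n (fun z => -q z) m M) : IsSpine n q M (m + n) where
  lt := by have := hs.lt_add; omega
  lt_add := by have := hs.lt; omega
  rise z hz hz' := (toLex_neg_lt_iff _ _).1 (hs.fall z hz hz')
  fall z hz hz' := (toLex_neg_lt_iff _ _).1 ((hs.shift hq.neg).rise z hz hz')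

/-- If the first edge rises, then the array rises up to the lexicographic maximum `a`, falls up to
the lexicographic minimum `b` and rises again. -/
lemma IsCyclicPolygon.exists_isSpine_of_rise {n : ℕ} {q : ℤ → ℝ × ℝ} (hq : IsCyclicPolygon n q)
    (h0 : toLex (q 0) < toLex (q 1)) : ∃ a b : ℤ, 1 ≤ a ∧ a < b ∧ b ≤ n ∧ IsSpine n q (b - n) a := by
  obtain ⟨M, hM0, hMn, hM⟩ := hq.exists_max
  obtain ⟨m, hm0, hmn, hm⟩ := hq.exists_min
  have hM1 : M ≠ 0 := by
    rintro rfl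
    exact absurd (hM 1) (not_le.2 h0)
  have hne : m ≠ M := by
    rintro rfl
    exact hq.toLex_ne m (le_antisymm (hm _) (hM _))
  rcases hm0.eq_or_lt with h | h
  · subst h
    exact ⟨M, n, by omega, hMn, le_rfl, by
      rw [sub_self]; exact hq.isSpine hm hM (by omega) (by omega)⟩
  · rcases lt_or_gt_of_ne hne with h' | h'
    -- Here vertex `n`, that is vertex `0`, would lie on the falling chain, although the first edge
    -- rises.
    · have := (hq.isSpine hm hM h' (by omega)).fall n (by omega) (by omega)
      rw [add_comm, hq.periodic, ← zero_add (n : ℤ), hq.periodic] at this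
      exact absurd h0 this.asymm
    · refine ⟨M, m, by omega, h', by omega, hq.isSpine ?_ hM (by omega) (by omega)⟩
      intro j
      rw [← hq.periodic, sub_add_cancel]
      exact hm j

/-! ### Breakpoints of monotone sequences, and the two chains as such sequences -/

lemma lt_of_forall_lt_succ {α : Type*} [Preorder α] {f : ℤ → α} {a b : ℤ} (hab : a < b)
    (h : ∀ z, a ≤ z → z < b → f z < f (z + 1)) : f a < f b := by
  have : ∀ c, a + 1 ≤ c → c ≤ b → f a < f c := by
    intro c hc
    induction c, hc using Int.leInduction with
    | base => exact fun hb => h a le_rfl (by omega)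
    | succ c hc ih => exact fun hb => (ih (by omega)).trans (h c (by omega) (by omega))
  exact this b (by omega) le_rfl

lemma monotoneOn_of_forall_le_succ {f : ℤ → ℝ} {s e : ℤ}
    (h : ∀ z, s ≤ z → z < e → f z ≤ f (z + 1)) : MonotoneOn f (Set.Icc s e) := by
  intro a ha b hb hab
  have : ∀ c, a ≤ c → c ≤ e → f a ≤ f c := by
    intro c hc
    induction c, hc using Int.leInduction with
    | base => exact fun _ => le_rfl
    | succ c hc ih => exact fun hb => (ih (by omega)).trans (h c (by have := ha.1; omega) (by omega))
  exact this b hab hb.2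

/-- Position `b` is the last one in `[s, e)` at which the sequence `f` is below `X`. -/
structure IsBreak (f : ℤ → ℝ) (s e : ℤ) (X : ℝ) (b : ℤ) : Prop where
  le : s ≤ b
  lt : b < e
  -- The strict `f i < X` implements the tie rule: at the abscissa of a vertex, the edge to its left
  -- is selected.
  iff : ∀ i, s ≤ i → i ≤ e → (f i < X ↔ i ≤ b)

lemma exists_isBreak {f : ℤ → ℝ} {s e : ℤ} {X : ℝ} (hf : MonotoneOn f (Set.Icc s e))
    (hse : s ≤ e) (hs : f s < X) (he : X ≤ f e) : ∃ b, IsBreak f s e X b := by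
  have : ∀ c, s ≤ c → c ≤ e → (∃ b, IsBreak f s e X b) ∨ f c < X := by
    intro c hc
    induction c, hc using Int.leInduction with
    | base => exact fun _ => Or.inr hs
    | succ c hc ih =>
      intro hce
      rcases ih (by omega) with h | h
      · exact Or.inl h
      · by_cases h' : f (c + 1) < X
        · exact Or.inr h'
        · refine Or.inl ⟨c, hc, by omega, fun i hi hi' => ⟨fun hX => ?_, fun hX => ?_⟩⟩
          · by_contra hc'
            exact h' (lt_of_le_of_lt (hf ⟨by omega, by omega⟩ ⟨hi, hi'⟩ (by omega)) hX)
          · exact lt_of_le_of_lt (hf ⟨by omega, by omega⟩ ⟨hc, by omega⟩ hX) h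
  rcases this e hse le_rfl with h | h
  · exact h
  · exact absurd h (not_lt.2 he)

/-- A local test on two consecutive values identifies the break. This is how an edge that is known
to contain a point is matched with a position on its chain. -/
lemma IsBreak.unique {f : ℤ → ℝ} {s e : ℤ} {X : ℝ} {b c : ℤ} (hb : IsBreak f s e X b)
    (hc : s ≤ c) (hc' : c < e) (h1 : f c < X) (h2 : X ≤ f (c + 1)) : c = b := by
  have := (hb.iff c hc hc'.le).1 h1
  have := mt (hb.iff (c + 1) (by omega) (by omega)).2 (not_lt.2 h2)
  omega

lemma IsBreak.lt_left {f : ℤ → ℝ} {s e : ℤ} {X : ℝ} {b : ℤ} (hb : IsBreak f s e X b) : f b < X :=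
  (hb.iff b hb.le hb.lt.le).2 le_rfl

lemma IsBreak.le_right {f : ℤ → ℝ} {s e : ℤ} {X : ℝ} {b : ℤ} (hb : IsBreak f s e X b) :
    X ≤ f (b + 1) :=
  not_lt.1 fun h => by
    have := (hb.iff (b + 1) (by have := hb.le; omega) (by have := hb.lt; omega)).1 h
    omega

/-- The `x`-coordinates along the lower chain, from left to right. -/
def lowX (q : ℤ → ℝ × ℝ) (z : ℤ) : ℝ := (q z).1

/-- The `x`-coordinates along the upper chain, from left to right. -/
def upX (q : ℤ → ℝ × ℝ) (z : ℤ) : ℝ := (q (-z)).1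

lemma IsSpine.monotoneOn_lowX {n : ℕ} {q : ℤ → ℝ × ℝ} {m M : ℤ} (h : IsSpine n q m M) :
    MonotoneOn (lowX q) (Set.Icc m M) :=
  monotoneOn_of_forall_le_succ fun z hz hz' => fst_le_of_toLex_lt (h.rise z hz hz')

/-- Reading the cycle backwards turns the upper chain into an increasing sequence as well; it ends
at `n - M` because `M - n` is the same vertex as `M`. Position `z` of this chain refers to the edge
`-z - 1`, which joins the vertices `-z - 1` and `-z`. -/
lemma IsSpine.monotoneOn_upX {n : ℕ} {q : ℤ → ℝ × ℝ} {m M : ℤ} (hq : IsCyclicPolygon n q)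
    (h : IsSpine n q m M) : MonotoneOn (upX q) (Set.Icc (-m) (n - M)) :=
  monotoneOn_of_forall_le_succ fun z hz hz' => by
    have := fst_le_of_toLex_lt (h.fall (-(z + 1) + n) (by omega) (by omega))
    rw [show -(z + 1) + (n : ℤ) + 1 = -z + n by ring, hq.periodic, hq.periodic] at this
    exact this

end StripPartition

namespace StripPartition

/-! ### The region of a polygon and its vertical sections -/

lemma convex_region {n : ℕ} (p : Fin n → ℝ × ℝ) : Convex ℝ (region p) := convex_convexHull ℝ _

lemma isCompact_region {n : ℕ} (p : Fin n → ℝ × ℝ) : IsCompact (region p) :=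
  (Set.finite_range p).isCompact_convexHull ℝ

variable {n : ℕ} [NeZero n] {p : Fin n → ℝ × ℝ} {m M : ℤ}

/-- The falling chain of the previous period ends at `m` and the rising chain starts there, so `m`
is a local and hence a global minimum. -/
lemma IsSpine.min_le (hp : IsConvexPolygon p) (hs : IsSpine n (cyc p) m M) (j : ℤ) :
    toLex (cyc p m) ≤ toLex (cyc p j) := by
  have hq := hp.isCyclicPolygon
  have h := hs.fall (m + n - 1) (by have := hs.lt_add; omega) (by omega)
  have e : cyc p (m + n - 1) = cyc p (m - 1) := by
    rw [← hq.periodic (m - 1)]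
    ring_nf
  rw [show m + n - 1 + 1 = m + n by ring, hq.periodic, e] at h
  have := hq.ge_of_local_min (i := m - 1) (by rwa [sub_add_cancel])
    (by rw [sub_add_cancel]; exact hs.rise m le_rfl hs.lt) j
  rwa [sub_add_cancel] at this

lemma IsSpine.le_max (hp : IsConvexPolygon p) (hs : IsSpine n (cyc p) m M) (j : ℤ) :
    toLex (cyc p j) ≤ toLex (cyc p M) := by
  have hq := hp.isCyclicPolygon
  have h := hs.rise (M - 1) (by have := hs.lt; omega) (by omega)
  rw [sub_add_cancel] at h
  have := hq.le_of_local_max (i := M - 1) (by rwa [sub_add_cancel])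
    (by rw [sub_add_cancel]; exact hs.fall M le_rfl hs.lt_add) j
  rwa [sub_add_cancel] at this

lemma fst_le_of_toLex_le {a b : ℝ × ℝ} (h : toLex a ≤ toLex b) : a.1 ≤ b.1 := by
  rcases h.eq_or_lt with h | h
  · rw [toLex.injective h]
  · exact fst_le_of_toLex_lt h

lemma exists_isSpine (hp : IsConvexPolygon p) : ∃ m M, IsSpine n (cyc p) m M := by
  have hq := hp.isCyclicPolygon
  obtain ⟨M, hM0, hMn, hM⟩ := hq.exists_max
  obtain ⟨m, hm0, hmn, hm⟩ := hq.exists_min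
  have hne : m ≠ M := by
    rintro rfl
    exact hq.toLex_ne m (le_antisymm (hm _) (hM _))
  rcases lt_or_gt_of_ne hne with h | h
  · exact ⟨m, M, hq.isSpine hm hM h (by omega)⟩
  · exact ⟨m, M + n, hq.isSpine hm (by rwa [hq.periodic]) (by omega) (by omega)⟩

lemma cyc_mem_region (p : Fin n → ℝ × ℝ) (z : ℤ) : cyc p z ∈ region p :=
  subset_convexHull ℝ _ (Set.mem_range_self _)

lemma region_subset {s : Set (ℝ × ℝ)} (hs : Convex ℝ s) (h : ∀ z, cyc p z ∈ s) : region p ⊆ s := by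
  refine convexHull_min ?_ hs
  rintro _ ⟨i, rfl⟩
  have := h (i : ℕ)
  rwa [cyc, cycIdx_natCast] at this

lemma cross_nonneg_of_mem_region (hp : IsConvexPolygon p) (i : ℤ) {w : ℝ × ℝ}
    (hw : w ∈ region p) : 0 ≤ cross (cyc p i) (cyc p (i + 1)) w := by
  refine region_subset (s := {w | 0 ≤ cross (cyc p i) (cyc p (i + 1)) w}) ?_
    (fun z => hp.isCyclicPolygon.left_of_edges i z) hw
  intro u hu v hv a b ha hb hab
  simp only [Set.mem_ofPred_eq, cross, Prod.fst_add, Prod.snd_add, Prod.smul_fst, Prod.smul_snd,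
    smul_eq_mul] at hu hv ⊢
  have hb' : b = 1 - a := by linarith
  subst hb'
  have := add_nonneg (mul_nonneg ha hu) (mul_nonneg hb hv)
  linarith

lemma IsSpine.fst_mem_Icc (hp : IsConvexPolygon p) (hs : IsSpine n (cyc p) m M) {w : ℝ × ℝ}
    (hw : w ∈ region p) : w.1 ∈ Set.Icc (cyc p m).1 (cyc p M).1 := by
  refine region_subset (s := {w | w.1 ∈ Set.Icc (cyc p m).1 (cyc p M).1}) ?_ (fun z =>
    ⟨fst_le_of_toLex_le (hs.min_le hp z), fst_le_of_toLex_le (hs.le_max hp z)⟩) hw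
  exact (convex_Icc _ _).linear_preimage (LinearMap.fst ℝ ℝ ℝ)

lemma IsSpine.leftX_eq (hp : IsConvexPolygon p) (hs : IsSpine n (cyc p) m M) :
    leftX (region p) = (cyc p m).1 :=
  IsLeast.csInf_eq ⟨⟨_, cyc_mem_region p m, rfl⟩, by
    rintro _ ⟨w, hw, rfl⟩
    exact (hs.fst_mem_Icc hp hw).1⟩

lemma IsSpine.rightX_eq (hp : IsConvexPolygon p) (hs : IsSpine n (cyc p) m M) :
    rightX (region p) = (cyc p M).1 :=
  IsGreatest.csSup_eq ⟨⟨_, cyc_mem_region p M, rfl⟩, by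
    rintro _ ⟨w, hw, rfl⟩
    exact (hs.fst_mem_Icc hp hw).2⟩

lemma IsSpine.hwidth_eq (hp : IsConvexPolygon p) (hs : IsSpine n (cyc p) m M) :
    hwidth (region p) = (cyc p M).1 - (cyc p m).1 := by
  rw [hwidth, hs.leftX_eq hp, hs.rightX_eq hp]

lemma IsSpine.fst_lt_fst (hp : IsConvexPolygon p) (hs : IsSpine n (cyc p) m M) :
    (cyc p m).1 < (cyc p M).1 := by
  by_contra hle
  have h : ∀ z, (cyc p z).1 = (cyc p m).1 := fun z => by
    have := hs.fst_mem_Icc hp (cyc_mem_region p z)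
    linarith [this.1, this.2]
  obtain ⟨i, j, hij⟩ := hp.isCyclicPolygon.not_collinear
  simp [cross, h] at hij

/-! ### Vertical sections between a lower and an upper edge -/

/-- The ordinate at abscissa `X` of the line through edge `i`. -/
noncomputable def lineAt (q : ℤ → ℝ × ℝ) (i : ℤ) (X : ℝ) : ℝ :=
  (q i).2 + ((q (i + 1)).2 - (q i).2) / ((q (i + 1)).1 - (q i).1) * (X - (q i).1)

/-- Translates orientation into a comparison of ordinates: the sign of the factor in front decides
whether the left side of the edge is above or below it. -/
lemma cross_eq_mul_sub_lineAt {q : ℤ → ℝ × ℝ} {i : ℤ} (h : (q (i + 1)).1 ≠ (q i).1)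
    (w : ℝ × ℝ) :
    cross (q i) (q (i + 1)) w = ((q (i + 1)).1 - (q i).1) * (w.2 - lineAt q i w.1) := by
  have : (q (i + 1)).1 - (q i).1 ≠ 0 := sub_ne_zero.2 h
  unfold cross lineAt
  field_simp
  ring

lemma lineAt_mem_segment {q : ℤ → ℝ × ℝ} {i : ℤ} {X : ℝ} (h : (q (i + 1)).1 ≠ (q i).1)
    (h1 : min (q i).1 (q (i + 1)).1 ≤ X) (h2 : X ≤ max (q i).1 (q (i + 1)).1) :
    (X, lineAt q i X) ∈ segment ℝ (q i) (q (i + 1)) := by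
  have hd : (q (i + 1)).1 - (q i).1 ≠ 0 := sub_ne_zero.2 h
  rw [segment_eq_image']
  have key : (X - (q i).1) / ((q (i + 1)).1 - (q i).1) ∈ Set.Icc (0 : ℝ) 1 := by
    rcases lt_or_gt_of_ne h with h | h
    · rw [min_eq_right h.le] at h1
      rw [max_eq_left h.le] at h2
      constructor
      · exact div_nonneg_of_nonpos (by linarith) (by linarith)
      · rw [div_le_one_of_neg (by linarith)]
        linarith
    · rw [min_eq_left h.le] at h1
      rw [max_eq_right h.le] at h2
      constructor
      · exact div_nonneg (by linarith) (by linarith)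
      · rw [div_le_one (by linarith)]
        linarith
  refine ⟨_, key, Prod.ext ?_ ?_⟩
  · simp only [Prod.fst_add, Prod.smul_fst, Prod.fst_sub, smul_eq_mul]
    field_simp
    ring
  · simp only [Prod.snd_add, Prod.smul_snd, Prod.snd_sub, smul_eq_mul, lineAt]
    field_simp

lemma segment_cyc_subset_region (p : Fin n → ℝ × ℝ) (i : ℤ) :
    segment ℝ (cyc p i) (cyc p (i + 1)) ⊆ region p :=
  (convex_region p).segment_subset (cyc_mem_region p _) (cyc_mem_region p _)

/-- The position on the lower chain of the edge at abscissa `X`. -/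
noncomputable def lowPos (q : ℤ → ℝ × ℝ) (m M : ℤ) (X : ℝ) : ℤ :=
  -- Arbitrary if there is no break; for `X` strictly between the extreme abscissas there is one, by
  -- `exists_isBreak`.
  Classical.epsilon (IsBreak (lowX q) m M X)

/-- The position on the upper chain of the edge at abscissa `X`. -/
noncomputable def upPos (n : ℕ) (q : ℤ → ℝ × ℝ) (m M : ℤ) (X : ℝ) : ℤ :=
  Classical.epsilon (IsBreak (upX q) (-m) (n - M) X)

/-- The lower end of the vertical section at abscissa `X`. -/
noncomputable def lowY (q : ℤ → ℝ × ℝ) (m M : ℤ) (X : ℝ) : ℝ := lineAt q (lowPos q m M X) X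

/-- The upper end of the vertical section at abscissa `X`. -/
noncomputable def upY (n : ℕ) (q : ℤ → ℝ × ℝ) (m M : ℤ) (X : ℝ) : ℝ :=
  lineAt q (-upPos n q m M X - 1) X

lemma IsSpine.isBreak_lowPos (hs : IsSpine n (cyc p) m M)
    {X : ℝ} (h1 : (cyc p m).1 < X) (h2 : X < (cyc p M).1) :
    IsBreak (lowX (cyc p)) m M X (lowPos (cyc p) m M X) :=
  Classical.epsilon_spec (exists_isBreak hs.monotoneOn_lowX hs.lt.le h1 h2.le)

lemma IsSpine.isBreak_upPos (hp : IsConvexPolygon p) (hs : IsSpine n (cyc p) m M)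
    {X : ℝ} (h1 : (cyc p m).1 < X) (h2 : X < (cyc p M).1) :
    IsBreak (upX (cyc p)) (-m) (n - M) X (upPos n (cyc p) m M X) := by
  refine Classical.epsilon_spec (exists_isBreak (hs.monotoneOn_upX hp.isCyclicPolygon)
    (by have := hs.lt_add; omega) (by simpa [upX] using h1) ?_)
  rw [upX, neg_sub, ← hp.isCyclicPolygon.periodic, sub_add_cancel]
  exact h2.le

/-- The edges at the two ends of a vertical section. -/
lemma IsSpine.edges_at (hp : IsConvexPolygon p) (hs : IsSpine n (cyc p) m M)
    {X : ℝ} (h1 : (cyc p m).1 < X) (h2 : X < (cyc p M).1) :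
    (cyc p (lowPos (cyc p) m M X)).1 < X ∧ X ≤ (cyc p (lowPos (cyc p) m M X + 1)).1 ∧
    X ≤ (cyc p (-upPos n (cyc p) m M X - 1)).1 ∧
    (cyc p (-upPos n (cyc p) m M X - 1 + 1)).1 < X := by
  have hb := hs.isBreak_lowPos h1 h2
  have hc := hs.isBreak_upPos hp h1 h2
  -- One inequality of each pair is strict, so neither of the two edges is vertical.
  refine ⟨hb.lt_left, hb.le_right, ?_, ?_⟩
  · have := hc.le_right
    rwa [upX, neg_add] at this
  · have := hc.lt_left
    rw [sub_add_cancel]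
    exact this

lemma above_edge (hp : IsConvexPolygon p) {i : ℤ} (h : (cyc p i).1 < (cyc p (i + 1)).1)
    {w : ℝ × ℝ} (hw : w ∈ region p) : lineAt (cyc p) i w.1 ≤ w.2 := by
  have := cross_nonneg_of_mem_region hp i hw
  rw [cross_eq_mul_sub_lineAt h.ne'] at this
  have := (mul_nonneg_iff_of_pos_left (sub_pos.2 h)).1 this
  linarith

lemma below_edge (hp : IsConvexPolygon p) {i : ℤ} (h : (cyc p (i + 1)).1 < (cyc p i).1)
    {w : ℝ × ℝ} (hw : w ∈ region p) : w.2 ≤ lineAt (cyc p) i w.1 := by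
  have := cross_nonneg_of_mem_region hp i hw
  rw [cross_eq_mul_sub_lineAt h.ne] at this
  by_contra hc
  nlinarith [mul_neg_of_neg_of_pos (sub_neg.2 h) (sub_pos.2 (not_le.1 hc))]

/-- The region lies above its lower edge at `X` and below its upper edge at `X`. Conversely, the
points on these edges belong to the region, and so does the segment between them, by convexity. -/
lemma IsSpine.mem_region_iff (hp : IsConvexPolygon p) (hs : IsSpine n (cyc p) m M)
    {X : ℝ} (h1 : (cyc p m).1 < X) (h2 : X < (cyc p M).1) (y : ℝ) :
    (X, y) ∈ region p ↔ lowY (cyc p) m M X ≤ y ∧ y ≤ upY n (cyc p) m M X := by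
  obtain ⟨e1, e2, e3, e4⟩ := hs.edges_at hp h1 h2
  constructor
  · intro h
    exact ⟨above_edge hp (e1.trans_le e2) h, below_edge hp (e4.trans_le e3) h⟩
  · rintro ⟨hy1, hy2⟩
    have hl : (X, lowY (cyc p) m M X) ∈ region p := segment_cyc_subset_region p _ <|
      lineAt_mem_segment (e1.trans_le e2).ne' (min_le_of_left_le e1.le) (le_max_of_le_right e2)
    have hu : (X, upY n (cyc p) m M X) ∈ region p := segment_cyc_subset_region p _ <|
      lineAt_mem_segment (e4.trans_le e3).ne (min_le_of_right_le e4.le) (le_max_of_le_left e3)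
    refine (convex_region p).segment_subset hl hu ?_
    rw [← Prod.image_mk_segment_right]
    refine ⟨y, ?_, rfl⟩
    rw [segment_eq_Icc (hy1.trans hy2)]
    exact ⟨hy1, hy2⟩

/-- If the section were a single point, the lower and the upper line would meet there. The vertices
lie between these lines, so `M` and `m` force equal slopes, and all vertices are collinear. -/
lemma IsSpine.lowY_lt_upY (hp : IsConvexPolygon p) (hs : IsSpine n (cyc p) m M)
    {X : ℝ} (h1 : (cyc p m).1 < X) (h2 : X < (cyc p M).1) :
    lowY (cyc p) m M X < upY n (cyc p) m M X := by
  obtain ⟨e1, e2, e3, e4⟩ := hs.edges_at hp h1 h2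
  by_contra hle
  have heq : upY n (cyc p) m M X = lowY (cyc p) m M X := by
    refine le_antisymm (not_lt.1 hle) ?_
    have hl : (X, lowY (cyc p) m M X) ∈ region p := segment_cyc_subset_region p _ <|
      lineAt_mem_segment (e1.trans_le e2).ne' (min_le_of_left_le e1.le) (le_max_of_le_right e2)
    exact ((hs.mem_region_iff hp h1 h2 _).1 hl).2
  set a := lowPos (cyc p) m M X
  set b := -upPos n (cyc p) m M X - 1
  set c := lowY (cyc p) m M X
  obtain ⟨s, hs1⟩ : ∃ s, ∀ z, lineAt (cyc p) a z = c + s * (z - X) :=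
    ⟨((cyc p (a + 1)).2 - (cyc p a).2) / ((cyc p (a + 1)).1 - (cyc p a).1), fun z => by
      simp only [c, lowY, lineAt]; ring⟩
  obtain ⟨t, ht1⟩ : ∃ t, ∀ z, lineAt (cyc p) b z = c + t * (z - X) :=
    ⟨((cyc p (b + 1)).2 - (cyc p b).2) / ((cyc p (b + 1)).1 - (cyc p b).1), fun z => by
      simp only [← heq, upY, lineAt]; ring⟩
  have k1 : ∀ z, c + s * ((cyc p z).1 - X) ≤ (cyc p z).2 := fun z => by
    rw [← hs1]; exact above_edge hp (e1.trans_le e2) (cyc_mem_region p z)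
  have k2 : ∀ z, (cyc p z).2 ≤ c + t * ((cyc p z).1 - X) := fun z => by
    rw [← ht1]; exact below_edge hp (e4.trans_le e3) (cyc_mem_region p z)
  have hst : s = t := by
    apply le_antisymm
    · have := (k1 M).trans (k2 M)
      have h : s * ((cyc p M).1 - X) ≤ t * ((cyc p M).1 - X) := by linarith
      exact le_of_mul_le_mul_right h (by linarith)
    · have := (k1 m).trans (k2 m)
      have h : t * (X - (cyc p m).1) ≤ s * (X - (cyc p m).1) := by linarith
      exact le_of_mul_le_mul_right h (by linarith)
  have k : ∀ z, (cyc p z).2 = c + s * ((cyc p z).1 - X) := fun z =>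
    le_antisymm (hst ▸ k2 z) (k1 z)
  obtain ⟨i, j, hij⟩ := hp.isCyclicPolygon.not_collinear
  simp only [cross, k] at hij
  ring_nf at hij
  exact lt_irrefl _ hij

lemma IsSpine.fst_lt_of_mem_interior (hp : IsConvexPolygon p) (hs : IsSpine n (cyc p) m M)
    {w : ℝ × ℝ} (hw : w ∈ interior (region p)) : (cyc p m).1 < w.1 ∧ w.1 < (cyc p M).1 := by
  have hsub : interior (region p) ⊆ Prod.fst ⁻¹' Set.Icc (cyc p m).1 (cyc p M).1 :=
    interior_subset.trans fun v hv => hs.fst_mem_Icc hp hv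
  have := interior_maximal hsub isOpen_interior hw
  rw [← isOpenMap_fst.preimage_interior_eq_interior_preimage continuous_fst, interior_Icc] at this
  exact this

/-- The points that lie strictly to the left of every edge and strictly between the leftmost and
the rightmost points are interior points. -/
lemma IsSpine.mem_interior_of_cross_pos (hp : IsConvexPolygon p) (hs : IsSpine n (cyc p) m M)
    {w : ℝ × ℝ} (h1 : (cyc p m).1 < w.1) (h2 : w.1 < (cyc p M).1)
    (h : ∀ i : Fin n, 0 < cross (p i) (p (i + 1)) w) : w ∈ interior (region p) := by
  have hopen : IsOpen ({w : ℝ × ℝ | (cyc p m).1 < w.1 ∧ w.1 < (cyc p M).1} ∩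
      ⋂ i : Fin n, {w : ℝ × ℝ | 0 < cross (p i) (p (i + 1)) w}) := by
    refine IsOpen.inter ?_ (isOpen_iInter_of_finite fun i => ?_)
    · exact (isOpen_lt continuous_const continuous_fst).inter
        (isOpen_lt continuous_fst continuous_const)
    · unfold cross
      exact isOpen_lt continuous_const (by fun_prop)
  refine interior_maximal ?_ hopen ⟨⟨h1, h2⟩, Set.mem_iInter.2 h⟩
  rintro ⟨X, y⟩ ⟨⟨g1, g2⟩, g⟩
  have g' : ∀ z, 0 < cross (cyc p z) (cyc p (z + 1)) (X, y) := fun z => by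
    have := Set.mem_iInter.1 g (cycIdx n z)
    rwa [Set.mem_ofPred_eq, ← cycIdx_add_one] at this
  obtain ⟨e1, e2, e3, e4⟩ := hs.edges_at hp g1 g2
  rw [hs.mem_region_iff hp g1 g2]
  constructor
  · have := g' (lowPos (cyc p) m M X)
    rw [cross_eq_mul_sub_lineAt (e1.trans_le e2).ne'] at this
    have := (mul_pos_iff_of_pos_left (by linarith)).1 this
    simp only [lowY]
    linarith
  · have := g' (-upPos n (cyc p) m M X - 1)
    rw [cross_eq_mul_sub_lineAt (e4.trans_le e3).ne] at this
    simp only [upY]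
    by_contra hc
    nlinarith [mul_neg_of_neg_of_pos (sub_neg.2 (e4.trans_le e3)) (sub_pos.2 (not_le.1 hc))]

/-- For the converse, every `cross` must be positive. For a nonvertical edge it is strictly monotone
along the section and nonnegative at both ends. For a vertical edge it depends on the abscissa only
and is nonnegative at `m` and at `M`, between which `X` lies strictly. -/
lemma IsSpine.mem_interior_iff (hp : IsConvexPolygon p) (hs : IsSpine n (cyc p) m M)
    {X : ℝ} (h1 : (cyc p m).1 < X) (h2 : X < (cyc p M).1) (y : ℝ) :
    (X, y) ∈ interior (region p) ↔ lowY (cyc p) m M X < y ∧ y < upY n (cyc p) m M X := by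
  constructor
  · intro h
    have hopen : IsOpen {z : ℝ | (X, z) ∈ interior (region p)} :=
      isOpen_interior.preimage (by fun_prop : Continuous fun z : ℝ => (X, z))
    have hsub : {z : ℝ | (X, z) ∈ interior (region p)} ⊆
        Set.Icc (lowY (cyc p) m M X) (upY n (cyc p) m M X) := fun z hz =>
      (hs.mem_region_iff hp h1 h2 z).1 (interior_subset hz)
    have := interior_maximal hsub hopen h
    rwa [interior_Icc] at this
  · rintro ⟨hy1, hy2⟩
    refine hs.mem_interior_of_cross_pos hp h1 h2 fun i => ?_
    have hl : (X, lowY (cyc p) m M X) ∈ region p :=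
      (hs.mem_region_iff hp h1 h2 _).2 ⟨le_rfl, (hy1.trans hy2).le⟩
    have hu : (X, upY n (cyc p) m M X) ∈ region p :=
      (hs.mem_region_iff hp h1 h2 _).2 ⟨(hy1.trans hy2).le, le_rfl⟩
    have e : cyc p (i : ℕ) = p i := by rw [cyc, cycIdx_natCast]
    have e' : cyc p ((i : ℕ) + 1) = p (i + 1) := by rw [cyc, cycIdx_add_one, cycIdx_natCast]
    rw [← e, ← e']
    generalize ((i : ℕ) : ℤ) = z
    have k1 := cross_nonneg_of_mem_region hp z hl
    have k2 := cross_nonneg_of_mem_region hp z hu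
    have k3 := cross_nonneg_of_mem_region hp z (cyc_mem_region p m)
    have k4 := cross_nonneg_of_mem_region hp z (cyc_mem_region p M)
    have hz := hp.isCyclicPolygon.toLex_ne z
    simp only [cross] at *
    rcases lt_trichotomy (cyc p z).1 (cyc p (z + 1)).1 with h | h | h
    · nlinarith [mul_pos (sub_pos.2 h) (sub_pos.2 hy1)]
    · have hz2 : (cyc p (z + 1)).2 - (cyc p z).2 ≠ 0 := fun h' =>
        hz (by rw [Prod.ext h (by linarith : (cyc p z).2 = (cyc p (z + 1)).2)])
      rw [h, sub_self, zero_mul, zero_sub, neg_nonneg] at k3 k4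
      rw [h, sub_self, zero_mul, zero_sub, neg_pos]
      rcases lt_or_gt_of_ne hz2 with h' | h'
      · nlinarith [mul_neg_of_neg_of_pos h' (sub_pos.2 h1)]
      · nlinarith [mul_pos h' (sub_pos.2 h2)]
    · nlinarith [mul_pos (sub_pos.2 h) (sub_pos.2 hy2)]

end StripPartition

namespace StripPartition

/-! ### Cuts and their descriptors -/

/-- The vertical section at abscissa `X`. -/
noncomputable def cutAt (n : ℕ) (q : ℤ → ℝ × ℝ) (m M : ℤ) (X : ℝ) : VSegment :=
  ⟨X, lowY q m M X, upY n q m M X⟩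

/-- The descriptor of the vertical section at abscissa `X`. -/
noncomputable def descAt (n : ℕ) [NeZero n] (q : ℤ → ℝ × ℝ) (m M : ℤ) (X : ℝ) : Descriptor n :=
  ⟨cycIdx n (-upPos n q m M X - 1), cycIdx n (lowPos q m M X), X⟩

section Cuts

variable {n : ℕ} [NeZero n] {p : Fin n → ℝ × ℝ} {m M : ℤ}

/-- The interior points of a cut place its abscissa strictly between the extremes. Its ends lie in
the closed section but not in the open one, so they are the two ends of the section. -/
lemma IsSpine.isCut_iff (hp : IsConvexPolygon p) (hs : IsSpine n (cyc p) m M) (c : VSegment) :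
    IsCut (region p) c ↔
      (cyc p m).1 < c.x ∧ c.x < (cyc p M).1 ∧ c = cutAt n (cyc p) m M c.x := by
  have hcl := (isCompact_region p).isClosed
  constructor
  · rintro ⟨h, hb, ht, hi⟩
    obtain ⟨y, hy1, hy2⟩ := exists_between h
    obtain ⟨h1, h2⟩ := hs.fst_lt_of_mem_interior hp (hi y hy1 hy2)
    refine ⟨h1, h2, ?_⟩
    rw [hcl.frontier_eq] at hb ht
    have hb1 := (hs.mem_region_iff hp h1 h2 _).1 hb.1
    have ht1 := (hs.mem_region_iff hp h1 h2 _).1 ht.1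
    have hb2 := mt (hs.mem_interior_iff hp h1 h2 _).2 hb.2
    have ht2 := mt (hs.mem_interior_iff hp h1 h2 _).2 ht.2
    apply VSegment.ext
    · rfl
    · refine le_antisymm (not_lt.1 fun hlt => hb2 ⟨hlt, ?_⟩) hb1.1
      linarith [ht1.2]
    · refine le_antisymm ht1.2 (not_lt.1 fun hlt => ht2 ⟨?_, hlt⟩)
      linarith [hb1.1]
  · rintro ⟨h1, h2, hc⟩
    have hlt := hs.lowY_lt_upY hp h1 h2
    have hbot : c.bot = lowY (cyc p) m M c.x := congrArg VSegment.bot hc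
    have htop : c.top = upY n (cyc p) m M c.x := congrArg VSegment.top hc
    refine ⟨by rwa [hbot, htop], ?_, ?_, fun y hy1 hy2 => ?_⟩
    · rw [hcl.frontier_eq, hbot]
      exact ⟨(hs.mem_region_iff hp h1 h2 _).2 ⟨le_rfl, hlt.le⟩, fun h =>
        lt_irrefl _ ((hs.mem_interior_iff hp h1 h2 _).1 h).1⟩
    · rw [hcl.frontier_eq, htop]
      exact ⟨(hs.mem_region_iff hp h1 h2 _).2 ⟨hlt.le, le_rfl⟩, fun h =>
        lt_irrefl _ ((hs.mem_interior_iff hp h1 h2 _).1 h).2⟩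
    · rw [hs.mem_interior_iff hp h1 h2, ← hbot, ← htop]
      exact ⟨hy1, hy2⟩

lemma cross_eq_zero_of_mem_segment {a b w : ℝ × ℝ} (h : w ∈ segment ℝ a b) : cross a b w = 0 := by
  rw [segment_eq_image'] at h
  obtain ⟨t, -, rfl⟩ := h
  simp only [cross, Prod.fst_add, Prod.snd_add, Prod.smul_fst, Prod.smul_snd, Prod.fst_sub,
    Prod.snd_sub, smul_eq_mul]
  ring

lemma fst_mem_of_mem_segment {a b w : ℝ × ℝ} (h : w ∈ segment ℝ a b) :
    min a.1 b.1 ≤ w.1 ∧ w.1 ≤ max a.1 b.1 := by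
  have : w.1 ∈ segment ℝ a.1 b.1 := by
    have := Set.mem_image_of_mem (LinearMap.fst ℝ ℝ ℝ).toAffineMap h
    rwa [image_segment] at this
  rw [segment_eq_uIcc] at this
  exact this

lemma exists_mem_Ico_cycIdx_eq (m : ℤ) (i : Fin n) :
    ∃ z, m ≤ z ∧ z < m + n ∧ cycIdx n z = i := by
  have hn : (0 : ℤ) < n := by exact_mod_cast NeZero.pos n
  refine ⟨m + ((i : ℕ) - m) % n, ?_, ?_, ?_⟩
  · have := Int.emod_nonneg ((i : ℕ) - m : ℤ) hn.ne'
    omega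
  · have := Int.emod_lt_of_pos ((i : ℕ) - m : ℤ) hn
    omega
  · conv_rhs => rw [← cycIdx_natCast n i]
    rw [cycIdx_eq_iff, Int.add_emod_emod, add_sub_cancel]

lemma lineAt_eq_of_mem_segment {q : ℤ → ℝ × ℝ} {i : ℤ} {w : ℝ × ℝ}
    (h : (q (i + 1)).1 ≠ (q i).1) (hw : w ∈ segment ℝ (q i) (q (i + 1))) :
    w.2 = lineAt q i w.1 := by
  have := cross_eq_zero_of_mem_segment hw
  rw [cross_eq_mul_sub_lineAt h] at this
  rcases mul_eq_zero.1 this with h' | h'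
  · exact absurd h' (sub_ne_zero.2 h)
  · linarith

/-- A rising edge through the point lies on the lower chain and passes the local test for the break.
A vertical edge does not extend to the left. A falling edge bounds the region from above and cannot
contain the lower end, as the section has positive length. -/
lemma IsSpine.onLeftEdge_low_iff (hp : IsConvexPolygon p) (hs : IsSpine n (cyc p) m M)
    {X : ℝ} (h1 : (cyc p m).1 < X) (h2 : X < (cyc p M).1) (i : Fin n) :
    OnLeftEdge p (X, lowY (cyc p) m M X) i ↔ i = cycIdx n (lowPos (cyc p) m M X) := by
  obtain ⟨e1, e2, e3, e4⟩ := hs.edges_at hp h1 h2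
  constructor
  · obtain ⟨z, hz1, hz2, rfl⟩ := exists_mem_Ico_cycIdx_eq m i
    rintro ⟨hseg, hmin⟩
    rw [← cycIdx_add_one] at hseg hmin
    change _ ∈ segment ℝ (cyc p z) (cyc p (z + 1)) at hseg
    change min (cyc p z).1 (cyc p (z + 1)).1 < X at hmin
    have hx := fst_mem_of_mem_segment hseg
    dsimp only at hx
    rcases lt_trichotomy (cyc p z).1 (cyc p (z + 1)).1 with h | h | h
    · have hzM : z < M := by
        by_contra hc
        have := fst_le_of_toLex_lt (hs.fall z (by omega) hz2)
        linarith
      rw [min_eq_left h.le] at hmin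
      rw [max_eq_right h.le] at hx
      rw [(hs.isBreak_lowPos h1 h2).unique hz1 hzM hmin hx.2]
    · rw [h, min_self] at hmin
      rw [h, max_self] at hx
      linarith [hx.2]
    · have k := lineAt_eq_of_mem_segment h.ne hseg
      have hu := (hs.mem_region_iff hp h1 h2 (upY n (cyc p) m M X)).2
        ⟨(hs.lowY_lt_upY hp h1 h2).le, le_rfl⟩
      have := below_edge hp h hu
      dsimp only at this k
      linarith [hs.lowY_lt_upY hp h1 h2]
  · rintro rfl
    refine ⟨?_, ?_⟩ <;> rw [← cycIdx_add_one]
    · exact lineAt_mem_segment (q := cyc p) (e1.trans_le e2).ne' (min_le_of_left_le e1.le)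
        (le_max_of_le_right e2)
    · exact min_lt_of_left_lt e1

lemma IsSpine.onLeftEdge_up_iff (hp : IsConvexPolygon p) (hs : IsSpine n (cyc p) m M)
    {X : ℝ} (h1 : (cyc p m).1 < X) (h2 : X < (cyc p M).1) (i : Fin n) :
    OnLeftEdge p (X, upY n (cyc p) m M X) i ↔ i = cycIdx n (-upPos n (cyc p) m M X - 1) := by
  obtain ⟨e1, e2, e3, e4⟩ := hs.edges_at hp h1 h2
  constructor
  · obtain ⟨z, hz1, hz2, rfl⟩ := exists_mem_Ico_cycIdx_eq m i
    rintro ⟨hseg, hmin⟩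
    rw [← cycIdx_add_one] at hseg hmin
    change _ ∈ segment ℝ (cyc p z) (cyc p (z + 1)) at hseg
    change min (cyc p z).1 (cyc p (z + 1)).1 < X at hmin
    have hx := fst_mem_of_mem_segment hseg
    dsimp only at hx
    rcases lt_trichotomy (cyc p z).1 (cyc p (z + 1)).1 with h | h | h
    · have k := lineAt_eq_of_mem_segment h.ne' hseg
      have hl := (hs.mem_region_iff hp h1 h2 (lowY (cyc p) m M X)).2
        ⟨le_rfl, (hs.lowY_lt_upY hp h1 h2).le⟩
      have := above_edge hp h hl
      dsimp only at this k
      linarith [hs.lowY_lt_upY hp h1 h2]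
    · rw [h, min_self] at hmin
      rw [h, max_self] at hx
      linarith [hx.2]
    · have hzM : M ≤ z := by
        by_contra hc
        have := fst_le_of_toLex_lt (hs.rise z hz1 (by omega))
        linarith
      rw [min_eq_right h.le] at hmin
      rw [max_eq_left h.le] at hx
      have hper := hp.isCyclicPolygon.periodic
      -- The position on the upper chain that stands for edge `z`: its vertices `-c` and `-c - 1`
      -- are `z + 1` and `z`, shifted by a period.
      rw [← (hs.isBreak_upPos hp h1 h2).unique (c := n - z - 1) (by omega) (by omega)
        (by rw [upX, ← hper, show -(n - z - 1) + (n : ℤ) = z + 1 by ring]; exact hmin)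
        (by rw [upX, ← hper, show -(n - z - 1 + 1) + (n : ℤ) = z by ring]; exact hx.2)]
      rw [cycIdx_eq_iff, show -((n : ℤ) - z - 1) - 1 = z - n by ring, Int.sub_emod_right]
  · rintro rfl
    refine ⟨?_, ?_⟩ <;> rw [← cycIdx_add_one]
    · exact lineAt_mem_segment (q := cyc p) (e4.trans_le e3).ne (min_le_of_right_le e4.le)
        (le_max_of_le_left e3)
    · exact min_lt_of_right_lt e4

lemma IsSpine.isDescriptor_iff (hp : IsConvexPolygon p) (hs : IsSpine n (cyc p) m M)
    {X : ℝ} (h1 : (cyc p m).1 < X) (h2 : X < (cyc p M).1) (d : Descriptor n) :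
    IsDescriptor p (cutAt n (cyc p) m M X) d ↔ d = descAt n (cyc p) m M X := by
  obtain ⟨t, b, x⟩ := d
  simp only [IsDescriptor, cutAt, descAt, Descriptor.mk.injEq, hs.onLeftEdge_low_iff hp h1 h2,
    hs.onLeftEdge_up_iff hp h1 h2]
  tauto

/-! ### Codewords -/

lemma eq_of_pairwise_lt {l l' : List ℝ} (h : l.Pairwise (· < ·)) (h' : l'.Pairwise (· < ·))
    (hm : ∀ x, x ∈ l ↔ x ∈ l') : l = l' :=
  ((List.perm_ext_iff_of_nodup (h.imp fun h => h.ne) (h'.imp fun h => h.ne)).2 hm).eq_of_sortedLE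
    (h.imp fun h => h.le).sortedLE (h'.imp fun h => h.le).sortedLE

lemma IsSpine.isCodeword_of_pairwise (hp : IsConvexPolygon p) (hs : IsSpine n (cyc p) m M)
    {C : Finset VSegment} {xs : List ℝ} (hxs : xs.Pairwise (· < ·))
    (hx : ∀ X ∈ xs, (cyc p m).1 < X ∧ X < (cyc p M).1)
    (hC : ∀ c, c ∈ C ↔ ∃ X ∈ xs, c = cutAt n (cyc p) m M X) :
    IsCodeword p C (hybridCode p (xs.map (descAt n (cyc p) m M))) := by
  refine ⟨xs.map (cutAt n (cyc p) m M), xs.map (descAt n (cyc p) m M), ?_, ?_, ?_, rfl⟩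
  · rw [List.pairwise_map]
    exact hxs
  · intro c
    rw [hC, List.mem_map]
    simp only [eq_comm]
  · rw [List.forall₂_map_left_iff, List.forall₂_map_right_iff, List.forall₂_same]
    exact fun X hX => (hs.isDescriptor_iff hp (hx X hX).1 (hx X hX).2 _).2 rfl

/-- The abscissas of a codeword's cuts, from left to right. -/
lemma IsSpine.exists_of_isCodeword (hp : IsConvexPolygon p) (hs : IsSpine n (cyc p) m M)
    {C : Finset VSegment} (hC : ∀ c ∈ C, IsCut (region p) c) {w : List Cell}
    (hw : IsCodeword p C w) : ∃ xs : List ℝ, xs.Pairwise (· < ·) ∧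
      (∀ c, c ∈ C ↔ ∃ X ∈ xs, c = cutAt n (cyc p) m M X) ∧
      w = hybridCode p (xs.map (descAt n (cyc p) m M)) := by
  obtain ⟨cs, ds, h1, h2, h3, rfl⟩ := hw
  have hcs : ∀ c ∈ cs, (cyc p m).1 < c.x ∧ c.x < (cyc p M).1 ∧ c = cutAt n (cyc p) m M c.x :=
    fun c hc => (hs.isCut_iff hp c).1 (hC c ((h2 c).1 hc))
  refine ⟨cs.map VSegment.x, ?_, fun c => ?_, ?_⟩
  · rw [List.pairwise_map]
    exact h1
  · rw [← h2]
    constructor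
    · exact fun hc => ⟨c.x, List.mem_map_of_mem hc, (hcs c hc).2.2⟩
    · rintro ⟨X, hX, rfl⟩
      obtain ⟨c, hc, rfl⟩ := List.mem_map.1 hX
      rw [← (hcs c hc).2.2]
      exact hc
  · congr 1
    clear h1 h2
    induction h3 with
    | nil => rfl
    | @cons c d cs ds hcd _ ih =>
      obtain ⟨k1, k2, k3⟩ := hcs c (by simp)
      rw [k3, hs.isDescriptor_iff hp k1 k2] at hcd
      rw [List.map_cons, List.map_cons, ← ih fun c hc => hcs c (by simp [hc]), hcd]

end Cuts

/-! ### Injectivity of the encodings -/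

lemma literalCode_injective {n : ℕ} : Function.Injective (literalCode (n := n)) := by
  intro l
  induction l with
  | nil =>
    intro l' h
    cases l' with
    | nil => rfl
    | cons d l' => simp [literalCode] at h
  | cons d l ih =>
    intro l' h
    cases l' with
    | nil => simp [literalCode] at h
    | cons d' l' =>
      obtain ⟨t, b, x⟩ := d
      obtain ⟨t', b', x'⟩ := d'
      simp only [literalCode, List.flatMap_cons, List.cons_append, List.nil_append,
        List.cons.injEq, Cell.int.injEq, Cell.real.injEq, Nat.cast_inj, Fin.val_inj] at h
      obtain ⟨rfl, rfl, rfl, h⟩ := h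
      rw [ih h]

/-- The descriptors that a run stands for. -/
def Run.expand {n : ℕ} (r : Run n) : List (Descriptor n) :=
  (List.range r.len).map fun i : ℕ => ⟨r.topEdge, r.botEdge, r.x + i⟩

lemma Run.expand_succ {n : ℕ} (t b : Fin n) (x : ℝ) (k : ℕ) :
    Run.expand ⟨t, b, x, k + 1⟩ = ⟨t, b, x⟩ :: Run.expand ⟨t, b, x + 1, k⟩ := by
  simp only [Run.expand, List.range_succ_eq_map, List.map_cons, List.map_map, Nat.cast_zero,
    add_zero, List.cons.injEq, true_and]
  refine List.map_congr_left fun i _ => ?_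
  simp only [Function.comp_apply, Nat.succ_eq_add_one, Nat.cast_add, Nat.cast_one,
    Descriptor.mk.injEq, true_and]
  ring

/-- Expansion is a left inverse of `runs`, which makes the grouping injective. -/
lemma flatMap_expand_runs {n : ℕ} (l : List (Descriptor n)) :
    (runs l).flatMap Run.expand = l := by
  induction l with
  | nil => rfl
  | cons d l ih =>
    obtain ⟨t, b, x⟩ := d
    rw [runs]
    have h1 : Run.expand ⟨t, b, x, 1⟩ = [⟨t, b, x⟩] := by
      rw [Run.expand_succ]; rfl
    split
    · rename_i h
      rw [h] at ih
      simp only [List.flatMap_nil] at ih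
      subst ih
      simp [h1]
    · rename_i r rs h
      rw [h, List.flatMap_cons] at ih
      split_ifs with hc
      · obtain ⟨t', b', x', k⟩ := r
        obtain ⟨rfl, rfl, rfl⟩ := hc
        rw [List.flatMap_cons, Run.expand_succ, List.cons_append, ih]
      · rw [List.flatMap_cons, List.flatMap_cons, ih, h1]
        rfl

lemma runLengthCode_injective {n : ℕ} : Function.Injective (runLengthCode (n := n)) := by
  have key : Function.Injective fun rs : List (Run n) => rs.flatMap fun r =>
      [Cell.int (r.topEdge : ℕ), .int (r.botEdge : ℕ), .real r.x, .real r.len] := by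
    intro l
    induction l with
    | nil =>
      intro l' h
      cases l' with
      | nil => rfl
      | cons d l' => simp at h
    | cons d l ih =>
      intro l' h
      cases l' with
      | nil => simp at h
      | cons d' l' =>
        obtain ⟨t, b, x, k⟩ := d
        obtain ⟨t', b', x', k'⟩ := d'
        simp only [List.flatMap_cons, List.cons_append, List.nil_append,
          List.cons.injEq, Cell.int.injEq, Cell.real.injEq, Nat.cast_inj, Fin.val_inj] at h
        obtain ⟨rfl, rfl, rfl, rfl, h⟩ := h
        rw [ih h]
  intro l l' h
  rw [← flatMap_expand_runs l, key h, flatMap_expand_runs]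

/-- The polygon alone decides the form, so a literal word is never compared with a run-length word.
-/
lemma hybridCode_injective {n : ℕ} (p : Fin n → ℝ × ℝ) : Function.Injective (hybridCode p) := by
  intro l l' h
  unfold hybridCode at h
  split_ifs at h
  · exact literalCode_injective h
  · exact runLengthCode_injective h

/-- The hybrid encoding is lossless. -/
theorem hybrid_lossless {n : ℕ} [NeZero n] {p : Fin n → ℝ × ℝ} (hp : IsConvexPolygon p) :
    (∀ C, IsStripPartition (region p) C → ∃! w, IsCodeword p C w) ∧
    (∀ C C' w, IsStripPartition (region p) C → IsStripPartition (region p) C' →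
      IsCodeword p C w → IsCodeword p C' w → C = C') := by
  obtain ⟨m, M, hs⟩ := exists_isSpine hp
  constructor
  · intro C hC
    have hcut := fun c hc => (hs.isCut_iff hp c).1 (hC.1 c hc)
    have hmem : ∀ X, X ∈ (C.image VSegment.x).sort ↔ ∃ c ∈ C, c.x = X := by simp
    have hCmem : ∀ c, c ∈ C ↔ ∃ X ∈ (C.image VSegment.x).sort, c = cutAt n (cyc p) m M X := by
      intro c
      constructor
      · exact fun hc => ⟨c.x, (hmem _).2 ⟨c, hc, rfl⟩, (hcut c hc).2.2⟩
      · rintro ⟨X, hX, rfl⟩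
        obtain ⟨c, hc, rfl⟩ := (hmem _).1 hX
        rw [← (hcut c hc).2.2]
        exact hc
    refine ⟨_, hs.isCodeword_of_pairwise hp (C.image VSegment.x).sortedLT_sort.pairwise ?_ hCmem,
      fun w hw => ?_⟩
    · intro X hX
      obtain ⟨c, hc, rfl⟩ := (hmem _).1 hX
      exact ⟨(hcut c hc).1, (hcut c hc).2.1⟩
    · obtain ⟨xs, h1, h2, rfl⟩ := hs.exists_of_isCodeword hp hC.1 hw
      congr 2
      refine eq_of_pairwise_lt h1 (C.image VSegment.x).sortedLT_sort.pairwise fun X => ?_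
      rw [hmem]
      constructor
      · exact fun hX => ⟨_, (h2 _).2 ⟨X, hX, rfl⟩, rfl⟩
      · rintro ⟨c, hc, rfl⟩
        obtain ⟨X, hX, h⟩ := (h2 c).1 hc
        rw [h]
        exact hX
  · intro C C' w hC hC' hw hw'
    obtain ⟨xs, -, h2, rfl⟩ := hs.exists_of_isCodeword hp hC.1 hw
    obtain ⟨ys, -, h2', h⟩ := hs.exists_of_isCodeword hp hC'.1 hw'
    -- The descriptors contain the abscissas, and these determine the cuts.
    have h := congrArg (List.map Descriptor.x) (hybridCode_injective p h)
    have hid : Descriptor.x ∘ descAt n (cyc p) m M = id := rfl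
    rw [List.map_map, List.map_map, hid, List.map_id, List.map_id] at h
    subst h
    ext c
    rw [h2, h2']

/-! ### The minimum number of strips -/

section Strips

variable {n : ℕ} [NeZero n] {p : Fin n → ℝ × ℝ} {m M : ℤ}

lemma subset_region_of_mem_pieces {n : ℕ} {p : Fin n → ℝ × ℝ} {C : Finset VSegment} {Q : Set (ℝ × ℝ)}
    (hQ : Q ∈ pieces (region p) C) : Q ⊆ region p := by
  obtain ⟨q, -, rfl⟩ := hQ
  refine closure_minimal ?_ (isCompact_region p).isClosed
  exact (connectedComponentIn_subset _ _).trans (Set.sdiff_subset.trans interior_subset)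

/-- A measure argument: except at the abscissas of the cuts, which form a null set, every vertical
section meets a piece. So the projections of the `k` pieces, each of measure at most one, cover
almost all of the width. -/
lemma IsSpine.width_le_card_pieces (hp : IsConvexPolygon p) (hs : IsSpine n (cyc p) m M)
    {C : Finset VSegment} (hC : IsStripPartition (region p) C) {k : ℕ}
    (hk : (pieces (region p) C).encard = k) : (cyc p M).1 - (cyc p m).1 ≤ k := by
  have hfin : (pieces (region p) C).Finite := Set.finite_of_encard_eq_coe hk
  have hcard : hfin.toFinset.card = k := by
    rw [← Nat.cast_inj (R := ℕ∞), ← hfin.encard_eq_coe_toFinset_card, hk]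
  have hsub : Set.Ioo (cyc p m).1 (cyc p M).1 \ (C.image VSegment.x : Finset ℝ) ⊆
      ⋃ Q ∈ hfin.toFinset, Prod.fst '' Q := by
    rintro X ⟨⟨h1, h2⟩, hX⟩
    obtain ⟨y, hy⟩ := exists_between (hs.lowY_lt_upY hp h1 h2)
    have hq : (X, y) ∈ uncut (region p) C := by
      refine ⟨(hs.mem_interior_iff hp h1 h2 y).2 hy, ?_⟩
      simp only [Set.mem_iUnion, not_exists]
      intro c hc hXc
      exact hX (by simpa using ⟨c, hc, hXc.1.symm⟩)
    rw [Set.mem_iUnion₂]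
    exact ⟨_, hfin.mem_toFinset.2 ⟨_, hq, rfl⟩, _, subset_closure (mem_connectedComponentIn hq), rfl⟩
  have hvol : ∀ Q ∈ hfin.toFinset, MeasureTheory.volume (Prod.fst '' Q) ≤ 1 := by
    intro Q hQ
    rw [hfin.mem_toFinset] at hQ
    have hc := (isCompact_region p).image continuous_fst
    have hQs := Set.image_mono (f := Prod.fst) (subset_region_of_mem_pieces hQ)
    have : Prod.fst '' Q ⊆ Set.Icc (leftX Q) (rightX Q) := fun x hx =>
      ⟨csInf_le (hc.bddBelow.mono hQs) hx, le_csSup (hc.bddAbove.mono hQs) hx⟩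
    calc MeasureTheory.volume (Prod.fst '' Q)
        ≤ MeasureTheory.volume (Set.Icc (leftX Q) (rightX Q)) := MeasureTheory.measure_mono this
      _ = ENNReal.ofReal (hwidth Q) := by rw [Real.volume_Icc]; rfl
      _ ≤ 1 := by
        rw [ENNReal.ofReal_le_one]
        exact hC.2 Q hQ
  have hle := calc
    ENNReal.ofReal ((cyc p M).1 - (cyc p m).1)
        = MeasureTheory.volume (Set.Ioo (cyc p m).1 (cyc p M).1 \
            (C.image VSegment.x : Finset ℝ)) := by
          rw [MeasureTheory.measure_sdiff_null (Finset.measure_zero _ _), Real.volume_Ioo]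
      _ ≤ MeasureTheory.volume (⋃ Q ∈ hfin.toFinset, Prod.fst '' Q) :=
          MeasureTheory.measure_mono hsub
      _ ≤ ∑ Q ∈ hfin.toFinset, MeasureTheory.volume (Prod.fst '' Q) :=
          MeasureTheory.measure_biUnion_finset_le _ _
      _ ≤ ∑ Q ∈ hfin.toFinset, 1 := Finset.sum_le_sum hvol
      _ = k := by rw [Finset.sum_const, hcard, nsmul_eq_mul, mul_one]
  rw [← ENNReal.ofReal_natCast, ENNReal.ofReal_le_ofReal_iff (Nat.cast_nonneg k)] at hle
  exact hle

/-- The cuts at unit distances from the leftmost points. -/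
lemma IsSpine.unit_cuts (hp : IsConvexPolygon p) (hs : IsSpine n (cyc p) m M)
    {C : Finset VSegment} {k : ℕ} (hk : k = ⌈(cyc p M).1 - (cyc p m).1⌉₊)
    (hC : ∀ c, c ∈ C ↔ ∃ j : ℕ, 1 ≤ j ∧ j < k ∧ c = cutAt n (cyc p) m M ((cyc p m).1 + j)) :
    IsStripPartition (region p) C ∧ (pieces (region p) C).encard ≤ k := by
  set l := (cyc p m).1 with hl
  set r := (cyc p M).1 with hr
  have hlr : l < r := hs.fst_lt_fst hp
  have hrk : r - l ≤ k := hk ▸ Nat.le_ceil _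
  have hj : ∀ j : ℕ, j < k → (j : ℝ) < r - l := fun j hj => Nat.lt_ceil.1 (hk ▸ hj)
  have huncut : ∀ q ∈ uncut (region p) C, ∀ j : ℕ, 1 ≤ j → j < k → q.1 ≠ l + j := by
    rintro ⟨X, y⟩ ⟨hq, hq'⟩ j hj1 hjk hX
    dsimp only at hX
    obtain ⟨h1, h2⟩ := hs.fst_lt_of_mem_interior hp hq
    apply hq'
    rw [Set.mem_iUnion₂]
    refine ⟨_, (hC _).2 ⟨j, hj1, hjk, rfl⟩, hX, ?_⟩
    have := (hs.mem_interior_iff hp h1 h2 y).1 hq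
    rw [← hX]
    exact ⟨this.1.le, this.2.le⟩
  have hxmem : ∀ q ∈ uncut (region p) C, l < q.1 ∧ q.1 < r :=
    fun q hq => hs.fst_lt_of_mem_interior hp hq.1
  -- the slab of a point
  have hceil : ∀ q ∈ uncut (region p) C, 1 ≤ ⌈q.1 - l⌉₊ ∧ ⌈q.1 - l⌉₊ ≤ k := by
    intro q hq
    obtain ⟨h1, h2⟩ := hxmem q hq
    exact ⟨Nat.ceil_pos.2 (by linarith), Nat.ceil_le.2 (by linarith)⟩
  -- The segment between two points of one slab stays in the interior by convexity and misses every
  -- cut, so each slab holds at most one component.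
  have hsame : ∀ q ∈ uncut (region p) C, ∀ q' ∈ uncut (region p) C, ⌈q.1 - l⌉₊ = ⌈q'.1 - l⌉₊ →
      connectedComponentIn (uncut (region p) C) q =
        connectedComponentIn (uncut (region p) C) q' := by
    intro q hq q' hq' he
    have hseg : segment ℝ q q' ⊆ uncut (region p) C := by
      intro w hw
      refine ⟨(convex_region p).interior.segment_subset hq.1 hq'.1 hw, ?_⟩
      rw [Set.mem_iUnion₂]
      rintro ⟨c, hc, hwc⟩
      obtain ⟨j, hj1, hjk, rfl⟩ := (hC c).1 hc
      have hwj : w.1 = l + j := hwc.1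
      obtain ⟨g1, g2⟩ := fst_mem_of_mem_segment hw
      have n1 := huncut q hq j hj1 hjk
      have n2 := huncut q' hq' j hj1 hjk
      have hle : ⌈min q.1 q'.1 - l⌉₊ = ⌈max q.1 q'.1 - l⌉₊ := by
        rcases le_total q.1 q'.1 with h | h
        · rw [min_eq_left h, max_eq_right h, he]
        · rw [min_eq_right h, max_eq_left h, he]
      have hlt : j < ⌈max q.1 q'.1 - l⌉₊ := by
        rw [Nat.lt_ceil]
        have : w.1 ≠ max q.1 q'.1 := by
          rcases max_choice q.1 q'.1 with h | h <;> rw [h, hwj]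
          · exact n1.symm
          · exact n2.symm
        have := lt_of_le_of_ne g2 this
        linarith
      rw [← hle, Nat.lt_ceil] at hlt
      linarith
    exact connectedComponentIn_eq ((convex_segment q q').isPreconnected.subset_connectedComponentIn
      (left_mem_segment ℝ q q') hseg (right_mem_segment ℝ q q'))
  refine ⟨⟨?_, ?_⟩, ?_⟩
  · intro c hc
    obtain ⟨j, hj1, hjk, rfl⟩ := (hC c).1 hc
    have h1 : (1 : ℝ) ≤ j := by exact_mod_cast hj1
    refine (hs.isCut_iff hp _).2 ⟨?_, ?_, rfl⟩
    · change l < l + j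
      linarith
    · change l + j < r
      linarith [hj j hjk]
  · rintro Q ⟨q, hq, rfl⟩
    set K := connectedComponentIn (uncut (region p) C) q with hK
    set i := ⌈q.1 - l⌉₊ with hi
    obtain ⟨hi1, hik⟩ : 1 ≤ i ∧ i ≤ k := hceil q hq
    have hqK : q ∈ K := mem_connectedComponentIn hq
    have hKs : K ⊆ uncut (region p) C := connectedComponentIn_subset _ _
    -- A component projects to an interval that avoids all abscissas of cuts, hence it stays in the
    -- slab of `q`.
    have hpre : IsPreconnected (Prod.fst '' K) :=
      isPreconnected_connectedComponentIn.image _ continuous_fst.continuousOn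
    have hord := hpre.ordConnected
    have hno : ∀ j : ℕ, 1 ≤ j → j < k → l + j ∉ Prod.fst '' K := by
      rintro j hj1 hjk ⟨w, hw, hwj⟩
      exact huncut w (hKs hw) j hj1 hjk hwj
    have hqi : q.1 ≤ l + i := by linarith [Nat.le_ceil (q.1 - l)]
    have hqi' : l + (i - 1 : ℕ) < q.1 := by
      have := Nat.lt_ceil.1 (show i - 1 < ⌈q.1 - l⌉₊ by omega)
      linarith
    have hslab : K ⊆ Prod.fst ⁻¹' Set.Icc (l + (i - 1 : ℕ)) (l + i) := by
      intro w hw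
      obtain ⟨w1, w2⟩ := hxmem w (hKs hw)
      constructor
      · by_contra hc
        rw [not_le] at hc
        -- The first slab is bounded on the left by the polygon itself, not by a cut; the last slab
        -- likewise on the right.
        rcases Nat.eq_zero_or_pos (i - 1) with h0 | h0
        · rw [h0, Nat.cast_zero, add_zero] at hc
          linarith
        · exact hno (i - 1) h0 (by omega) (hord.out ⟨w, hw, rfl⟩ ⟨q, hqK, rfl⟩ ⟨hc.le, hqi'.le⟩)
      · by_contra hc
        rw [not_le] at hc
        rcases hik.lt_or_eq with h | h
        · exact hno i hi1 h (hord.out ⟨q, hqK, rfl⟩ ⟨w, hw, rfl⟩ ⟨hqi, hc.le⟩)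
        · rw [h] at hc
          linarith
    have hcl : closure K ⊆ Prod.fst ⁻¹' Set.Icc (l + (i - 1 : ℕ)) (l + i) :=
      closure_minimal hslab (isClosed_Icc.preimage continuous_fst)
    have hne : (Prod.fst '' closure K).Nonempty := ⟨_, q, subset_closure hqK, rfl⟩
    have k1 : l + (i - 1 : ℕ) ≤ leftX (closure K) := le_csInf hne (by
      rintro _ ⟨w, hw, rfl⟩
      exact (hcl hw).1)
    have k2 : rightX (closure K) ≤ l + i := csSup_le hne (by
      rintro _ ⟨w, hw, rfl⟩
      exact (hcl hw).2)
    have : ((i - 1 : ℕ) : ℝ) = i - 1 := by rw [Nat.cast_sub hi1, Nat.cast_one]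
    rw [hwidth]
    linarith
  · classical
    -- Choosing one point per slab maps `{1, …, k}` onto a family that contains all pieces.
    set G : ℕ → Set (ℝ × ℝ) := fun i => closure (connectedComponentIn (uncut (region p) C)
      (Classical.epsilon fun q => q ∈ uncut (region p) C ∧ ⌈q.1 - l⌉₊ = i))
    have hsub : pieces (region p) C ⊆ ((Finset.Icc 1 k).image G : Finset (Set (ℝ × ℝ))) := by
      rintro Q ⟨q, hq, rfl⟩
      have hspec := Classical.epsilon_spec
        (p := fun q' => q' ∈ uncut (region p) C ∧ ⌈q'.1 - l⌉₊ = ⌈q.1 - l⌉₊) ⟨q, hq, rfl⟩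
      rw [Finset.coe_image]
      refine ⟨⌈q.1 - l⌉₊, ?_, ?_⟩
      · rw [Finset.mem_coe, Finset.mem_Icc]
        exact hceil q hq
      · simp only [G]
        rw [hsame _ hspec.1 q hq hspec.2]
    refine (Set.encard_le_encard hsub).trans ?_
    rw [Set.encard_coe_eq_coe_finsetCard]
    refine (Nat.cast_le.2 Finset.card_image_le).trans ?_
    simp

/-- The minimum number of strips is the width, rounded up. -/
lemma IsSpine.isOpt_of_unit_cuts (hp : IsConvexPolygon p) (hs : IsSpine n (cyc p) m M)
    {C : Finset VSegment} {k : ℕ} (hk : k = ⌈(cyc p M).1 - (cyc p m).1⌉₊)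
    (hC : ∀ c, c ∈ C ↔ ∃ j : ℕ, 1 ≤ j ∧ j < k ∧ c = cutAt n (cyc p) m M ((cyc p m).1 + j)) :
    IsStripPartition (region p) C ∧ (pieces (region p) C).encard = k ∧ IsOpt (region p) k := by
  obtain ⟨h1, h2⟩ := hs.unit_cuts hp hk hC
  have hlow : ∀ C', IsStripPartition (region p) C' → ∀ j : ℕ,
      (pieces (region p) C').encard = j → k ≤ j := fun C' hC' j hj => by
    rw [hk]
    exact Nat.ceil_le.2 (hs.width_le_card_pieces hp hC' hj)
  obtain ⟨j, hj⟩ : ∃ j : ℕ, (pieces (region p) C).encard = j :=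
    ⟨_, (ENat.natCast_toNat (h2.trans_lt (ENat.natCast_lt_top k)).ne).symm⟩
  -- Equality comes from the lower bound, so it need not be shown that every slab contributes its
  -- own piece.
  have hjk : j = k := le_antisymm (by rw [hj] at h2; exact_mod_cast h2) (hlow C h1 j hj)
  subst hjk
  refine ⟨h1, hj, ⟨C, h1, hj⟩, ?_⟩
  rintro i ⟨C', hC', hi⟩
  exact hlow C' hC' i hi

/-- The set of cuts at unit distances. -/
lemma exists_unit_cuts (n : ℕ) (q : ℤ → ℝ × ℝ) (m M : ℤ) (l : ℝ) (k : ℕ) :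
    ∃ C : Finset VSegment, ∀ c, c ∈ C ↔
      ∃ j : ℕ, 1 ≤ j ∧ j < k ∧ c = cutAt n q m M (l + j) := by
  classical
  refine ⟨(Finset.Ico 1 k).image fun j : ℕ => cutAt n q m M (l + j), fun c => ?_⟩
  simp only [Finset.mem_image, Finset.mem_Ico, and_assoc, eq_comm]

end Strips

end StripPartition

namespace StripPartition

/-! ### Programs without loops -/

open Classical in
/-- The effect of a program without loops. -/
noncomputable def Program.run (inp : Input) : Program → State → State
  | .skip, s => s
  | .setInt k a, s => { s with intReg := Function.update s.intReg k (a.eval inp s) }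
  | .setReal k a, s => { s with realReg := Function.update s.realReg k (a.eval inp s) }
  | .storeInt b a, s =>
    { s with intMem := Function.update s.intMem (b.eval inp s) (a.eval inp s) }
  | .storeReal b a, s =>
    { s with realMem := Function.update s.realMem (b.eval inp s) (a.eval inp s) }
  | .writeInt a, s => { s with out := s.out ++ [.int (a.eval inp s)] }
  | .writeReal a, s => { s with out := s.out ++ [.real (a.eval inp s)] }
  | .seq c d, s => d.run inp (c.run inp s)
  | .ite b c d, s => if b.Holds inp s then c.run inp s else d.run inp s
  -- A default value: `run` is tied to `Exec` under `LoopFree` only.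
  | .loop _ _, s => s

/-- The program has no loops. -/
def Program.LoopFree : Program → Prop
  | .seq c d => c.LoopFree ∧ d.LoopFree
  | .ite _ c d => c.LoopFree ∧ d.LoopFree
  | .loop _ _ => False
  | _ => True

/-- A bound on the running time of a program without loops. -/
def Program.maxCost : Program → ℕ
  | .skip => 1
  | .setInt _ a => a.cost + 1
  | .setReal _ a => a.cost + 1
  | .storeInt b a => b.cost + a.cost + 1
  | .storeReal b a => b.cost + a.cost + 1
  | .writeInt a => a.cost + 1
  | .writeReal a => a.cost + 1
  | .seq c d => c.maxCost + d.maxCost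
  | .ite b c d => b.cost + (c.maxCost + d.maxCost) + 1
  | .loop _ _ => 0

/-- Reduces code without loops to the evaluation of a function with a constant time bound;
executions are built by hand for loops only. -/
lemma Program.LoopFree.exec {inp : Input} {c : Program} (hc : c.LoopFree) (s : State) :
    ∃ t, Exec inp c s (c.run inp s) t ∧ t ≤ c.maxCost := by
  induction c generalizing s with
  | skip => exact ⟨_, .skip s, le_rfl⟩
  | setInt k a => exact ⟨_, .setInt s k a, le_rfl⟩
  | setReal k a => exact ⟨_, .setReal s k a, le_rfl⟩
  | storeInt b a => exact ⟨_, .storeInt s b a, le_rfl⟩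
  | storeReal b a => exact ⟨_, .storeReal s b a, le_rfl⟩
  | writeInt a => exact ⟨_, .writeInt s a, le_rfl⟩
  | writeReal a => exact ⟨_, .writeReal s a, le_rfl⟩
  | seq c d ihc ihd =>
    obtain ⟨t₁, h₁, l₁⟩ := ihc hc.1 s
    obtain ⟨t₂, h₂, l₂⟩ := ihd hc.2 (c.run inp s)
    exact ⟨_, .seq h₁ h₂, add_le_add l₁ l₂⟩
  | ite b c d ihc ihd =>
    by_cases hb : b.Holds inp s
    · obtain ⟨t, h, l⟩ := ihc hc.1 s
      rw [Program.run, if_pos hb]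
      refine ⟨_, .iteTrue hb h, ?_⟩
      simp only [Program.maxCost]
      omega
    · obtain ⟨t, h, l⟩ := ihd hc.2 s
      rw [Program.run, if_neg hb]
      refine ⟨_, .iteFalse hb h, ?_⟩
      simp only [Program.maxCost]
      omega
  | loop b c => exact hc.elim

/-! ### Galloping search -/

/-- Exponential search followed by binary search: advances the pointer in register `r` to the last
position that passes the test `T`, which probes the position that is ahead of the pointer by the
contents of register `1`. -/
def gallop (r : ℕ) (T : Test) : Program :=
  .seq (.setInt 1 (.const 1)) <|
  .seq (.loop T (.seq (.setInt r (.add (.reg r) (.reg 1)))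
    (.setInt 1 (.add (.reg 1) (.reg 1))))) <|
  .loop (.intLt (.const 1) (.reg 1)) (.seq (.setInt 1 (.half (.reg 1)))
    (.ite T (.setInt r (.add (.reg r) (.reg 1))) .skip))

/-- The time of a galloping search per level. -/
def gallopCost (T : Test) : ℕ := 2 * T.cost + 21

/-- The state with new contents of register `r` and of register `1`. -/
def State.setPtr (s : State) (r : ℕ) (x y : ℤ) : State :=
  { s with intReg := Function.update (Function.update s.intReg r x) 1 y }

section Gallop

variable {inp : Input} {r : ℕ} {T : Test} {P : ℤ → Prop} {s : State} {b : ℤ}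

lemma setPtr_advance (hr : r ≠ 1) (x y : ℤ) :
    (Program.setInt r (.add (.reg r) (.reg 1))).run inp (s.setPtr r x y) =
      s.setPtr r (x + y) y := by
  simp only [Program.run, State.setPtr, IntExpr.eval, Function.update_self,
    Function.update_of_ne hr]
  rw [Function.update_comm hr.symm, Function.update_idem]

lemma setPtr_step (f : IntExpr) (x y : ℤ) :
    (Program.setInt 1 f).run inp (s.setPtr r x y) =
      s.setPtr r x (f.eval inp (s.setPtr r x y)) := by
  simp only [Program.run, State.setPtr]
  rw [Function.update_idem]

/-- After `i` doublings the pointer has advanced by `1 + 2 + ⋯ + 2 ^ (i - 1) = 2 ^ i - 1` and the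
step is `2 ^ i`. On exit the next probe fails, so `b` is less than one step ahead. The induction is
on a bound `N` for the remaining distance. -/
lemma exec_gallop_up (hr : r ≠ 1)
    (hT : ∀ x y, s.intReg r ≤ x → 0 < y → (T.Holds inp (s.setPtr r x y) ↔ P (x + y)))
    (hP : ∀ i, s.intReg r < i → (P i ↔ i ≤ b)) (N i : ℕ)
    (hi : s.intReg r + 2 ^ i - 1 ≤ b) (hN : b - (s.intReg r + 2 ^ i - 1) ≤ N) :
    ∃ v t : ℕ, s.intReg r + 2 ^ (i + v) - 1 ≤ b ∧ b < s.intReg r + 2 ^ (i + v) - 1 + 2 ^ (i + v) ∧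
      Exec inp (.loop T (.seq (.setInt r (.add (.reg r) (.reg 1)))
        (.setInt 1 (.add (.reg 1) (.reg 1)))))
        (s.setPtr r (s.intReg r + 2 ^ i - 1) (2 ^ i))
        (s.setPtr r (s.intReg r + 2 ^ (i + v) - 1) (2 ^ (i + v))) t ∧
      t ≤ (T.cost + 9) * v + (T.cost + 1) := by
  have h2 : ∀ i : ℕ, (1 : ℤ) ≤ 2 ^ i := fun i => one_le_pow₀ (by norm_num)
  induction N generalizing i with
  | zero =>
    refine ⟨0, _, by simpa using hi, ?_, .loopStop ?_, by simp⟩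
    · have := h2 i
      simp only [add_zero]
      push_cast at hN
      omega
    · rw [hT _ _ (by have := h2 i; omega) (by have := h2 i; omega),
        hP _ (by have := h2 i; omega)]
      have := h2 i
      push_cast at hN
      omega
  | succ N ih =>
    have h2i := h2 i
    by_cases hb : T.Holds inp (s.setPtr r (s.intReg r + 2 ^ i - 1) (2 ^ i))
    · have hb' := hb
      rw [hT _ _ (by omega) (by omega), hP _ (by omega)] at hb'
      have e : s.intReg r + 2 ^ i - 1 + 2 ^ i = s.intReg r + 2 ^ (i + 1) - 1 := by
        rw [pow_succ]; ring
      obtain ⟨v, t, k1, k2, k3, k4⟩ := ih (i + 1) (by rw [← e]; exact hb')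
        (by push_cast at hN; rw [← e]; omega)
      rw [show i + 1 + v = i + (v + 1) by ring] at k1 k2 k3
      obtain ⟨t', h', l'⟩ := Program.LoopFree.exec (inp := inp)
        (c := .seq (.setInt r (.add (.reg r) (.reg 1))) (.setInt 1 (.add (.reg 1) (.reg 1))))
        ⟨trivial, trivial⟩ (s.setPtr r (s.intReg r + 2 ^ i - 1) (2 ^ i))
      have e' : Program.run inp
          (.seq (.setInt r (.add (.reg r) (.reg 1))) (.setInt 1 (.add (.reg 1) (.reg 1))))
          (s.setPtr r (s.intReg r + 2 ^ i - 1) (2 ^ i)) =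
          s.setPtr r (s.intReg r + 2 ^ (i + 1) - 1) (2 ^ (i + 1)) := by
        rw [Program.run, setPtr_advance hr, setPtr_step, e]
        simp only [IntExpr.eval, State.setPtr, Function.update_self]
        rw [pow_succ, mul_two]
      rw [e'] at h'
      refine ⟨v + 1, _, k1, k2, .loopStep hb h' k3, ?_⟩
      simp only [Program.maxCost, IntExpr.cost] at l'
      rw [mul_add]
      omega
    · refine ⟨0, _, by simpa using hi, ?_, .loopStop hb, by simp⟩
      rw [hT _ _ (by omega) (by omega), hP _ (by omega), not_le] at hb
      simpa using hb

/-- Binary search with the invariant `x ≤ b < x + 2 ^ u`: each round halves the step and then probes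
the middle of the window. -/
lemma exec_gallop_down (hr : r ≠ 1)
    (hT : ∀ x y, s.intReg r ≤ x → 0 < y → (T.Holds inp (s.setPtr r x y) ↔ P (x + y)))
    (hP : ∀ i, s.intReg r < i → (P i ↔ i ≤ b)) (u : ℕ) (x : ℤ) (hx : s.intReg r ≤ x)
    (hxb : x ≤ b) (hbx : b < x + 2 ^ u) :
    ∃ t : ℕ, Exec inp (.loop (.intLt (.const 1) (.reg 1)) (.seq (.setInt 1 (.half (.reg 1)))
        (.ite T (.setInt r (.add (.reg r) (.reg 1))) .skip)))
        (s.setPtr r x (2 ^ u)) (s.setPtr r b 1) t ∧ t ≤ (T.cost + 12) * u + 4 := by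
  have hreg : ∀ x y, (s.setPtr r x y).intReg 1 = y := fun x y => by
    simp only [State.setPtr, Function.update_self]
  induction u generalizing x with
  | zero =>
    have : x = b := by simp only [pow_zero] at hbx; omega
    subst this
    refine ⟨_, .loopStop ?_, ?_⟩
    · simp only [Test.Holds, IntExpr.eval, hreg]
      norm_num
    · simp [Test.cost, IntExpr.cost]
  | succ u ih =>
    have h2u : (1 : ℤ) ≤ 2 ^ u := one_le_pow₀ (by norm_num)
    have hcond : (Test.intLt (.const 1) (.reg 1)).Holds inp (s.setPtr r x (2 ^ (u + 1))) := by
      simp only [Test.Holds, IntExpr.eval, hreg]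
      rw [pow_succ]
      omega
    have hhalf : (Program.setInt 1 (.half (.reg 1))).run inp (s.setPtr r x (2 ^ (u + 1))) =
        s.setPtr r x (2 ^ u) := by
      rw [setPtr_step]
      simp only [IntExpr.eval, hreg]
      rw [pow_succ, Int.mul_ediv_cancel _ two_ne_zero]
    have hTx := hT x (2 ^ u) hx (by omega)
    rw [hP _ (by omega)] at hTx
    obtain ⟨t₁, h₁, l₁⟩ := Program.LoopFree.exec (inp := inp)
      (c := .setInt 1 (.half (.reg 1))) trivial (s.setPtr r x (2 ^ (u + 1)))
    rw [hhalf] at h₁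
    simp only [Program.maxCost, IntExpr.cost] at l₁
    by_cases hb : T.Holds inp (s.setPtr r x (2 ^ u))
    · obtain ⟨t₂, h₂, l₂⟩ := Program.LoopFree.exec (inp := inp)
        (c := .setInt r (.add (.reg r) (.reg 1))) trivial (s.setPtr r x (2 ^ u))
      rw [setPtr_advance hr] at h₂
      simp only [Program.maxCost, IntExpr.cost] at l₂
      obtain ⟨t, h, l⟩ := ih (x + 2 ^ u) (by omega) (hTx.1 hb) (by rw [pow_succ] at hbx; omega)
      refine ⟨_, .loopStep hcond (.seq h₁ (.iteTrue hb h₂)) h, ?_⟩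
      simp only [Test.cost, IntExpr.cost]
      rw [mul_add]
      omega
    · obtain ⟨t, h, l⟩ := ih x hx hxb (not_le.1 (mt hTx.2 hb))
      refine ⟨_, .loopStep hcond (.seq h₁ (.iteFalse hb (.skip _))) h, ?_⟩
      simp only [Test.cost, IntExpr.cost]
      rw [mul_add]
      omega

/-- A galloping search over a distance `d` takes time `O(1 + log (1 + d))`. -/
lemma exec_gallop (hr : r ≠ 1)
    (hT : ∀ x y, s.intReg r ≤ x → 0 < y → (T.Holds inp (s.setPtr r x y) ↔ P (x + y)))
    (hP : ∀ i, s.intReg r < i → (P i ↔ i ≤ b)) (hb : s.intReg r ≤ b) :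
    ∃ u t : ℕ, Exec inp (gallop r T) s (s.setPtr r b 1) t ∧ 2 ^ u ≤ 1 + (b - s.intReg r) ∧
      t ≤ gallopCost T * (u + 1) := by
  obtain ⟨u, t₁, k1, k2, k3, k4⟩ := exec_gallop_up hr hT hP (b - s.intReg r).toNat 0
    (by simpa using hb) (by simp only [pow_zero]; omega)
  simp only [zero_add, pow_zero, add_sub_cancel_right] at k1 k2 k3
  have h2 : (1 : ℤ) ≤ 2 ^ u := one_le_pow₀ (by norm_num)
  obtain ⟨t₂, h₂, l₂⟩ := exec_gallop_down hr hT hP u _ (by omega) k1 k2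
  have h₀ : Exec inp (.setInt 1 (.const 1)) s (s.setPtr r (s.intReg r) 1) 2 := by
    have := Exec.setInt (inp := inp) s 1 (.const 1)
    simp only [State.setPtr, Function.update_eq_self]
    exact this
  refine ⟨u, _, .seq h₀ (.seq k3 h₂), by omega, ?_⟩
  -- A level costs at most `T.cost + 9` for doubling and `T.cost + 12` for halving; the remaining
  -- `T.cost + 7` is charged to the extra level in `u + 1`.
  unfold gallopCost
  nlinarith

end Gallop

end StripPartition

namespace StripPartition

/-! ### Cyclic access to the input -/

/-- The `x`-coordinate of vertex `i`, for `-n ≤ i < 2 n`. -/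
def xAt (i : IntExpr) : RealExpr :=
  .add (.add (.inputX i) (.inputX (.sub i .size))) (.inputX (.add i .size))

/-- The `y`-coordinate of vertex `i`, for `-n ≤ i < 2 n`. -/
def yAt (i : IntExpr) : RealExpr :=
  .add (.add (.inputY i) (.inputY (.sub i .size))) (.inputY (.add i .size))

/-- The integer part of the `x`-coordinate of vertex `i`, for `-n ≤ i < 2 n`. -/
def floorAt (i : IntExpr) : RealExpr :=
  .add (.add (.inputXFloor i) (.inputXFloor (.sub i .size))) (.inputXFloor (.add i .size))

section Input

variable {n : ℕ} [NeZero n] {p : Fin n → ℝ × ℝ}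

/-- Cells outside of the array read as zero, and exactly one of `z`, `z - n`, `z + n` is inside. So
a sum of three reads emulates access modulo `n` without a test. -/
lemma sum_window {g : ℤ → ℝ} (hg : ∀ z, g (z + n) = g z) {z : ℤ} (h1 : -n ≤ z) (h2 : z < 2 * n) :
    (if 0 ≤ z ∧ z < n then g z else 0) + (if 0 ≤ z - n ∧ z - n < n then g (z - n) else 0) +
      (if 0 ≤ z + n ∧ z + n < n then g (z + n) else 0) = g z := by
  have hn : (0 : ℤ) < n := by exact_mod_cast NeZero.pos n
  rcases lt_or_ge z 0 with h | h
  · rw [if_neg (by omega), if_neg (by omega), if_pos (by omega), hg]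
    ring
  · rcases lt_or_ge z n with h' | h'
    · rw [if_pos (by omega), if_neg (by omega), if_neg (by omega)]
      ring
    · rw [if_neg (by omega), if_pos (by omega), if_neg (by omega), ← hg (z - n), sub_add_cancel]
      ring

lemma cyc_of_mem {z : ℤ} (hz : 0 ≤ z ∧ z < n) : cyc p z = p ⟨z.toNat, by omega⟩ := by
  unfold cyc
  congr 1
  apply Fin.ext
  simp only [cycIdx]
  rw [Int.emod_eq_of_lt hz.1 hz.2]

lemma cyc_add_size (z : ℤ) : cyc p (z + n) = cyc p z := by
  unfold cyc
  congr 1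
  rw [cycIdx_eq_iff, Int.add_emod_right]

lemma inputOf_x (z : ℤ) : (inputOf p).x z = if 0 ≤ z ∧ z < n then (cyc p z).1 else 0 := by
  simp only [inputOf]
  split_ifs with h
  · rw [cyc_of_mem h]
  · rfl

lemma inputOf_y (z : ℤ) : (inputOf p).y z = if 0 ≤ z ∧ z < n then (cyc p z).2 else 0 := by
  simp only [inputOf]
  split_ifs with h
  · rw [cyc_of_mem h]
  · rfl

lemma inputOf_xFloor (z : ℤ) :
    (inputOf p).xFloor z = if 0 ≤ z ∧ z < n then (⌊(cyc p z).1⌋ : ℝ) else 0 := by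
  simp only [inputOf]
  split_ifs with h
  · rw [cyc_of_mem h]
  · rfl

lemma inputOf_size {n : ℕ} {p : Fin n → ℝ × ℝ} : (inputOf p).size = n := rfl

variable {s : State} {i : IntExpr}

lemma eval_xAt (h1 : -(n : ℤ) ≤ i.eval (inputOf p) s) (h2 : i.eval (inputOf p) s < 2 * n) :
    (xAt i).eval (inputOf p) s = (cyc p (i.eval (inputOf p) s)).1 := by
  simp only [xAt, RealExpr.eval, IntExpr.eval, inputOf_x, inputOf_size]
  exact sum_window (g := fun z => (cyc p z).1) (fun z => by rw [cyc_add_size]) h1 h2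

lemma eval_yAt (h1 : -(n : ℤ) ≤ i.eval (inputOf p) s) (h2 : i.eval (inputOf p) s < 2 * n) :
    (yAt i).eval (inputOf p) s = (cyc p (i.eval (inputOf p) s)).2 := by
  simp only [yAt, RealExpr.eval, IntExpr.eval, inputOf_y, inputOf_size]
  exact sum_window (g := fun z => (cyc p z).2) (fun z => by rw [cyc_add_size]) h1 h2

lemma eval_floorAt (h1 : -(n : ℤ) ≤ i.eval (inputOf p) s) (h2 : i.eval (inputOf p) s < 2 * n) :
    (floorAt i).eval (inputOf p) s = (⌊(cyc p (i.eval (inputOf p) s)).1⌋ : ℝ) := by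
  simp only [floorAt, RealExpr.eval, IntExpr.eval, inputOf_xFloor, inputOf_size]
  exact sum_window (g := fun z => (⌊(cyc p z).1⌋ : ℝ)) (fun z => by rw [cyc_add_size]) h1 h2

end Input

/-! ### The leftmost and the rightmost vertex -/

/-- Lexicographic comparison of the vertices `i` and `j`, after multiplication by `σ`. -/
def lexTest (σ : ℤ) (i j : IntExpr) : Test :=
  .neg (.conj
    (.neg (.realLt (.mul (.ofInt (.const σ)) (xAt i)) (.mul (.ofInt (.const σ)) (xAt j))))
    (.neg (.conj
      (.realEq (.mul (.ofInt (.const σ)) (xAt i)) (.mul (.ofInt (.const σ)) (xAt j)))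
      (.realLt (.mul (.ofInt (.const σ)) (yAt i)) (.mul (.ofInt (.const σ)) (yAt j))))))

/-- Probes whether the array rises from the start to the position ahead of register `2`. -/
def riseTest (σ : ℤ) : Test :=
  .conj (.intLt (.add (.reg 2) (.reg 1)) .size)
    (.conj (lexTest σ (.sub (.add (.reg 2) (.reg 1)) (.const 1)) (.add (.reg 2) (.reg 1)))
      -- After the minimum the edges rise again, but the vertices there are below vertex `0`, where
      -- that rise ends. This comparison makes the test a threshold.
      (lexTest σ (.const 0) (.add (.reg 2) (.reg 1))))

/-- Probes whether the array falls to the position ahead of register `3`. -/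
def fallTest (σ : ℤ) : Test :=
  -- Position `n` is admitted: it is vertex `0`, which may be the end of the fall.
  .conj (.intLt (.add (.reg 3) (.reg 1)) (.add .size (.const 1)))
    (lexTest σ (.add (.reg 3) (.reg 1)) (.sub (.add (.reg 3) (.reg 1)) (.const 1)))

/-- Finds the end of the initial rise and the end of the fall after it. -/
def findExtremes (σ : ℤ) : Program :=
  .seq (gallop 2 (riseTest σ)) (.seq (.setInt 3 (.reg 2)) (gallop 3 (fallTest σ)))

/-- Finds the leftmost vertex (register `4`) and the rightmost vertex (register `5`). -/
def findSpine : Program :=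
  .ite (lexTest 1 (.const 0) (.const 1))
    -- The maximum is shifted by a period so that it follows the minimum.
    (.seq (findExtremes 1) (.seq (.setInt 4 (.reg 3)) (.setInt 5 (.add (.reg 2) .size))))
    (.seq (findExtremes (-1)) (.seq (.setInt 4 (.reg 2)) (.setInt 5 (.reg 3))))

/-- Computes the width, rounded up, in the real register `0`. -/
def computeWidth : Program :=
  .seq (.setReal 0 (.sub (floorAt (.reg 5)) (floorAt (.reg 4))))
    (.ite (.realLt (.sub (xAt (.reg 4)) (floorAt (.reg 4))) (.sub (xAt (.reg 5)) (floorAt (.reg 5))))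
      (.setReal 0 (.add (.reg 0) (.ofInt (.const 1)))) .skip)

/-- The program that solves the value version. -/
def valueProgram : Program := .seq findSpine (.seq computeWidth (.writeReal (.reg 0)))

section FindSpine

variable {n : ℕ} [NeZero n] {p : Fin n → ℝ × ℝ}

lemma lexTest_holds {s : State} {σ : ℤ} {i j : IntExpr}
    (hi1 : -(n : ℤ) ≤ i.eval (inputOf p) s) (hi2 : i.eval (inputOf p) s < 2 * n)
    (hj1 : -(n : ℤ) ≤ j.eval (inputOf p) s) (hj2 : j.eval (inputOf p) s < 2 * n) :
    (lexTest σ i j).Holds (inputOf p) s ↔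
      toLex ((σ : ℝ) • cyc p (i.eval (inputOf p) s)) <
        toLex ((σ : ℝ) • cyc p (j.eval (inputOf p) s)) := by
  simp only [lexTest, Test.Holds, RealExpr.eval, eval_xAt hi1 hi2, eval_xAt hj1 hj2,
    eval_yAt hi1 hi2, eval_yAt hj1 hj2, IntExpr.eval, toLex_lt_iff, Prod.smul_fst, Prod.smul_snd,
    smul_eq_mul]
  tauto

/-- Ahead of the start, the rise test holds exactly up to the maximum `a`; ahead of `a`, the fall
test holds exactly up to the minimum `b`. Both are thus thresholds, as `exec_gallop` requires, and
both distances are less than `n`. -/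
lemma exec_findExtremes {σ : ℤ} (hq : IsCyclicPolygon n fun z => (σ : ℝ) • cyc p z)
    (h0 : toLex ((σ : ℝ) • cyc p 0) < toLex ((σ : ℝ) • cyc p 1)) {s : State}
    (hs : s.intReg 2 = 0) :
    ∃ (a b : ℤ) (s' : State) (t : ℕ), Exec (inputOf p) (findExtremes σ) s s' t ∧
      s'.intReg 2 = a ∧ s'.intReg 3 = b ∧ s'.out = s.out ∧ 1 ≤ a ∧ a < b ∧ b ≤ n ∧
      IsSpine n (fun z => (σ : ℝ) • cyc p z) (b - n) a ∧
      t ≤ (gallopCost (riseTest σ) + gallopCost (fallTest σ) + 2) * (Nat.log 2 n + 1) := by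
  obtain ⟨a, b, ha, hab, hb, hsp⟩ := hq.exists_isSpine_of_rise h0
  set q : ℤ → ℝ × ℝ := fun z => (σ : ℝ) • cyc p z with hqd
  have hper := hq.periodic
  obtain ⟨u, t₁, e₁, hu, l₁⟩ := exec_gallop (inp := inputOf p) (r := 2) (T := riseTest σ) (s := s)
    (b := a) (by decide)
    (P := fun i => i < n ∧ toLex (q (i - 1)) < toLex (q i) ∧ toLex (q 0) < toLex (q i)) (by
      intro x y hx hy
      rw [hs] at hx
      have ev : (IntExpr.add (.reg 2) (.reg 1)).eval (inputOf p) (s.setPtr 2 x y) = x + y := by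
        simp [IntExpr.eval, State.setPtr]
      simp only [riseTest, Test.Holds, ev]
      refine and_congr_right fun h => ?_
      change x + y < n at h
      rw [lexTest_holds, lexTest_holds] <;> simp only [IntExpr.eval] at ev ⊢ <;> (try rw [ev]) <;>
        omega) (by
      intro i hi
      rw [hs] at hi
      constructor
      · rintro ⟨h1, h2, h3⟩
        by_contra hc
        have hib : b < i := by
          by_contra hib
          have := hsp.fall (i - 1) (by omega) (by omega)
          rw [sub_add_cancel] at this
          exact h2.asymm this
        have := lt_of_forall_lt_succ (f := fun z => toLex (q z)) (a := i - n) (b := 0) (by omega)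
          (fun z hz hz' => hsp.rise z (by omega) (by omega))
        change toLex (q (i - n)) < toLex (q 0) at this
        rw [← hper (i - n), sub_add_cancel] at this
        exact h3.asymm this
      · intro h
        refine ⟨by omega, ?_, ?_⟩
        · have := hsp.rise (i - 1) (by omega) (by omega)
          rwa [sub_add_cancel] at this
        · exact lt_of_forall_lt_succ (f := fun z => toLex (q z)) (a := 0) (b := i) (by omega)
            (fun z hz hz' => hsp.rise z (by omega) (by omega))) (by omega)
  obtain ⟨t₂, e₂, l₂⟩ := Program.LoopFree.exec (inp := inputOf p) (c := .setInt 3 (.reg 2)) trivial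
    (s.setPtr 2 a 1)
  set s₂ := Program.run (inputOf p) (.setInt 3 (.reg 2)) (s.setPtr 2 a 1) with hs₂
  have hs3 : s₂.intReg 3 = a := by
    simp [hs₂, Program.run, State.setPtr, IntExpr.eval]
  obtain ⟨v, t₃, e₃, hv, l₃⟩ := exec_gallop (inp := inputOf p) (r := 3) (T := fallTest σ) (s := s₂)
    (b := b) (by decide)
    (P := fun i => i < n + 1 ∧ toLex (q i) < toLex (q (i - 1))) (by
      intro x y hx hy
      rw [hs3] at hx
      have ev : (IntExpr.add (.reg 3) (.reg 1)).eval (inputOf p) (s₂.setPtr 3 x y) = x + y := by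
        simp [IntExpr.eval, State.setPtr]
      simp only [fallTest, Test.Holds, ev]
      refine and_congr_right fun h => ?_
      change x + y < n + 1 at h
      rw [lexTest_holds] <;> simp only [IntExpr.eval] at ev ⊢ <;> (try rw [ev]) <;>
        omega) (by
      intro i hi
      rw [hs3] at hi
      constructor
      · rintro ⟨h1, h2⟩
        by_contra hc
        have := hsp.rise (i - 1 - n) (by omega) (by omega)
        rw [← hper, ← hper (i - 1 - n + 1), sub_add_cancel,
          show i - 1 - n + 1 + (n : ℤ) = i by ring] at this
        exact h2.asymm this
      · intro h
        refine ⟨by omega, ?_⟩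
        have := hsp.fall (i - 1) (by omega) (by omega)
        rwa [sub_add_cancel] at this) (by omega)
  refine ⟨a, b, _, _, .seq e₁ (.seq e₂ e₃), ?_, ?_, ?_, ha, hab, hb, hsp, ?_⟩
  · simp [hs₂, Program.run, State.setPtr, IntExpr.eval]
  · simp [State.setPtr]
  · simp [hs₂, Program.run, State.setPtr]
  · rw [hs] at hu
    rw [hs3] at hv
    have hu' : u ≤ Nat.log 2 n := Nat.le_log_of_pow_le one_lt_two (by zify; omega)
    have hv' : v ≤ Nat.log 2 n := Nat.le_log_of_pow_le one_lt_two (by zify; omega)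
    simp only [Program.maxCost, IntExpr.cost] at l₂
    have k1 := Nat.mul_le_mul_left (gallopCost (riseTest σ)) (Nat.add_le_add_right hu' 1)
    have k2 := Nat.mul_le_mul_left (gallopCost (fallTest σ)) (Nat.add_le_add_right hv' 1)
    rw [add_mul, add_mul]
    omega

/-- The cost of finding the extreme vertices, per level of the binary search. -/
def findSpineCost : ℕ :=
  (lexTest 1 (.const 0) (.const 1)).cost + 10 +
    (gallopCost (riseTest 1) + gallopCost (fallTest 1) + 2) +
    (gallopCost (riseTest (-1)) + gallopCost (fallTest (-1)) + 2)

/-- If the first edge falls, the search runs on the reflected polygon. The bounds on `m` keep all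
later vertex indices in the window on which `xAt` and `floorAt` are correct. -/
lemma exec_findSpine (hp : IsConvexPolygon p) :
    ∃ (m M : ℤ) (s : State) (t : ℕ), Exec (inputOf p) findSpine State.init s t ∧
      IsSpine n (cyc p) m M ∧ 0 ≤ m ∧ m ≤ n ∧ s.intReg 4 = m ∧ s.intReg 5 = M ∧ s.out = [] ∧
      t ≤ findSpineCost * (Nat.log 2 n + 1) := by
  have hq := hp.isCyclicPolygon
  have hn := hp.three_le
  have htest := lexTest_holds (p := p) (s := State.init) (σ := 1) (i := .const 0) (j := .const 1)
    (by simp only [IntExpr.eval]; omega) (by simp only [IntExpr.eval]; omega)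
    (by simp only [IntExpr.eval]; omega) (by simp only [IntExpr.eval]; omega)
  simp only [IntExpr.eval] at htest
  have hcost : ∀ x : ℕ, x ≤ x * (Nat.log 2 n + 1) := fun x => Nat.le_mul_of_pos_right _ (by omega)
  by_cases hb : (lexTest 1 (.const 0) (.const 1)).Holds (inputOf p) State.init
  · have h0 := htest.1 hb
    have hfun : (fun z => ((1 : ℤ) : ℝ) • cyc p z) = cyc p := by simp
    obtain ⟨a, b, s, t, e, ha', hb', hout, ha, hab, hbn, hsp, l⟩ :=
      exec_findExtremes (p := p) (σ := 1) (by rw [hfun]; exact hq) h0 (s := State.init) rfl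
    rw [hfun] at hsp
    have hsp := hsp.shift hq
    rw [sub_add_cancel] at hsp
    obtain ⟨t', e', l'⟩ := Program.LoopFree.exec (inp := inputOf p)
      (c := .seq (.setInt 4 (.reg 3)) (.setInt 5 (.add (.reg 2) .size))) ⟨trivial, trivial⟩ s
    refine ⟨b, a + n, _, _, .iteTrue hb (.seq e e'), hsp, by omega, hbn, ?_, ?_, ?_, ?_⟩
    · simp [Program.run, IntExpr.eval, hb']
    · simp [Program.run, IntExpr.eval, ha', inputOf_size]
    · simp only [Program.run, hout, State.init]
    · simp only [Program.maxCost, IntExpr.cost] at l'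
      have := hcost ((lexTest 1 (.const 0) (.const 1)).cost + 10)
      unfold findSpineCost
      rw [add_mul, add_mul _ _ (Nat.log 2 n + 1)]
      omega
  · have h0 : toLex (((-1 : ℤ) : ℝ) • cyc p 0) < toLex (((-1 : ℤ) : ℝ) • cyc p 1) := by
      rw [htest] at hb
      simp only [Int.cast_neg, Int.cast_one, neg_smul, one_smul, toLex_neg_lt_iff] at hb ⊢
      exact lt_of_le_of_ne (not_lt.1 hb) (hq.toLex_ne 0).symm
    have hfun : (fun z => ((-1 : ℤ) : ℝ) • cyc p z) = fun z => -cyc p z := by simp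
    obtain ⟨a, b, s, t, e, ha', hb', hout, ha, hab, hbn, hsp, l⟩ :=
      exec_findExtremes (p := p) (σ := -1) (by rw [hfun]; exact hq.neg) h0 (s := State.init) rfl
    rw [hfun] at hsp
    have hsp := hsp.of_neg hq
    rw [sub_add_cancel] at hsp
    obtain ⟨t', e', l'⟩ := Program.LoopFree.exec (inp := inputOf p)
      (c := .seq (.setInt 4 (.reg 2)) (.setInt 5 (.reg 3))) ⟨trivial, trivial⟩ s
    refine ⟨a, b, _, _, .iteFalse hb (.seq e e'), hsp, by omega, by omega, ?_, ?_, ?_, ?_⟩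
    · simp [Program.run, IntExpr.eval, ha']
    · simp [Program.run, IntExpr.eval, hb']
    · simp only [Program.run, hout, State.init]
    · simp only [Program.maxCost, IntExpr.cost] at l'
      have := hcost ((lexTest 1 (.const 0) (.const 1)).cost + 10)
      unfold findSpineCost
      rw [add_mul, add_mul _ _ (Nat.log 2 n + 1)]
      omega

/-- Rounds the width up without a floor instruction: the integer parts are given, and comparing the
fractional parts tells whether to add one. -/
lemma ceil_sub_eq {a b : ℝ} (hab : a < b) :
    ((⌈b - a⌉₊ : ℕ) : ℝ) = ⌊b⌋ - ⌊a⌋ + if a - ⌊a⌋ < b - ⌊b⌋ then 1 else 0 := by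
  rw [natCast_ceil_eq_intCast_ceil (by linarith)]
  have ha := Int.floor_le a
  have ha' := Int.lt_floor_add_one a
  have hb := Int.floor_le b
  have hb' := Int.lt_floor_add_one b
  split_ifs with h
  · have : ⌈b - a⌉ = ⌊b⌋ - ⌊a⌋ + 1 := by
      rw [Int.ceil_eq_iff]
      push_cast
      constructor <;> linarith
    rw [this]
    push_cast
    ring
  · have : ⌈b - a⌉ = ⌊b⌋ - ⌊a⌋ := by
      rw [Int.ceil_eq_iff]
      push_cast
      constructor <;> linarith
    rw [this]
    push_cast
    ring

lemma run_computeWidth {m M : ℤ} (hp : IsConvexPolygon p) (hs : IsSpine n (cyc p) m M)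
    (hm : 0 ≤ m) (hm' : m ≤ n) {s : State} (h4 : s.intReg 4 = m) (h5 : s.intReg 5 = M) :
    computeWidth.run (inputOf p) s =
      { s with realReg := Function.update s.realReg 0 (⌈(cyc p M).1 - (cyc p m).1⌉₊ : ℕ) } := by
  have h1 := hs.lt
  have h2 := hs.lt_add
  have e4 : ∀ s : State, s.intReg 4 = m → (xAt (.reg 4)).eval (inputOf p) s = (cyc p m).1 ∧
      (floorAt (.reg 4)).eval (inputOf p) s = ⌊(cyc p m).1⌋ := fun s h => by
    rw [eval_xAt, eval_floorAt] <;> simp only [IntExpr.eval, h, and_self] <;> omega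
  have e5 : ∀ s : State, s.intReg 5 = M → (xAt (.reg 5)).eval (inputOf p) s = (cyc p M).1 ∧
      (floorAt (.reg 5)).eval (inputOf p) s = ⌊(cyc p M).1⌋ := fun s h => by
    rw [eval_xAt, eval_floorAt] <;> simp only [IntExpr.eval, h, and_self] <;> omega
  rw [ceil_sub_eq (hs.fst_lt_fst hp)]
  simp only [computeWidth, Program.run, RealExpr.eval, Test.Holds, (e4 s h4).2, (e5 s h5).2,
    fun f : ℕ → ℝ => e4 { s with realReg := f } h4, fun f : ℕ → ℝ => e5 { s with realReg := f } h5]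
  split_ifs with h
  · simp [IntExpr.eval]
  · simp

end FindSpine

/-! ### From search depth to natural logarithms; the value version -/

lemma natCast_le_two_mul_log {u : ℕ} {x : ℝ} (hx : 2 ^ u ≤ x) : (u : ℝ) ≤ 2 * Real.log x := by
  have h := Real.log_le_log (by positivity) hx
  rw [Real.log_pow] at h
  have := Real.log_two_gt_d9
  nlinarith [Nat.cast_nonneg (α := ℝ) u]

lemma one_le_log_of_three_le {x : ℝ} (hx : 3 ≤ x) : 1 ≤ Real.log x := by
  rw [Real.le_log_iff_exp_le (by linarith)]
  linarith [Real.exp_one_lt_d9]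

/-- The additive `1` is at most `log n` because `n ≥ 3 > e`. -/
lemma log_add_one_le {n : ℕ} (hn : 3 ≤ n) : ((Nat.log 2 n + 1 : ℕ) : ℝ) ≤ 3 * Real.log n := by
  have h1 : (2 : ℝ) ^ Nat.log 2 n ≤ n := by
    exact_mod_cast Nat.pow_log_le_self 2 (by omega)
  have h2 := natCast_le_two_mul_log h1
  have h3 := one_le_log_of_three_le (x := n) (by exact_mod_cast hn)
  push_cast
  linarith

theorem value_version : ∃ (valueAlg : Program) (K : ℝ),
    ∀ (n : ℕ) [NeZero n] (p : Fin n → ℝ × ℝ), IsConvexPolygon p →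
      ∃ k t : ℕ, HaltsWith valueAlg p [Cell.real k] t ∧ IsOpt (region p) k ∧
        (t : ℝ) ≤ K * Real.log n := by
  refine ⟨valueProgram, 3 * (findSpineCost + computeWidth.maxCost + 2), fun n _ p hp => ?_⟩
  obtain ⟨m, M, s, t, e, hs, hm, hm', h4, h5, hout, l⟩ := exec_findSpine hp
  obtain ⟨t', e', l'⟩ := Program.LoopFree.exec (inp := inputOf p)
    (c := .seq computeWidth (.writeReal (.reg 0))) ⟨⟨trivial, trivial, trivial⟩, trivial⟩ s
  rw [Program.run, run_computeWidth hp hs hm hm' h4 h5] at e'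
  obtain ⟨C, hC⟩ := exists_unit_cuts n (cyc p) m M (cyc p m).1 ⌈(cyc p M).1 - (cyc p m).1⌉₊
  refine ⟨_, _, ⟨_, .seq e e', ?_⟩, (hs.isOpt_of_unit_cuts hp rfl hC).2.2, ?_⟩
  · simp [Program.run, hout, RealExpr.eval]
  · have hlog := log_add_one_le hp.three_le
    have h1 : t + t' ≤ (findSpineCost + computeWidth.maxCost + 2) * (Nat.log 2 n + 1) := by
      have e2 : (Program.seq computeWidth (.writeReal (.reg 0))).maxCost =
        computeWidth.maxCost + 2 := rfl
      have : computeWidth.maxCost + 2 ≤ (computeWidth.maxCost + 2) * (Nat.log 2 n + 1) :=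
        Nat.le_mul_of_pos_right _ (by omega)
      rw [add_assoc, add_mul]
      omega
    have h2 : ((t + t' : ℕ) : ℝ) ≤
        ((findSpineCost + computeWidth.maxCost + 2) * (Nat.log 2 n + 1) : ℕ) := by
      exact_mod_cast h1
    refine h2.trans ?_
    rw [Nat.cast_mul]
    refine (mul_le_mul_of_nonneg_left hlog (Nat.cast_nonneg _)).trans (le_of_eq ?_)
    push_cast
    ring

end StripPartition

namespace StripPartition

/-! ### The reporting program -/

/-- Probes whether the position ahead of register `6` on the lower chain is to the left of the
real register `4`. -/
def lowTest : Test :=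
  .conj (.intLt (.add (.reg 6) (.reg 1)) (.reg 5))
    (.realLt (xAt (.add (.reg 6) (.reg 1))) (.reg 4))

/-- Probes whether the position ahead of register `7` on the upper chain is to the left of the
real register `4`. -/
def upTest : Test :=
  .conj (.intLt (.add (.reg 7) (.reg 1)) (.sub .size (.reg 5)))
    (.realLt (xAt (.sub (.const 0) (.add (.reg 7) (.reg 1)))) (.reg 4))

/-- Writes the two edges at the current positions and the current abscissa. -/
def emitRecord : Program :=
  .seq (.setInt 8 (.reg 6)) <|
  .seq (.ite (.intLt (.reg 8) .size) .skip (.setInt 8 (.sub (.reg 8) .size))) <|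
  .seq (.setInt 9 (.sub (.const (-1)) (.reg 7))) <|
  .seq (.ite (.intLt (.reg 9) (.const 0)) (.setInt 9 (.add (.reg 9) .size)) .skip) <|
  .seq (.writeInt (.reg 9)) <|
  .seq (.writeInt (.reg 8)) (.writeReal (.reg 4))

/-- The integer part of the distance of vertex `i` from the leftmost vertex, in register `r`. -/
def floorDist (r : ℕ) (i : IntExpr) : Program :=
  .seq (.setReal r (.sub (floorAt i) (floorAt (.reg 4))))
    (.ite (.realLt (.sub (xAt i) (floorAt i)) (.sub (xAt (.reg 4)) (floorAt (.reg 4))))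
      (.setReal r (.sub (.reg r) (.ofInt (.const 1)))) .skip)

/-- Replaces the contents of the real register `a` by its minimum with the real register `b`. -/
def setMin (a b : ℕ) : Program := .ite (.realLt (.reg b) (.reg a)) (.setReal a (.reg b)) .skip

/-- Finds the end of the current run and writes its length. -/
def emitLength : Program :=
  .seq (floorDist 6 (.add (.reg 6) (.const 1))) <|
  .seq (floorDist 7 (.sub (.const (-1)) (.reg 7))) <|
  .seq (.setReal 5 (.sub (.reg 0) (.ofInt (.const 1)))) <|
  .seq (setMin 5 6) <|
  .seq (setMin 5 7) <|
  .seq (.writeReal (.add (.sub (.reg 5) (.reg 2)) (.ofInt (.const 1))))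
    (.setReal 2 (.add (.reg 5) (.ofInt (.const 1))))

/-- Finishes a record and advances to the next one. -/
def finishRecord : Program :=
  .ite (.realLt (.reg 3) (.ofInt .size)) (.setReal 2 (.add (.reg 2) (.ofInt (.const 1)))) emitLength

/-- One record of the output. -/
def reportBody : Program :=
  .seq (.setReal 4 (.add (.reg 1) (.reg 2))) <|
  .seq (gallop 6 lowTest) <|
  .seq (gallop 7 upTest) (.seq emitRecord finishRecord)

/-- The main loop: register `2` counts the cuts. -/
def reportLoop : Program := .loop (.realLt (.reg 2) (.reg 0)) reportBody

/-- Sets up the positions on the two chains. -/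
def initReport : Program :=
  .seq computeWidth <|
  .seq (.setInt 6 (.reg 4)) <|
  .seq (.setInt 7 (.sub (.const 0) (.reg 4))) <|
  .seq (.setReal 1 (xAt (.reg 4))) <|
  .seq (.setReal 2 (.ofInt (.const 1))) (.setReal 3 (.sub (xAt (.reg 5)) (xAt (.reg 4))))

/-- The program that solves the reporting version. -/
def reportProgram : Program := .seq findSpine (.seq initReport reportLoop)

/-! ### Runs of consecutive cuts -/

lemma exists_runs_cons {n : ℕ} (d : Descriptor n) (l : List (Descriptor n)) :
    ∃ r rs, runs (d :: l) = r :: rs ∧ r.topEdge = d.topEdge ∧ r.botEdge = d.botEdge := by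
  rw [runs]
  split
  · exact ⟨_, _, rfl, rfl, rfl⟩
  · split_ifs
    · exact ⟨_, _, rfl, rfl, rfl⟩
    · exact ⟨_, _, rfl, rfl, rfl⟩

/-- A block of consecutive cuts with the same edges is a run if the next cut has other edges. -/
lemma runs_expand_append {n : ℕ} (t b : Fin n) (L : ℕ) (rest : List (Descriptor n))
    (hrest : ∀ d l, rest = d :: l → ¬ (t = d.topEdge ∧ b = d.botEdge)) (x : ℝ) :
    runs (Run.expand ⟨t, b, x, L + 1⟩ ++ rest) = ⟨t, b, x, L + 1⟩ :: runs rest := by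
  induction L generalizing x with
  | zero =>
    rw [Run.expand_succ]
    change runs (⟨t, b, x⟩ :: rest) = _
    rw [runs]
    cases rest with
    | nil => simp [runs]
    | cons d l =>
      obtain ⟨r, rs, h, h1, h2⟩ := exists_runs_cons d l
      rw [h]
      have := hrest d l rfl
      simp only
      rw [if_neg]
      rintro ⟨g1, g2, -⟩
      exact this ⟨g1.trans h1, g2.trans h2⟩
  | succ L ih =>
    rw [Run.expand_succ, List.cons_append, runs, ih]
    simp

/-! ### Correctness of one iteration -/

section Report

variable {n : ℕ} [NeZero n] {p : Fin n → ℝ × ℝ} {m M : ℤ}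

/-- The abscissa of the cut number `j`. -/
noncomputable def cutX (p : Fin n → ℝ × ℝ) (m : ℤ) (j : ℕ) : ℝ := (cyc p m).1 + j

/-- The descriptors of the cuts from number `j` up to number `k - 1`. -/
noncomputable def descFrom (p : Fin n → ℝ × ℝ) (m M : ℤ) (k j : ℕ) : List (Descriptor n) :=
  (List.range' j (k - j)).map fun i => descAt n (cyc p) m M (cutX p m i)

/-- The contents of the registers in the main loop. -/
structure ReportInv (p : Fin n → ℝ × ℝ) (m M : ℤ) (k : ℕ) (s : State) (j : ℕ) (a b : ℤ) :
    Prop where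
  int4 : s.intReg 4 = m
  int5 : s.intReg 5 = M
  int6 : s.intReg 6 = a
  int7 : s.intReg 7 = b
  real0 : s.realReg 0 = k
  real1 : s.realReg 1 = (cyc p m).1
  real2 : s.realReg 2 = j
  real3 : s.realReg 3 = (cyc p M).1 - (cyc p m).1

lemma floor_sub_eq (a b : ℝ) :
    ((⌊b - a⌋ : ℤ) : ℝ) = ⌊b⌋ - ⌊a⌋ - if b - ⌊b⌋ < a - ⌊a⌋ then 1 else 0 := by
  have ha := Int.floor_le a
  have ha' := Int.lt_floor_add_one a
  have hb := Int.floor_le b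
  have hb' := Int.lt_floor_add_one b
  split_ifs with h
  · have : ⌊b - a⌋ = ⌊b⌋ - ⌊a⌋ - 1 := by
      rw [Int.floor_eq_iff]
      push_cast
      constructor <;> linarith
    rw [this]
    push_cast
    ring
  · have : ⌊b - a⌋ = ⌊b⌋ - ⌊a⌋ := by
      rw [Int.floor_eq_iff]
      push_cast
      constructor <;> linarith
    rw [this]
    push_cast
    ring

lemma run_floorDist {s : State} {r : ℕ} {i : IntExpr} {z : ℤ}
    (hi : ∀ f : ℕ → ℝ, i.eval (inputOf p) { s with realReg := f } = z)
    (h4 : s.intReg 4 = m) (hz : -(n : ℤ) ≤ z) (hz' : z < 2 * n) (hm : 0 ≤ m) (hm' : m ≤ n) :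
    (floorDist r i).run (inputOf p) s =
      { s with realReg := Function.update s.realReg r (⌊(cyc p z).1 - (cyc p m).1⌋ : ℤ) } := by
  have hn : (0 : ℤ) < n := by exact_mod_cast NeZero.pos n
  have e4 : ∀ f : ℕ → ℝ, (xAt (.reg 4)).eval (inputOf p) { s with realReg := f } = (cyc p m).1 ∧
      (floorAt (.reg 4)).eval (inputOf p) { s with realReg := f } = ⌊(cyc p m).1⌋ := fun f => by
    rw [eval_xAt, eval_floorAt] <;> simp only [IntExpr.eval, h4, and_self] <;> omega
  have ei : ∀ f : ℕ → ℝ, (xAt i).eval (inputOf p) { s with realReg := f } = (cyc p z).1 ∧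
      (floorAt i).eval (inputOf p) { s with realReg := f } = ⌊(cyc p z).1⌋ := fun f => by
    rw [eval_xAt, eval_floorAt] <;> simp only [hi, and_self] <;> omega
  rw [floor_sub_eq]
  simp only [floorDist, Program.run, RealExpr.eval, Test.Holds, (e4 s.realReg).2,
    (ei s.realReg).2, e4, ei]
  split_ifs with h
  · simp [IntExpr.eval]
  · simp

lemma run_setMin (inp : Input) (a b : ℕ) (s : State) :
    (setMin a b).run inp s =
      { s with realReg := Function.update s.realReg a (min (s.realReg a) (s.realReg b)) } := by
  by_cases h : (Test.realLt (.reg b) (.reg a)).Holds inp s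
  · rw [setMin, Program.run, if_pos h, min_eq_right (show s.realReg b ≤ s.realReg a from le_of_lt h)]
    rfl
  · rw [setMin, Program.run, if_neg h, min_eq_left (show s.realReg a ≤ s.realReg b from not_lt.1 h),
      Function.update_eq_self]
    rfl

lemma run_emitRecord {k j : ℕ} {a b : ℤ} {X : ℝ} {s : State}
    (hI : ReportInv p m M k s j a b) (hX : s.realReg 4 = X) (ha : 0 ≤ a) (ha' : a < 2 * n)
    (hb : -(n : ℤ) ≤ -b - 1) (hb' : -b - 1 < n) :
    ReportInv p m M k (emitRecord.run (inputOf p) s) j a b ∧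
      (emitRecord.run (inputOf p) s).out = s.out ++
        [.int (cycIdx n (-b - 1) : ℕ), .int (cycIdx n a : ℕ), .real X] := by
  have ea : (cycIdx n a : ℕ) = if a < n then a else a - n := by
    rw [cycIdx_val]
    split_ifs with h
    · exact Int.emod_eq_of_lt ha h
    · rw [← Int.sub_emod_right, Int.emod_eq_of_lt (by omega) (by omega)]
  have eb : (cycIdx n (-b - 1) : ℕ) = if -1 - b < 0 then -1 - b + n else -1 - b := by
    rw [cycIdx_val, show -b - 1 = -1 - b by ring]
    split_ifs with h
    · rw [← Int.add_emod_right, Int.emod_eq_of_lt (by omega) (by omega)]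
    · exact Int.emod_eq_of_lt (by omega) (by omega)
  obtain ⟨h4, h5, h6, h7, r0, r1, r2, r3⟩ := hI
  rw [ea, eb]
  by_cases c1 : a < n <;> by_cases c2 : -1 - b < 0 <;>
  · simp only [emitRecord, Program.run, Test.Holds, IntExpr.eval, RealExpr.eval, inputOf_size]
    simp only [Function.update_self, h6, h7, c1, c2, if_true, if_false, ne_eq, not_false_eq_true,
      Function.update_of_ne, Nat.reduceEqDiff, hX, List.append_assoc,
      List.cons_append, List.nil_append, and_true]
    constructor <;> simp [h4, h5, h6, h7, r0, r1, r2, r3]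

/-- The last cut of the run that starts with the current one. -/
noncomputable def runEnd (p : Fin n → ℝ × ℝ) (m : ℤ) (k : ℕ) (a b : ℤ) : ℤ :=
  min (min (k - 1) ⌊(cyc p (a + 1)).1 - (cyc p m).1⌋) ⌊(cyc p (-b - 1)).1 - (cyc p m).1⌋

/-- A run ends at the last cut or where the current lower or upper edge ends, whichever comes first.
Integer parts of distances are computed in real registers, as reals cannot be turned into integers.
-/
lemma run_emitLength {k j : ℕ} {a b : ℤ} {s : State}
    (hI : ReportInv p m M k s j a b) (hm : 0 ≤ m) (hm' : m ≤ n) (ha : 0 ≤ a) (ha' : a + 1 < 2 * n)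
    (hb : -(n : ℤ) ≤ -b - 1) (hb' : -b - 1 < n) (hj : j ≤ runEnd p m k a b) :
    ReportInv p m M k (emitLength.run (inputOf p) s) (runEnd p m k a b + 1).toNat a b ∧
      (emitLength.run (inputOf p) s).out = s.out ++
        [.real (((runEnd p m k a b + 1).toNat - j : ℕ) : ℝ)] := by
  set e := runEnd p m k a b with he
  have hecast : (e : ℝ) = min (min ((k : ℝ) - 1) (⌊(cyc p (a + 1)).1 - (cyc p m).1⌋ : ℤ))
      (⌊(cyc p (-b - 1)).1 - (cyc p m).1⌋ : ℤ) := by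
    rw [he, runEnd]
    push_cast
    rfl
  have hnat : (((e + 1).toNat : ℕ) : ℝ) = (e : ℝ) + 1 := by
    rw [← Int.cast_natCast, Int.toNat_of_nonneg (by omega)]
    push_cast
    rfl
  -- The truncated subtraction is exact because the run contains the current cut, by `hj`.
  rw [Nat.cast_sub (by omega), hnat]
  obtain ⟨h4, h5, h6, h7, r0, r1, r2, r3⟩ := hI
  have hseq : ∀ (c d : Program) (s : State),
      (Program.seq c d).run (inputOf p) s = d.run (inputOf p) (c.run (inputOf p) s) :=
    fun _ _ _ => rfl
  simp only [emitLength, hseq]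
  rw [run_floorDist (p := p) (m := m) (z := a + 1) (fun f => by simp [IntExpr.eval, h6]) h4
    (by omega) (by omega) hm hm']
  have h7' := fun f : ℕ → ℝ => run_floorDist (p := p) (m := m) (r := 7) (z := -b - 1)
    (i := .sub (.const (-1)) (.reg 7)) (s := { s with realReg := f })
    (fun f => by simp only [IntExpr.eval, h7]; ring) h4 (by omega) (by omega) hm hm'
  rw [h7']
  have hset : ∀ (c : RealExpr) (s : State), (Program.setReal 5 c).run (inputOf p) s =
      { s with realReg := Function.update s.realReg 5 (c.eval (inputOf p) s) } := fun _ _ => rfl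
  rw [hset, run_setMin, run_setMin]
  simp only [Program.run]
  have hr : ∀ i j : ℕ, i ≠ j → ∀ (f : ℕ → ℝ) v, Function.update f j v i = f i :=
    fun i j h f v => Function.update_of_ne h v f
  simp only [RealExpr.eval, IntExpr.eval, Function.update_self, hr 6 7 (by decide),
    hr 6 5 (by decide), hr 7 5 (by decide), hr 0 7 (by decide), hr 0 6 (by decide),
    hr 2 5 (by decide), hr 2 6 (by decide), hr 2 7 (by decide), r0, r2, Int.cast_one, ← hecast]
  refine ⟨⟨h4, h5, h6, h7, ?_, ?_, ?_, ?_⟩, ?_⟩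
  · simp [r0]
  · simp [r1]
  · simp [hnat]
  · simp [r3]
  · congr 3
    ring

end Report

end StripPartition

namespace StripPartition

/-! ### Run ends on the two chains and the main loop -/

section Report

variable {n : ℕ} [NeZero n] {p : Fin n → ℝ × ℝ} {m M : ℤ} {k : ℕ}

lemma cycIdx_inj_of_lt {z w : ℤ} (h : cycIdx n z = cycIdx n w) (h1 : -(n : ℤ) < z - w)
    (h2 : z - w < n) : z = w := by
  rw [cycIdx_eq_iff] at h
  by_contra hne
  exact not_dvd_of_abs_lt (sub_ne_zero.2 hne) h1 h2 (Int.ModEq.dvd (Eq.symm h : w ≡ z [ZMOD n]))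

/-- Positions only advance as the cuts move to the right, so each search can start where the
previous one ended. -/
lemma IsBreak.mono {f : ℤ → ℝ} {s e : ℤ} {X Y : ℝ} {b c : ℤ} (hb : IsBreak f s e X b)
    (hc : IsBreak f s e Y c) (h : X ≤ Y) : b ≤ c :=
  (hc.iff b hb.le hb.lt.le).1 (hb.lt_left.trans_le h)

lemma cutX_mem (hk : k = ⌈(cyc p M).1 - (cyc p m).1⌉₊) {j : ℕ} (h1 : 1 ≤ j) (h2 : j < k) :
    (cyc p m).1 < cutX p m j ∧ cutX p m j < (cyc p M).1 := by
  have h1 : (1 : ℝ) ≤ j := by exact_mod_cast h1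
  have h2 : (j : ℝ) < (cyc p M).1 - (cyc p m).1 := Nat.lt_ceil.1 (hk ▸ h2)
  constructor <;> unfold cutX <;> linarith

lemma descFrom_cons {j : ℕ} (hj : j < k) :
    descFrom p m M k j = descAt n (cyc p) m M (cutX p m j) :: descFrom p m M k (j + 1) := by
  unfold descFrom
  rw [show k - j = (k - (j + 1)) + 1 by omega, List.range'_succ, List.map_cons]

lemma descFrom_self : descFrom p m M k k = [] := by
  simp [descFrom]

lemma descFrom_append {j L : ℕ} {t b : Fin n} (hL : j + L ≤ k)
    (h : ∀ i < L, descAt n (cyc p) m M (cutX p m (j + i)) = ⟨t, b, cutX p m (j + i)⟩) :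
    descFrom p m M k j = Run.expand ⟨t, b, cutX p m j, L⟩ ++ descFrom p m M k (j + L) := by
  unfold descFrom
  rw [show k - j = L + (k - (j + L)) by omega, ← List.range'_append_1, List.map_append]
  congr 1
  rw [List.range'_eq_map_range, List.map_map, Run.expand]
  refine List.map_congr_left fun i hi => ?_
  rw [Function.comp_apply, h i (List.mem_range.1 hi)]
  simp only [cutX, Nat.cast_add, add_assoc]

lemma hybridCode_of_lt {n : ℕ} {p : Fin n → ℝ × ℝ} {ds : List (Descriptor n)} (h : hwidth (region p) < n) :
    hybridCode p ds = literalCode ds := if_pos h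

lemma hybridCode_of_not_lt {n : ℕ} {p : Fin n → ℝ × ℝ} {ds : List (Descriptor n)} (h : ¬ hwidth (region p) < n) :
    hybridCode p ds = runLengthCode ds := if_neg h

/-- The cuts of a run span the same edges, and the next cut does not. -/
lemma runEnd_spec (hp : IsConvexPolygon p) (hs : IsSpine n (cyc p) m M)
    (hk : k = ⌈(cyc p M).1 - (cyc p m).1⌉₊) {j : ℕ} {a b : ℤ} (h1 : 1 ≤ j) (h2 : j < k)
    (ha : a = lowPos (cyc p) m M (cutX p m j)) (hb : b = upPos n (cyc p) m M (cutX p m j)) :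
    j ≤ runEnd p m k a b ∧ runEnd p m k a b ≤ k - 1 ∧
    (∀ i : ℕ, j ≤ i → i ≤ runEnd p m k a b → lowPos (cyc p) m M (cutX p m i) = a ∧
      upPos n (cyc p) m M (cutX p m i) = b) ∧
    (∀ i : ℕ, (i : ℤ) = runEnd p m k a b + 1 → i < k →
      a < lowPos (cyc p) m M (cutX p m i) ∨ b < upPos n (cyc p) m M (cutX p m i)) := by
  obtain ⟨g1, g2⟩ := cutX_mem hk h1 h2
  have hA := hs.isBreak_lowPos g1 g2
  have hB := hs.isBreak_upPos hp g1 g2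
  rw [← ha] at hA
  rw [← hb] at hB
  have hAl := hA.lt_left
  have hAr := hA.le_right
  have hBl := hB.lt_left
  have hBr := hB.le_right
  have hup : upX (cyc p) (b + 1) = (cyc p (-b - 1)).1 := by
    rw [upX, neg_add]
    rfl
  have hlow : lowX (cyc p) (a + 1) = (cyc p (a + 1)).1 := rfl
  set e := runEnd p m k a b with he
  have e1 : e ≤ k - 1 := (min_le_left _ _).trans (min_le_left _ _)
  have e2 : e ≤ ⌊(cyc p (a + 1)).1 - (cyc p m).1⌋ := (min_le_left _ _).trans (min_le_right _ _)
  have e3 : e ≤ ⌊(cyc p (-b - 1)).1 - (cyc p m).1⌋ := min_le_right _ _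
  -- The current cut is not to the right of either edge's right end, and its distance from the
  -- leftmost points is an integer, so rounding down does not lose it.
  have hji : (j : ℤ) ≤ e := by
    refine le_min (le_min (by omega) ?_) ?_ <;> rw [Int.le_floor, Int.cast_natCast]
    · rw [← hlow]
      unfold cutX at hAr
      linarith
    · rw [← hup]
      unfold cutX at hBr
      linarith
  refine ⟨hji, e1, fun i hi hi' => ?_, fun i hi hi' => ?_⟩
  · have hij : cutX p m j ≤ cutX p m i := by
      have : (j : ℝ) ≤ i := by exact_mod_cast hi
      unfold cutX
      linarith
    obtain ⟨f1, f2⟩ := cutX_mem (p := p) hk (h1.trans hi) (by omega)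
    have k2 := Int.le_floor.1 (hi'.trans e2)
    have k3 := Int.le_floor.1 (hi'.trans e3)
    rw [Int.cast_natCast] at k2 k3
    constructor
    · refine ((hs.isBreak_lowPos f1 f2).unique hA.le hA.lt (hAl.trans_le hij) ?_).symm
      rw [hlow]
      unfold cutX
      linarith
    · refine ((hs.isBreak_upPos hp f1 f2).unique hB.le hB.lt (hBl.trans_le hij) ?_).symm
      rw [hup]
      unfold cutX
      linarith
  · obtain ⟨f1, f2⟩ := cutX_mem (p := p) hk (show 1 ≤ i by omega) hi'
    have hcast : ((i : ℤ) : ℝ) = i := Int.cast_natCast i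
    -- A cut beyond the minimum that is still a cut must have passed the right end of one of the two
    -- edges.
    have hor : ⌊(cyc p (a + 1)).1 - (cyc p m).1⌋ < i ∨
        ⌊(cyc p (-b - 1)).1 - (cyc p m).1⌋ < i := by
      by_contra hc
      push Not at hc
      have : (i : ℤ) ≤ e := le_min (le_min (by omega) hc.1) hc.2
      omega
    rcases hor with h | h <;> rw [Int.floor_lt, hcast] at h
    · left
      refine ((hs.isBreak_lowPos f1 f2).iff (a + 1) (by have := hA.le; omega) hA.lt).1 ?_
      rw [hlow]
      unfold cutX
      linarith
    · right
      refine ((hs.isBreak_upPos hp f1 f2).iff (b + 1) (by have := hB.le; omega) hB.lt).1 ?_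
      rw [hup]
      unfold cutX
      linarith

/-- The output followed by the code of the remaining cuts is invariant. In run-length form the next
record starts on a later edge of one of the chains, which bounds the number of records. -/
lemma run_finishRecord (hp : IsConvexPolygon p) (hs : IsSpine n (cyc p) m M) (hm : 0 ≤ m)
    (hm' : m ≤ n) (hk : k = ⌈(cyc p M).1 - (cyc p m).1⌉₊) {j : ℕ} {a b : ℤ}
    (h1 : 1 ≤ j) (h2 : j < k) (ha : a = lowPos (cyc p) m M (cutX p m j))
    (hb : b = upPos n (cyc p) m M (cutX p m j)) {s : State} (hI : ReportInv p m M k s j a b)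
    {w : List Cell} (hw : s.out = w ++ [.int (cycIdx n (-b - 1) : ℕ), .int (cycIdx n a : ℕ),
      .real (cutX p m j)]) :
    ∃ j', j < j' ∧ j' ≤ k ∧ ReportInv p m M k (finishRecord.run (inputOf p) s) j' a b ∧
      (finishRecord.run (inputOf p) s).out ++ hybridCode p (descFrom p m M k j') =
        w ++ hybridCode p (descFrom p m M k j) ∧
      (¬ (cyc p M).1 - (cyc p m).1 < n → j' < k →
        a < lowPos (cyc p) m M (cutX p m j') ∨ b < upPos n (cyc p) m M (cutX p m j')) := by
  obtain ⟨g1, g2⟩ := cutX_mem hk h1 h2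
  have hA := hs.isBreak_lowPos g1 g2
  have hB := hs.isBreak_upPos hp g1 g2
  rw [← ha] at hA
  rw [← hb] at hB
  have b1 := hA.le
  have b2 := hA.lt
  have b3 := hB.le
  have b4 := hB.lt
  have b5 := hs.lt
  have b6 := hs.lt_add
  have htest : (Test.realLt (.reg 3) (.ofInt .size)).Holds (inputOf p) s ↔
      hwidth (region p) < n := by
    simp only [Test.Holds, RealExpr.eval, IntExpr.eval, inputOf_size, hI.real3, hs.hwidth_eq hp,
      Int.cast_natCast]
  rw [← hs.hwidth_eq hp]
  by_cases hlt : hwidth (region p) < n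
  · refine ⟨j + 1, by omega, by omega, ?_⟩
    rw [finishRecord, Program.run, if_pos (htest.2 hlt), hybridCode_of_lt hlt,
      hybridCode_of_lt hlt, descFrom_cons h2]
    obtain ⟨h4, h5, h6, h7, r0, r1, r2, r3⟩ := hI
    refine ⟨?_, ?_, fun h => absurd hlt h⟩
    · constructor <;> simp [Program.run, RealExpr.eval, IntExpr.eval, h4, h5, h6, h7, r0, r1, r2,
        r3]
    · simp only [Program.run, hw, literalCode, List.flatMap_cons, descAt, ← ha, ← hb,
        List.append_assoc]
  · obtain ⟨e1, e2, e3, e4⟩ := runEnd_spec hp hs hk h1 h2 ha hb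
    obtain ⟨i1, i2⟩ := run_emitLength hI hm hm' (by omega) (by omega) (by omega) (by omega) e1
    set e := runEnd p m k a b
    rw [finishRecord, Program.run, if_neg (mt htest.1 hlt)]
    refine ⟨(e + 1).toNat, by omega, by omega, i1, ?_, fun _ => e4 _ (by omega)⟩
    rw [hybridCode_of_not_lt hlt, hybridCode_of_not_lt hlt]
    obtain ⟨L, hL⟩ : ∃ L : ℕ, (e + 1).toNat = j + (L + 1) := ⟨(e + 1).toNat - j - 1, by omega⟩
    have happ := descFrom_append (p := p) (m := m) (M := M) (k := k) (j := j) (L := L + 1)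
      (t := cycIdx n (-b - 1)) (b := cycIdx n a) (by omega) (fun i hi => by
        obtain ⟨l1, l2⟩ := e3 (j + i) (by omega) (by omega)
        rw [descAt, l1, l2])
    rw [i2, hw, hL, happ, runLengthCode, runLengthCode, runs_expand_append, List.flatMap_cons]
    · simp
    -- Positions on one chain differ by less than `n`, so equal edges would mean equal positions.
    · rintro d l hd ⟨t1, t2⟩
      have hjk : j + (L + 1) < k := by
        by_contra hc
        rw [show j + (L + 1) = k by omega, descFrom_self] at hd
        simp at hd
      rw [descFrom_cons hjk] at hd
      obtain ⟨rfl, -⟩ := List.cons.inj hd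
      obtain ⟨f1, f2⟩ := cutX_mem (p := p) hk (show 1 ≤ j + (L + 1) by omega) hjk
      have hA' := hs.isBreak_lowPos f1 f2
      have hB' := hs.isBreak_upPos hp f1 f2
      have c1 := hA'.le
      have c2 := hA'.lt
      have c3 := hB'.le
      have c4 := hB'.lt
      simp only [descAt] at t1 t2
      have u1 := cycIdx_inj_of_lt t1 (by omega) (by omega)
      have u2 := cycIdx_inj_of_lt t2 (by omega) (by omega)
      rcases e4 _ (by omega) hjk with h | h <;> omega

/-- The time of an iteration of the main loop, per level of the galloping searches. -/
def reportBodyCost : ℕ :=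
  gallopCost lowTest + gallopCost upTest + emitRecord.maxCost + finishRecord.maxCost + 8

lemma exec_reportBody (hp : IsConvexPolygon p) (hs : IsSpine n (cyc p) m M) (hm : 0 ≤ m)
    (hm' : m ≤ n) (hk : k = ⌈(cyc p M).1 - (cyc p m).1⌉₊) {j : ℕ} {a b : ℤ}
    (h1 : 1 ≤ j) (h2 : j < k) {s : State} (hI : ReportInv p m M k s j a b)
    (ha : m ≤ a) (hb : -m ≤ b) (ha' : a ≤ lowPos (cyc p) m M (cutX p m j))
    (hb' : b ≤ upPos n (cyc p) m M (cutX p m j)) :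
    ∃ (s' : State) (t j' v w : ℕ), Exec (inputOf p) reportBody s s' t ∧ j < j' ∧ j' ≤ k ∧
      ReportInv p m M k s' j' (lowPos (cyc p) m M (cutX p m j))
        (upPos n (cyc p) m M (cutX p m j)) ∧
      s'.out ++ hybridCode p (descFrom p m M k j') =
        s.out ++ hybridCode p (descFrom p m M k j) ∧
      (¬ (cyc p M).1 - (cyc p m).1 < n → j' < k →
        lowPos (cyc p) m M (cutX p m j) < lowPos (cyc p) m M (cutX p m j') ∨
        upPos n (cyc p) m M (cutX p m j) < upPos n (cyc p) m M (cutX p m j')) ∧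
      2 ^ v ≤ 1 + (lowPos (cyc p) m M (cutX p m j) - a) ∧
      2 ^ w ≤ 1 + (upPos n (cyc p) m M (cutX p m j) - b) ∧
      -- The `4` pays for the loop test.
      t + 4 ≤ reportBodyCost * (v + w + 1) := by
  obtain ⟨g1, g2⟩ := cutX_mem hk h1 h2
  have hA := hs.isBreak_lowPos g1 g2
  have hB := hs.isBreak_upPos hp g1 g2
  set a' := lowPos (cyc p) m M (cutX p m j) with hda
  set b' := upPos n (cyc p) m M (cutX p m j) with hdb
  have b1 := hA.le
  have b2 := hA.lt
  have b3 := hB.le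
  have b4 := hB.lt
  have b5 := hs.lt
  have b6 := hs.lt_add
  obtain ⟨h4, h5, h6, h7, r0, r1, r2, r3⟩ := hI
  obtain ⟨t₁, x₁, l₁⟩ := Program.LoopFree.exec (inp := inputOf p)
    (c := .setReal 4 (.add (.reg 1) (.reg 2))) trivial s
  set s₁ := Program.run (inputOf p) (.setReal 4 (.add (.reg 1) (.reg 2))) s with hs₁
  have q4 : s₁.intReg 4 = m := h4
  have q5 : s₁.intReg 5 = M := h5
  have q6 : s₁.intReg 6 = a := h6
  have q7 : s₁.intReg 7 = b := h7
  have qX : s₁.realReg 4 = cutX p m j := by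
    simp [hs₁, Program.run, RealExpr.eval, r1, r2, cutX]
  obtain ⟨v, t₂, x₂, hv, l₂⟩ := exec_gallop (inp := inputOf p) (r := 6) (T := lowTest) (s := s₁)
    (b := a') (by decide) (P := fun i => i < M ∧ (cyc p i).1 < cutX p m j) (by
      intro x y hx hy
      rw [q6] at hx
      have ev : (IntExpr.add (.reg 6) (.reg 1)).eval (inputOf p) (s₁.setPtr 6 x y) = x + y := by
        simp [IntExpr.eval, State.setPtr]
      have ev5 : (s₁.setPtr 6 x y).intReg 5 = M := by simp [State.setPtr, q5]
      have ev4 : (s₁.setPtr 6 x y).realReg 4 = cutX p m j := qX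
      simp only [lowTest, Test.Holds, ev]
      simp only [IntExpr.eval, RealExpr.eval, ev5, ev4]
      refine and_congr_right fun h => ?_
      rw [eval_xAt, ev] <;> rw [ev] <;> omega) (by
      intro i hi
      rw [q6] at hi
      constructor
      · rintro ⟨k1, k2⟩
        exact (hA.iff i (by omega) k1.le).1 k2
      · intro k1
        exact ⟨by omega, (hA.iff i (by omega) (by omega)).2 k1⟩) (by rw [q6]; exact ha')
  set s₂ := s₁.setPtr 6 a' 1 with hs₂
  have w4 : s₂.intReg 4 = m := by simp [hs₂, State.setPtr, q4]
  have w5 : s₂.intReg 5 = M := by simp [hs₂, State.setPtr, q5]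
  have w6 : s₂.intReg 6 = a' := by simp [hs₂, State.setPtr]
  have w7 : s₂.intReg 7 = b := by simp [hs₂, State.setPtr, q7]
  have wX : s₂.realReg 4 = cutX p m j := qX
  obtain ⟨w, t₃, x₃, hw, l₃⟩ := exec_gallop (inp := inputOf p) (r := 7) (T := upTest) (s := s₂)
    (b := b') (by decide) (P := fun i => i < n - M ∧ (cyc p (-i)).1 < cutX p m j) (by
      intro x y hx hy
      rw [w7] at hx
      have ev : (IntExpr.add (.reg 7) (.reg 1)).eval (inputOf p) (s₂.setPtr 7 x y) = x + y := by
        simp [IntExpr.eval, State.setPtr]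
      have ev' : (IntExpr.sub (.const 0) (.add (.reg 7) (.reg 1))).eval (inputOf p)
          (s₂.setPtr 7 x y) = -(x + y) := by
        rw [IntExpr.eval, ev, IntExpr.eval, zero_sub]
      have ev5 : (s₂.setPtr 7 x y).intReg 5 = M := by simp [State.setPtr, w5]
      have ev4 : (s₂.setPtr 7 x y).realReg 4 = cutX p m j := wX
      simp only [upTest, Test.Holds, ev]
      simp only [IntExpr.eval, RealExpr.eval, ev5, ev4, inputOf_size]
      refine and_congr_right fun h => ?_
      rw [eval_xAt, ev'] <;> rw [ev'] <;> omega) (by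
      intro i hi
      rw [w7] at hi
      constructor
      · rintro ⟨k1, k2⟩
        exact (hB.iff i (by omega) k1.le).1 k2
      · intro k1
        exact ⟨by omega, (hB.iff i (by omega) (by omega)).2 k1⟩) (by rw [w7]; exact hb')
  set s₃ := s₂.setPtr 7 b' 1 with hs₃
  have hI₃ : ReportInv p m M k s₃ j a' b' := by
    refine ⟨?_, ?_, ?_, ?_, ?_, ?_, ?_, ?_⟩
    · simp [hs₃, State.setPtr, w4]
    · simp [hs₃, State.setPtr, w5]
    · simp [hs₃, State.setPtr, w6]
    · simp [hs₃, State.setPtr]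
    · simp [hs₃, hs₂, hs₁, State.setPtr, Program.run, r0]
    · simp [hs₃, hs₂, hs₁, State.setPtr, Program.run, r1]
    · simp [hs₃, hs₂, hs₁, State.setPtr, Program.run, r2]
    · simp [hs₃, hs₂, hs₁, State.setPtr, Program.run, r3]
  obtain ⟨t₄, x₄, l₄⟩ := Program.LoopFree.exec (inp := inputOf p) (c := emitRecord)
    ⟨trivial, ⟨trivial, trivial⟩, trivial, ⟨trivial, trivial⟩, trivial, trivial, trivial⟩ s₃
  obtain ⟨hI₄, o₄⟩ := run_emitRecord hI₃ (wX : s₃.realReg 4 = _) (by omega) (by omega) (by omega)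
    (by omega)
  obtain ⟨t₅, x₅, l₅⟩ := Program.LoopFree.exec (inp := inputOf p) (c := finishRecord)
    ⟨trivial, ⟨trivial, trivial, trivial⟩, ⟨trivial, trivial, trivial⟩, trivial,
      ⟨trivial, trivial⟩, ⟨trivial, trivial⟩, trivial, trivial⟩ (emitRecord.run (inputOf p) s₃)
  obtain ⟨j', d1, d2, d3, d4, d5⟩ := run_finishRecord hp hs hm hm' hk h1 h2 hda hdb hI₄ o₄
  refine ⟨_, _, j', v, w, .seq x₁ (.seq x₂ (.seq x₃ (.seq x₄ x₅))), d1, d2, d3, d4, d5, ?_, ?_, ?_⟩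
  · rwa [q6] at hv
  · rwa [w7] at hw
  · simp only [Program.maxCost, RealExpr.cost] at l₁
    have : gallopCost lowTest * (v + 1) ≤ gallopCost lowTest * (v + w + 1) :=
      Nat.mul_le_mul_left _ (by omega)
    have : gallopCost upTest * (w + 1) ≤ gallopCost upTest * (v + w + 1) :=
      Nat.mul_le_mul_left _ (by omega)
    have : emitRecord.maxCost + finishRecord.maxCost + 8 ≤
        (emitRecord.maxCost + finishRecord.maxCost + 8) * (v + w + 1) :=
      Nat.le_mul_of_pos_right _ (by omega)
    unfold reportBodyCost
    rw [add_assoc (gallopCost lowTest + _), add_assoc (gallopCost lowTest + _), add_mul, add_mul]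
    omega

/-- The main loop, with a linear bound `α + β d` on the time of an iteration that advances the two
positions by `d`. -/
lemma exec_reportLoop (hp : IsConvexPolygon p) (hs : IsSpine n (cyc p) m M) (hm : 0 ≤ m)
    (hm' : m ≤ n) (hk : k = ⌈(cyc p M).1 - (cyc p m).1⌉₊) {α β : ℝ} (hβ : 0 ≤ β)
    -- A bound linear in the advances telescopes over the iterations: in total, `α` times their
    -- number plus `β` times the length of the chains.
    (hαβ : ∀ (v w : ℕ) (d e : ℤ), 2 ^ v ≤ 1 + d → 2 ^ w ≤ 1 + e →
      (reportBodyCost : ℝ) * (v + w + 1) ≤ α + β * (d + e))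
    (N j : ℕ) (hN : k - j ≤ N) (h1 : 1 ≤ j) (h2 : j ≤ k) {a b : ℤ} {s : State}
    (hI : ReportInv p m M k s j a b) (ha : m ≤ a) (hb : -m ≤ b) (haM : a ≤ M) (hbM : b ≤ n - M)
    (hab : j < k → a ≤ lowPos (cyc p) m M (cutX p m j) ∧
      b ≤ upPos n (cyc p) m M (cutX p m j)) :
    ∃ (s' : State) (t r : ℕ), Exec (inputOf p) reportLoop s s' t ∧
      s'.out = s.out ++ hybridCode p (descFrom p m M k j) ∧
      (t : ℝ) ≤ α * r + β * ((M - a) + (n - M - b)) + 4 ∧ r ≤ k - j ∧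
      (¬ (cyc p M).1 - (cyc p m).1 < n → j < k →
        (r : ℤ) ≤ 1 + (M - lowPos (cyc p) m M (cutX p m j)) +
          (n - M - upPos n (cyc p) m M (cutX p m j))) := by
  have hcond : ∀ {s : State} {j : ℕ} {a b : ℤ}, ReportInv p m M k s j a b →
      ((Test.realLt (.reg 2) (.reg 0)).Holds (inputOf p) s ↔ j < k) := fun hI => by
    simp only [Test.Holds, RealExpr.eval, hI.real0, hI.real2, Nat.cast_lt]
  have hnil : hybridCode p (descFrom p m M k k) = [] := by
    rw [descFrom_self, hybridCode]
    split_ifs <;> rfl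
  induction N generalizing j a b s with
  | zero =>
    have : j = k := by omega
    subst this
    refine ⟨s, _, 0, .loopStop (mt (hcond hI).1 (lt_irrefl _)), by rw [hnil, List.append_nil], ?_,
      by omega, fun _ h => absurd h (lt_irrefl _)⟩
    have h1 : (a : ℝ) ≤ M := by exact_mod_cast haM
    have h2 : (b : ℝ) ≤ n - M := by exact_mod_cast hbM
    have := mul_nonneg hβ (by linarith : (0 : ℝ) ≤ (M - a) + (n - M - b))
    simp only [Test.cost, RealExpr.cost, Nat.cast_zero]
    norm_num
    exact this
  | succ N ih =>
    rcases h2.eq_or_lt with h | h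
    · exact ih j (by omega) h1 h2 hI ha hb haM hbM hab
    · obtain ⟨ha', hb'⟩ := hab h
      obtain ⟨s₁, t₁, j', v, w, x₁, d1, d2, d3, d4, d5, hv, hw, l₁⟩ :=
        exec_reportBody hp hs hm hm' hk h1 h hI ha hb ha' hb'
      obtain ⟨g1, g2⟩ := cutX_mem hk h1 h
      have hA := hs.isBreak_lowPos g1 g2
      have hB := hs.isBreak_upPos hp g1 g2
      set a' := lowPos (cyc p) m M (cutX p m j)
      set b' := upPos n (cyc p) m M (cutX p m j)
      have hnext : j' < k → a' ≤ lowPos (cyc p) m M (cutX p m j') ∧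
          b' ≤ upPos n (cyc p) m M (cutX p m j') := fun hj' => by
        obtain ⟨f1, f2⟩ := cutX_mem (p := p) hk (h1.trans d1.le) hj'
        have hle : cutX p m j ≤ cutX p m j' := by
          have : (j : ℝ) ≤ j' := by exact_mod_cast d1.le
          unfold cutX
          linarith
        exact ⟨hA.mono (hs.isBreak_lowPos f1 f2) hle, hB.mono (hs.isBreak_upPos hp f1 f2) hle⟩
      obtain ⟨s', t₂, r, x₂, o₂, l₂, r₁, r₂⟩ := ih j' (by omega) (by omega) d2 d3
        hA.le hB.le hA.lt.le hB.lt.le hnext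
      refine ⟨s', _, r + 1, .loopStep ((hcond hI).2 h) x₁ x₂, by rw [o₂, d4], ?_, by omega,
        fun hn _ => ?_⟩
      · have hc := hαβ v w _ _ hv hw
        have l₁' : (t₁ : ℝ) + 4 ≤ reportBodyCost * (v + w + 1) := by exact_mod_cast l₁
        simp only [Test.cost, RealExpr.cost]
        push_cast at hc l₂ ⊢
        linarith
      -- In run-length form every iteration but the last moves one of the positions forward, so the
      -- number of edges ahead drops; the last iteration accounts for the `1`.
      · rcases d2.eq_or_lt with hj' | hj'
        · have := hA.lt
          have := hB.lt
          omega
        · have := r₂ hn hj'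
          have := hnext hj'
          rcases d5 hn hj' with h' | h' <;> omega

lemma run_initReport (hp : IsConvexPolygon p) (hs : IsSpine n (cyc p) m M) (hm : 0 ≤ m)
    (hm' : m ≤ n) {s : State} (h4 : s.intReg 4 = m) (h5 : s.intReg 5 = M) :
    ReportInv p m M ⌈(cyc p M).1 - (cyc p m).1⌉₊ (initReport.run (inputOf p) s) 1 m (-m) ∧
      (initReport.run (inputOf p) s).out = s.out := by
  have b5 := hs.lt
  have b6 := hs.lt_add
  have e4 : ∀ s : State, s.intReg 4 = m → (xAt (.reg 4)).eval (inputOf p) s = (cyc p m).1 :=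
    fun s h => by rw [eval_xAt] <;> simp only [IntExpr.eval, h] <;> omega
  have e5 : ∀ s : State, s.intReg 5 = M → (xAt (.reg 5)).eval (inputOf p) s = (cyc p M).1 :=
    fun s h => by rw [eval_xAt] <;> simp only [IntExpr.eval, h] <;> omega
  have hseq : ∀ (c d : Program) (s : State),
      (Program.seq c d).run (inputOf p) s = d.run (inputOf p) (c.run (inputOf p) s) :=
    fun _ _ _ => rfl
  rw [initReport, hseq, run_computeWidth hp hs hm hm' h4 h5]
  refine ⟨?_, rfl⟩
  constructor <;> simp [Program.run, RealExpr.eval, IntExpr.eval, h4, h5, e4, e5]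

end Report

/-! ### The running time -/

/-- Bernoulli's inequality `1 + x ≤ (1 + x / h) ^ h`. It absorbs the time for finding the extreme
vertices into the reporting bound. -/
lemma log_le_mul_log_one_add_div {x h : ℝ} (hx : 1 ≤ x) (hh : 1 ≤ h) :
    Real.log x ≤ h * Real.log (1 + x / h) := by
  have h0 : 0 < 1 + x / h := by positivity
  rw [← Real.log_rpow h0]
  refine Real.log_le_log (by linarith) ?_
  have := one_add_mul_self_le_rpow_one_add (s := x / h) (by
    have : 0 ≤ x / h := by positivity
    linarith) hh
  rw [mul_div_cancel₀ _ (by linarith : h ≠ 0)] at this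
  linarith

lemma div_one_add_le_log {x : ℝ} (hx : 0 ≤ x) : x / (1 + x) ≤ Real.log (1 + x) := by
  have := Real.one_sub_inv_le_log_of_pos (show 0 < 1 + x by linarith)
  have e : 1 - (1 + x)⁻¹ = x / (1 + x) := by
    field_simp
    ring
  rwa [e] at this

/-- The tangent to the logarithm at `1 + x` bounds the depth of a galloping search. -/
lemma natCast_le_of_two_pow_le {v : ℕ} {d : ℤ} {x : ℝ} (hx : 0 ≤ x) (h : (2 : ℤ) ^ v ≤ 1 + d) :
    (v : ℝ) ≤ 2 * Real.log (1 + x) + 2 / (1 + x) * d := by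
  have h' : (2 : ℝ) ^ v ≤ 1 + d := by exact_mod_cast h
  have hd : (0 : ℝ) < 1 + d := lt_of_lt_of_le (by positivity) h'
  have h1 := natCast_le_two_mul_log h'
  have h2 := Real.log_le_sub_one_of_pos (show 0 < (1 + d) / (1 + x) by positivity)
  rw [Real.log_div hd.ne' (by linarith)] at h2
  have h3 : (1 + d) / (1 + x) - 1 ≤ 1 / (1 + x) * d := by
    rw [div_mul_eq_mul_div, one_mul, sub_le_iff_le_add, div_add_one (by linarith)]
    exact div_le_div_of_nonneg_right (by linarith) (by linarith)
  have : 2 / (1 + x) * d = 2 * (1 / (1 + x) * d) := by ring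
  linarith

lemma natCast_le_of_two_pow_le' {v : ℕ} {d : ℤ} (h : (2 : ℤ) ^ v ≤ 1 + d) : (v : ℝ) ≤ d := by
  have : ((v + 1 : ℕ) : ℤ) ≤ 2 ^ v := by exact_mod_cast Nat.lt_two_pow_self
  have : (v : ℤ) ≤ d := by
    push_cast at this
    omega
  exact_mod_cast this

theorem reporting_version : ∃ (reportAlg : Program) (K : ℝ),
    ∀ (n : ℕ) [NeZero n] (p : Fin n → ℝ × ℝ), IsConvexPolygon p →
      ∀ h : ℝ, h = hwidth (region p) → 1 ≤ h →
        ∃ (C : Finset VSegment) (w : List Cell) (t : ℕ),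
          HaltsWith reportAlg p w t ∧ IsCodeword p C w ∧
          IsOptimalStripPartition (region p) C ∧
          VSegment.x '' (C : Set VSegment) =
            {a | ∃ j : ℕ, 1 ≤ j ∧ j < ⌈h⌉₊ ∧ a = leftX (region p) + j} ∧
          (t : ℝ) ≤ K * (h * Real.log (1 + n / h)) := by
  refine ⟨reportProgram, 3 * (findSpineCost + initReport.maxCost + 4) + 8 * reportBodyCost,
    fun n _ p hp h hh h1 => ?_⟩
  obtain ⟨m, M, s, t, e, hs, hm, hm', h4, h5, hout, l⟩ := exec_findSpine hp
  rw [hs.hwidth_eq hp] at hh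
  obtain ⟨k, hk⟩ : ∃ k, k = ⌈(cyc p M).1 - (cyc p m).1⌉₊ := ⟨_, rfl⟩
  obtain ⟨t', e', l'⟩ := Program.LoopFree.exec (inp := inputOf p) (c := initReport)
    ⟨⟨trivial, trivial, trivial⟩, trivial, trivial, trivial, trivial, trivial⟩ s
  obtain ⟨hI, hout'⟩ := run_initReport hp hs hm hm' h4 h5
  rw [hout] at hout'
  rw [← hk] at hI
  have hn3 : (3 : ℝ) ≤ n := by exact_mod_cast hp.three_le
  have hh0 : 0 < h := by linarith
  have hx0 : 0 ≤ (n : ℝ) / h := by positivity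
  have hk1 : 1 ≤ k := by
    rw [hk, ← hh]
    exact Nat.ceil_pos.2 hh0
  have hkh : ((k - 1 : ℕ) : ℝ) ≤ h := by
    have : k - 1 < ⌈h⌉₊ := by rw [hh, ← hk]; omega
    exact (Nat.lt_ceil.1 this).le
  have hlow : 1 < k → m ≤ lowPos (cyc p) m M (cutX p m 1) ∧
      -m ≤ upPos n (cyc p) m M (cutX p m 1) := fun hj => by
    obtain ⟨f1, f2⟩ := cutX_mem (p := p) hk le_rfl hj
    exact ⟨(hs.isBreak_lowPos f1 f2).le, (hs.isBreak_upPos hp f1 f2).le⟩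
  have hlog := div_one_add_le_log hx0
  set x : ℝ := (n : ℝ) / h with hx
  set c : ℝ := (reportBodyCost : ℝ) with hc
  have hc0 : 0 ≤ c := Nat.cast_nonneg _
  have hnx : (n : ℝ) = h * x := by
    rw [hx]
    field_simp
  -- the time of the loop
  obtain ⟨s', t'', e'', hout'', l''⟩ : ∃ (s' : State) (t'' : ℕ),
      Exec (inputOf p) reportLoop (initReport.run (inputOf p) s) s' t'' ∧
      s'.out = hybridCode p (descFrom p m M k 1) ∧
      (t'' : ℝ) ≤ 8 * c * (h * Real.log (1 + x)) + 4 := by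
    have hlt := hs.lt
    have hlt' := hs.lt_add
    by_cases hlt : h < n
    · have hx1 : 1 ≤ x := by
        rw [hx, le_div_iff₀ hh0]
        linarith
      have hlog2 : 1 / 2 ≤ Real.log (1 + x) := by
        refine le_trans ?_ hlog
        rw [div_le_div_iff₀ two_pos (by linarith)]
        linarith
      -- The tangent is taken at `1 + x` with `x = n / h`. Per unit of `c h log (1 + x)`, the total
      -- is at most `4`, plus `2` for the summand `1` since `log (1 + x) ≥ 1 / 2`, plus `2` for the
      -- advances: this is the `8`.
      obtain ⟨s', t'', r, k1, k2, k3, k4, -⟩ := exec_reportLoop hp hs hm hm' hk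
        (α := c * (4 * Real.log (1 + x) + 1)) (β := c * (2 / (1 + x))) (by positivity)
        (fun v w d e hv hw => by
          have g1 := natCast_le_of_two_pow_le hx0 hv
          have g2 := natCast_le_of_two_pow_le hx0 hw
          rw [mul_assoc, ← mul_add]
          refine mul_le_mul_of_nonneg_left ?_ hc0
          linarith)
        (k - 1) 1 le_rfl le_rfl hk1 hI le_rfl le_rfl (by omega) (by omega) hlow
      rw [hout', List.nil_append] at k2
      refine ⟨s', t'', k1, k2, k3.trans ?_⟩
      have hr : (r : ℝ) ≤ h := le_trans (by exact_mod_cast k4) hkh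
      have hR : ((M : ℝ) - m + (n - M - (-m : ℤ))) = h * x := by
        rw [← hnx]
        push_cast
        ring
      rw [hR]
      have g1 : c * (4 * Real.log (1 + x) + 1) * r ≤ c * (4 * Real.log (1 + x) + 1) * h :=
        mul_le_mul_of_nonneg_left hr (mul_nonneg hc0 (by linarith))
      have g2 : c * (2 / (1 + x)) * (h * x) = 2 * (c * h) * (x / (1 + x)) := by ring
      have g3 : 2 * (c * h) * (x / (1 + x)) ≤ 2 * (c * h) * Real.log (1 + x) :=
        mul_le_mul_of_nonneg_left hlog (by positivity)
      have g4 : c * h * (1 / 2) ≤ c * h * Real.log (1 + x) :=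
        mul_le_mul_of_nonneg_left hlog2 (by positivity)
      rw [g2]
      linarith
    · have hx1 : x ≤ 1 := by
        rw [hx, div_le_one hh0]
        linarith
      -- For `n ≤ h` the crude bound `v ≤ d` suffices: there are at most `1 + n` records and `n`
      -- advances, and `n ≤ 2 h log (1 + x)` because `x ≤ 1`.
      obtain ⟨s', t'', r, k1, k2, k3, k4, k5⟩ := exec_reportLoop hp hs hm hm' hk
        (α := c) (β := c) hc0
        (fun v w d e hv hw => by
          have g1 := natCast_le_of_two_pow_le' hv
          have g2 := natCast_le_of_two_pow_le' hw
          rw [← mul_one_add]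
          refine mul_le_mul_of_nonneg_left ?_ hc0
          linarith)
        (k - 1) 1 le_rfl le_rfl hk1 hI le_rfl le_rfl (by omega) (by omega) hlow
      rw [hout', List.nil_append] at k2
      refine ⟨s', t'', k1, k2, k3.trans ?_⟩
      have hr : (r : ℝ) ≤ 1 + n := by
        have : (r : ℤ) ≤ 1 + n := by
          rcases hk1.eq_or_lt with hk' | hk'
          · omega
          · have := k5 (by rwa [← hh]) hk'
            have := hlow hk'
            omega
        exact_mod_cast this
      have hR : ((M : ℝ) - m + (n - M - (-m : ℤ))) = n := by
        push_cast
        ring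
      rw [hR]
      have hlog2 : x / 2 ≤ Real.log (1 + x) := by
        refine le_trans ?_ hlog
        gcongr
        linarith
      have g1 : c * r ≤ c * (1 + n) := mul_le_mul_of_nonneg_left hr hc0
      have g2 : c * n ≤ 2 * (c * (h * Real.log (1 + x))) := by
        have := mul_le_mul_of_nonneg_left hlog2 (mul_nonneg hc0 hh0.le)
        rw [hnx]
        linarith
      have g3 : c ≤ c * n := by nlinarith
      linarith
  obtain ⟨C, hC⟩ := exists_unit_cuts n (cyc p) m M (cyc p m).1 k
  obtain ⟨o1, o2, o3⟩ := hs.isOpt_of_unit_cuts hp hk hC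
  refine ⟨C, hybridCode p (descFrom p m M k 1), _, ⟨s', .seq e (.seq e' e''), hout''⟩, ?_,
    ⟨o1, k, o3, o2⟩, ?_, ?_⟩
  · have hmap : descFrom p m M k 1 =
        ((List.range' 1 (k - 1)).map fun j => cutX p m j).map (descAt n (cyc p) m M) := by
      rw [List.map_map]
      rfl
    rw [hmap]
    refine hs.isCodeword_of_pairwise hp ?_ ?_ ?_
    · rw [List.pairwise_map]
      refine (List.pairwise_lt_range' (s := 1) (n := k - 1)).imp fun {i j} hij => ?_
      have : (i : ℝ) < j := by exact_mod_cast hij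
      unfold cutX
      linarith
    · intro X hX
      obtain ⟨j, hj, rfl⟩ := List.mem_map.1 hX
      rw [List.mem_range'_1] at hj
      exact cutX_mem hk hj.1 (by omega)
    · intro c
      rw [hC]
      constructor
      · rintro ⟨j, j1, j2, rfl⟩
        exact ⟨_, List.mem_map.2 ⟨j, by rw [List.mem_range'_1]; omega, rfl⟩, rfl⟩
      · rintro ⟨X, hX, rfl⟩
        obtain ⟨j, hj, rfl⟩ := List.mem_map.1 hX
        rw [List.mem_range'_1] at hj
        exact ⟨j, hj.1, by omega, rfl⟩
  · rw [hs.leftX_eq hp, hh, ← hk]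
    ext a
    constructor
    · rintro ⟨c, hc, rfl⟩
      obtain ⟨j, j1, j2, rfl⟩ := (hC c).1 hc
      exact ⟨j, j1, j2, rfl⟩
    · rintro ⟨j, j1, j2, rfl⟩
      exact ⟨_, (hC _).2 ⟨j, j1, j2, rfl⟩, rfl⟩
  · have hH := log_le_mul_log_one_add_div (x := n) (by linarith) h1
    rw [← hx] at hH
    have hlogn := (log_add_one_le hp.three_le).trans (mul_le_mul_of_nonneg_left hH (by norm_num))
    have k1 : t + t' + 4 ≤ (findSpineCost + initReport.maxCost + 4) * (Nat.log 2 n + 1) := by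
      have : initReport.maxCost + 4 ≤ (initReport.maxCost + 4) * (Nat.log 2 n + 1) :=
        Nat.le_mul_of_pos_right _ (by omega)
      rw [add_assoc findSpineCost, add_mul]
      omega
    have k2 : (t : ℝ) + t' + 4 ≤
        (findSpineCost + initReport.maxCost + 4) * ((Nat.log 2 n + 1 : ℕ) : ℝ) := by
      exact_mod_cast k1
    have k3 := mul_le_mul_of_nonneg_left hlogn
      (show (0 : ℝ) ≤ findSpineCost + initReport.maxCost + 4 by positivity)
    push_cast at k2 k3 ⊢
    linarith

end StripPartition

theorem mainTheorem4 :
    -- value version, in time `O(log n)`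
    (∃ (valueAlg : Program) (K : ℝ),
      ∀ (n : ℕ) [NeZero n] (p : Fin n → ℝ × ℝ), IsConvexPolygon p →
        ∃ k t : ℕ, HaltsWith valueAlg p [Cell.real k] t ∧ IsOpt (region p) k ∧
          (t : ℝ) ≤ K * Real.log n) ∧
    -- the hybrid encoding is a lossless encoding scheme for strip partitions
    (∀ (n : ℕ) [NeZero n] (p : Fin n → ℝ × ℝ), IsConvexPolygon p →
      (∀ C, IsStripPartition (region p) C → ∃! w, IsCodeword p C w) ∧
      (∀ C C' w, IsStripPartition (region p) C → IsStripPartition (region p) C' →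
        IsCodeword p C w → IsCodeword p C' w → C = C')) ∧
    -- reporting version, in time `O(h log (1 + n / h))`, with cuts at unit distances
    (∃ (reportAlg : Program) (K : ℝ),
      ∀ (n : ℕ) [NeZero n] (p : Fin n → ℝ × ℝ), IsConvexPolygon p →
        ∀ h : ℝ, h = hwidth (region p) → 1 ≤ h →
          ∃ (C : Finset VSegment) (w : List Cell) (t : ℕ),
            HaltsWith reportAlg p w t ∧ IsCodeword p C w ∧
            IsOptimalStripPartition (region p) C ∧
            VSegment.x '' (C : Set VSegment) =
              {a | ∃ j : ℕ, 1 ≤ j ∧ j < ⌈h⌉₊ ∧ a = leftX (region p) + j} ∧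
            (t : ℝ) ≤ K * (h * Real.log (1 + n / h))) :=
  ⟨StripPartition.value_version, fun _ _ _ hp => StripPartition.hybrid_lossless hp,
    StripPartition.reporting_version⟩
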